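/- **Setting.** Let $\mathcal G=(V,E)$ be a finite connected undirected block graph (every block, i.e. maximal biconnected subgraph, is complete). "Clique" means maximal clique. For $u,v\in V$ let $(u\rightsquigarrow v)$ be the sequence of edges, directed away from $u$, of the unique shortest path from $u$ to $v$. Let $X=(X_v)_{v\in V}$ be a random vector with values in $[0,\infty)^V$ satisfying the global Markov property: $X_A\perp\!\!\!\perp X_B\mid X_S$ for all non-empty disjoint $A,B,S\subseteq V$ such that every path from $A$ to $B$ meets $S$. For every clique $C$ and $s\in C$ fix a version of the conditional law of $X_{C\setminus s}=(X_v)_{v\in C\setminus\{s\}}$ given $X_s$. Assume: 1. For every clique $C$ and $s\in C$ there is a probability measure $\nu_{C,s}$ on $[0,\infty)^{C\setminus s}$ such that $\mathcal L(X_{C\setminus s}/t\mid X_s=t)\to\nu_{C,s}$ weakly as $t\to\infty$. 2. Let $u\in V$, let $s$ be a node such that $\{s\}$ is a minimal separator of two distinct cliques, and let $C$ be a clique containing $s$ but no other node of the shortest path from $u$ to $s$. If some edge $(a,b)\in(u\rightsquigarrow s)$, with $C'$ the clique containing $a$ and $b$, is such that the $b$-th margin of $\nu_{C',a}$ has positive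 mass at $0$, then for every $\eta>0$, $$\limsup_{\delta\downarrow0}\ \limsup_{t\to\infty}\ \sup_{x\in[0,\delta]}\mathbb P\bigl(\exists v\in C\setminus s:\ X_v/t>\eta\ \big|\ X_s/t=x\bigr)=0.$$ 3. $t\,\mathbb P(X_v>t)\to1$ as $t\to\infty$, for every $v\in V$. For $u\in V$ and a clique $C$, let $s=s(u,C)$ be $u$ if $u\in C$, and otherwise the unique node of $C$ through which every path from $u$ to a node of $C$ passes. Let $(Z_{sv})_{v\in C\setminus s}$ have law $\nu_{C,s}$, independently for different cliques $C$, and put $A_{uv}=\prod_{e\in(u\rightsquigarrow v)}Z_e$, $A_{uu}=1$, $A_u=(A_{uv})_{v\in V}$. Let $\mathcal M_0$ be the set of Borel measures on $[0,\infty)^V\setminus\{0\}$ that are finite on Borel subsets of $\{x:\max_v x_v\ge\varepsilon\}$ for every $\varepsilon>0$, with the smallest topology making $\mu\mapsto\int f\,\mathrm d\mu$ continuous for every real-valued bounded continuous $f$ on $[0,\infty)^V\setminus\{0\}$ that vanishes in a neighbourhood of the origin. **Claim.** There is $\mu\in\mathcal M_0$ such that $t\,\mathbb P(t^{-1}X\in\cdot\,)\to\mu$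 in $\mathcal M_0$ as $t\to\infty$. For all $u\in V$ and all Borel functions $f:[0,\infty)^V\setminus\{0\}\to[0,\infty]$, $$\int f(x)\,\mathbf 1\{x_u>0\}\,\mathrm d\mu(x)=\mathbb E\Bigl[\int_0^\infty f(zA_u)\,z^{-2}\,\mathrm dz\Bigr],$$ and $\mu$ is the only Borel measure on $[0,\infty)^V\setminus\{0\}$ with this property. Consequently, $X$ is in the max-domain of attraction of a max-stable distribution with unit-Fréchet margins, whose distribution function $G$ is given by $$G(x)=\exp\bigl[-\mu(\{y:\exists v\in V,\ y_v>x_v\})\bigr]=\lim_{n\to\infty}\bigl[\mathbb P(X_v\le n x_v,\ v\in V)\bigr]^n,\qquad x\in(0,\infty)^V.$$ -/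

import Mathlib

open MeasureTheory ProbabilityTheory Filter Topology
open scoped NNReal ENNReal BoundedContinuousFunction

section Graphs

variable {V : Type*}

/-- The subgraph induced by `B` is biconnected: it is connected and remains connected after the
removal of a single node. -/
def IsBiconnectedSet (G : SimpleGraph V) (B : Set V) : Prop :=
  (G.induce B).Connected ∧ ∀ x ∈ B, (G.induce (B \ {x})).Preconnected

/-- A connected block graph: every block (maximal biconnected subgraph) is complete. -/
def IsBlockGraph (G : SimpleGraph V) : Prop :=
  G.Connected ∧ ∀ B : Set V, Maximal (IsBiconnectedSet G) B → G.IsClique B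

/-- The (maximal) cliques of `G`. -/
abbrev MaxClique (G : SimpleGraph V) : Type _ :=
  {C : Set V // Maximal (fun K : Set V => G.IsClique K) C}

noncomputable instance MaxClique.instFintype [Finite V] (G : SimpleGraph V) :
    Fintype (MaxClique G) := Fintype.ofFinite _

/-- Every path from a node of `A` to a node of `B` passes through a node of `S`.
(It makes no difference whether one says this about paths or about walks.) -/
def IsSeparatorOf (G : SimpleGraph V) (A B S : Set V) : Prop :=
  ∀ a ∈ A, ∀ b ∈ B, ∀ p : G.Walk a b, ∃ s ∈ S, s ∈ p.support

/-- `s` is a minimal clique separator: `{s}` is a minimal separator of two distinct cliques. -/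
def IsMinCliqueSep (G : SimpleGraph V) (s : V) : Prop :=
  ∃ C D : MaxClique G, C ≠ D ∧ Minimal (IsSeparatorOf G C.1 D.1) {s}

/-- A shortest path from `u` to `v` (unique in a block graph). -/
noncomputable def shortestPath {G : SimpleGraph V} (hG : G.Connected) (u v : V) : G.Walk u v :=
  (hG.exists_walk_length_eq_dist u v).choose

open Classical in
/-- The separator node in the clique `C` between `u` and the nodes of `C`: it is `u` if `u ∈ C`, and
otherwise the unique node of `C` through which every path from `u` to a node of `C` passes. (The
last `else` branch does not occur in a connected block graph.) -/
noncomputable def sepNode (G : SimpleGraph V) (u : V) (C : MaxClique G) : V :=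
  if u ∈ C.1 then u
  else if h : ∃ s ∈ C.1, ∀ v ∈ C.1, ∀ p : G.Walk u v, s ∈ p.support then h.choose
  else u

end Graphs

section Markov

variable {V : Type*} {Ω : Type*} [MeasurableSpace Ω]

/-- The sub-vector `x_A`. -/
def subvec (A : Set V) (x : V → ℝ≥0) : A → ℝ≥0 := fun v => x v

lemma measurable_subvec (A : Set V) : Measurable (subvec A) :=
  measurable_pi_lambda _ fun _ => measurable_pi_apply _

/-- The global Markov property of the random vector `X` with respect to `G`. Conditional
independence of `X_A` and `X_B` given `X_S` depends only on the law of `X`, and is expressed on the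
canonical space `[0, ∞)^V` equipped with that law. -/
def IsMarkovRandomField [Finite V] (G : SimpleGraph V) (P : Measure Ω) [IsFiniteMeasure P]
    (X : Ω → V → ℝ≥0) : Prop :=
  ∀ A B S : Set V, A.Nonempty → B.Nonempty → S.Nonempty →
    Disjoint A B → Disjoint A S → Disjoint B S → IsSeparatorOf G A B S →
    CondIndepFun (MeasurableSpace.comap (subvec S) inferInstance) (measurable_subvec S).comap_le
      (subvec A) (subvec B) (P.map X)

/-- `κ C s` is, for every clique `C` and node `s ∈ C`, a (regular) version of the conditional law of
`X_{C ∖ s}` given `X_s`, that is, `κ C s x = 𝓛(X_{C ∖ s} ∣ X_s = x)`. -/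
def AreCliqueCondLaws (G : SimpleGraph V) (P : Measure Ω) (X : Ω → V → ℝ≥0)
    (κ : (C : MaxClique G) → (s : V) → Kernel ℝ≥0 (↥(C.1 \ {s}) → ℝ≥0)) : Prop :=
  ∀ (C : MaxClique G), ∀ s ∈ C.1,
    HasCondDistrib (fun ω => subvec (C.1 \ {s}) (X ω)) (fun ω => X ω s) (κ C s) P

/-- If `κ x` is the law of `Y` given `X = x`, this is the law of `Y / t` given `X = t`. -/
noncomputable def rescaledCondLaw {ι : Type*} (κ : Kernel ℝ≥0 (ι → ℝ≥0)) [IsMarkovKernel κ]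
    (t : ℝ≥0) : ProbabilityMeasure (ι → ℝ≥0) :=
  ⟨(κ t).map (fun y v => y v / t),
    Measure.isProbabilityMeasure_map
      (measurable_pi_lambda _ fun v => (measurable_pi_apply v).div_const t).aemeasurable⟩

/-- For all cliques `C` and `s ∈ C`, the law of `X_{C ∖ s} / t` given `X_s = t` converges weakly to
`ν C s` as `t → ∞`. -/
def CliqueLimits [Finite V] (G : SimpleGraph V)
    (κ : (C : MaxClique G) → (s : V) → Kernel ℝ≥0 (↥(C.1 \ {s}) → ℝ≥0))
    [∀ C s, IsMarkovKernel (κ C s)]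
    (ν : (C : MaxClique G) → (s : V) → ProbabilityMeasure (↥(C.1 \ {s}) → ℝ≥0)) : Prop :=
  ∀ (C : MaxClique G), ∀ s ∈ C.1,
    Tendsto (fun t : ℝ≥0 => rescaledCondLaw (κ C s) t) atTop (𝓝 (ν C s))

/-- Let `s` be a minimal clique separator, `u` a node, and `C` a clique containing `s` but no other
node of the shortest path from `u` to `s`. If that path has an edge `(a, b)`, in a clique `K`, for
which the `b`-th margin of `ν K a` has an atom at zero, then for every `η > 0`,
`limsup_{δ ↓ 0} limsup_{t → ∞} sup_{x ∈ [0, δ]} P(∃ v ∈ C ∖ s, X_v / t > η ∣ X_s / t = x) = 0`. -/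
def NoReturnFromZero {G : SimpleGraph V} (hG : G.Connected)
    (κ : (C : MaxClique G) → (s : V) → Kernel ℝ≥0 (↥(C.1 \ {s}) → ℝ≥0))
    (ν : (C : MaxClique G) → (s : V) → ProbabilityMeasure (↥(C.1 \ {s}) → ℝ≥0)) : Prop :=
  ∀ (u s : V), IsMinCliqueSep G s →
    ∀ C : MaxClique G, s ∈ C.1 → (∀ w ∈ (shortestPath hG u s).support, w ∈ C.1 → w = s) →
    (∃ d ∈ (shortestPath hG u s).darts, ∃ K : MaxClique G, d.fst ∈ K.1 ∧
      ∃ hb : d.snd ∈ K.1 \ {d.fst},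
        0 < (ν K d.fst : Measure (↥(K.1 \ {d.fst}) → ℝ≥0)) {y | y ⟨d.snd, hb⟩ = 0}) →
    ∀ η : ℝ≥0, 0 < η →
      limsup (fun δ : ℝ≥0 =>
        limsup (fun t : ℝ≥0 =>
          ⨆ x ∈ Set.Icc (0 : ℝ≥0) δ, κ C s (t * x) {y | ∃ v, η < y v / t}) atTop) (𝓝[>] 0) = 0

end Markov

section TailField

variable {V : Type*}

/-- The sample space of the increments `Z = (Z_{s, C ∖ s})_C` for the source node `u`: one vector
indexed by `C ∖ s` for every clique `C`, where `s` is the separator node between `u` and `C`. -/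
abbrev IncrementSpace (G : SimpleGraph V) (u : V) : Type _ :=
  (C : MaxClique G) → (↥(C.1 \ {sepNode G u C}) → ℝ≥0)

/-- The law of `Z`: the blocks `Z_{s, C ∖ s}` have law `ν C s` and are independent as `C` varies. -/
noncomputable def incrementLaw [Finite V] (G : SimpleGraph V)
    (ν : (C : MaxClique G) → (s : V) → ProbabilityMeasure (↥(C.1 \ {s}) → ℝ≥0)) (u : V) :
    Measure (IncrementSpace G u) :=
  Measure.pi fun C => (ν C (sepNode G u C) : Measure (↥(C.1 \ {sepNode G u C}) → ℝ≥0))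

open Classical in
/-- The increment `Z_e` for `e = (a, b)`: the `b`-th coordinate of `Z_{s, C ∖ s}`, where `C` is the
clique with separator node `s = a` and with `b ∈ C ∖ s`. (On a connected block graph, `C` exists and
is unique for every edge of a shortest path that starts at `u`.) -/
noncomputable def edgeIncrement (G : SimpleGraph V) (u : V) (z : IncrementSpace G u) (a b : V) :
    ℝ≥0 :=
  if h : ∃ C : MaxClique G, sepNode G u C = a ∧ b ∈ C.1 \ {sepNode G u C} then
    z h.choose ⟨b, h.choose_spec.2⟩
  else 1

/-- `A_{uv} = ∏ Z_e`, the product over the edges `e` of the shortest path from `u` to `v`; in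
particular `A_{uu} = 1`. -/
noncomputable def tailField {G : SimpleGraph V} (hG : G.Connected) (u : V)
    (z : IncrementSpace G u) (v : V) : ℝ≥0 :=
  ((shortestPath hG u v).darts.map fun d => edgeIncrement G u z d.fst d.snd).prod

end TailField

section ExponentMeasures

variable {V : Type*}

/-- The punctured orthant `[0, ∞)^V ∖ {0}`. -/
abbrev PuncturedOrthant (V : Type*) : Type _ := {x : V → ℝ≥0 // x ≠ 0}

/-- `𝓜₀`: the Borel measures on `[0, ∞)^V ∖ {0}` that are finite on the Borel sets contained in
`{x : max_v x_v ≥ ε}` for some `ε > 0`. -/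
def MZero (V : Type*) : Type _ :=
  {μ : Measure (PuncturedOrthant V) // ∀ B : Set (PuncturedOrthant V), MeasurableSet B →
    (∃ ε : ℝ≥0, 0 < ε ∧ B ⊆ {x | ∃ v, ε ≤ x.1 v}) → μ B < ∞}

/-- The smallest topology on `𝓜₀` for which `μ ↦ ∫ f dμ` is continuous for all real-valued, bounded,
continuous `f` on `[0, ∞)^V ∖ {0}` that vanish in a neighbourhood of the origin. -/
noncomputable instance MZero.instTopologicalSpace : TopologicalSpace (MZero V) :=
  ⨅ f : {f : PuncturedOrthant V →ᵇ ℝ //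
      ∃ ε : ℝ≥0, 0 < ε ∧ ∀ x : PuncturedOrthant V, (∀ v, x.1 v < ε) → f x = 0},
    TopologicalSpace.induced (fun μ : MZero V => ∫ x, f.1 x ∂μ.1) inferInstance

/-- The measure `t P(X / t ∈ ·)` on `[0, ∞)^V ∖ {0}`. -/
noncomputable def scaledTail {Ω : Type*} [MeasurableSpace Ω] (P : Measure Ω) [IsFiniteMeasure P]
    (X : Ω → V → ℝ≥0) (t : ℝ≥0) : MZero V :=
  ⟨(t • P.map (fun ω v => X ω v / t)).comap Subtype.val, fun _ hB _ =>
    (Measure.comap_apply_le _ _ hB.nullMeasurableSet).trans_lt (measure_lt_top _ _)⟩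

/-- For all `u` and Borel `f ≥ 0`, `∫ f(y) 1{y_u > 0} dμ(y) = E ∫_0^∞ f(z A_u) z⁻² dz`. (The
functions `f` are defined on all of `[0, ∞)^V`; their value at the origin plays no role.) -/
def IsTailFieldMeasure [Finite V] {G : SimpleGraph V} (hG : G.Connected)
    (ν : (C : MaxClique G) → (s : V) → ProbabilityMeasure (↥(C.1 \ {s}) → ℝ≥0))
    (μ : Measure (PuncturedOrthant V)) : Prop :=
  ∀ (u : V) (f : (V → ℝ≥0) → ℝ≥0∞), Measurable f →
    ∫⁻ y, {y : PuncturedOrthant V | 0 < y.1 u}.indicator (fun y => f y.1) y ∂μ =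
      ∫⁻ ζ, (∫⁻ z in Set.Ioi (0 : ℝ),
        f (fun v => z.toNNReal * tailField hG u ζ v) * ENNReal.ofReal (z ^ 2)⁻¹)
        ∂(incrementLaw G ν u)

/-- `γ` is a max-stable distribution with unit-Fréchet margins. -/
def IsSimpleMaxStable (γ : Measure (V → ℝ≥0)) : Prop :=
  (∀ (v : V) (r : ℝ≥0), 0 < r → γ {y | y v ≤ r} = ENNReal.ofReal (Real.exp (-(1 / (r : ℝ))))) ∧
  ∀ (n : ℕ), 1 ≤ n → ∀ x : V → ℝ≥0, γ {y | ∀ v, y v ≤ n * x v} ^ n = γ {y | ∀ v, y v ≤ x v}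

/-- The law of `X` is in the max-domain of attraction of `γ`, with scaling sequence `n`:
`P(X_v ≤ n x_v, v ∈ V) ^ n → γ([0, x])` for all `x ∈ (0, ∞)^V`. -/
def InMaxDomain {Ω : Type*} [MeasurableSpace Ω] (P : Measure Ω) (X : Ω → V → ℝ≥0)
    (γ : Measure (V → ℝ≥0)) : Prop :=
  ∀ x : V → ℝ≥0, (∀ v, 0 < x v) →
    Tendsto (fun n : ℕ => P {ω | ∀ v, X ω v ≤ n * x v} ^ n) atTop (𝓝 (γ {y | ∀ v, y v ≤ x v}))

end ExponentMeasures

/-! Fix a root `u`; `tailLaw` is the law of `z A_u` under `z⁻² dz`. The core is the one-sided bound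
`IsBlockGraph.tailLaw_le_liminf`: on every open set, `tailLaw` is at most the liminf of `t P(X/t ∈
·)`. It is proved by adding cliques in order of their distance from `u`. A new clique `C` meets the
nodes already reached only in its separator node `s`. By the Markov property, the law of the
enlarged vector is the old law integrated against the law of `X_{C∖s}` given `X_s`
(`scaledLaw_map_union`); the tail field has the same structure with `ν C s`
(`IsBlockGraph.tailLaw_map_union`). A Fatou lemma in which measures and integrands vary together
(`lintegral_le_liminf_of_le_liminf_prod`) passes to the limit. It needs only a pointwise lower
bound: where `x_s > 0` this is the weak convergence of the conditional laws; points with `x_s = 0`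
are either null, if no increment on the path has an atom at zero, or covered by `NoReturnFromZero`.

Upper bounds follow from conservation of mass. Since `A_{uu} = 1`, `tailLaw` gives `{x_u > a}` mass
`1/a`, which is also the limit of `t P(X_u/t > a)`. Hence integrals of bounded continuous functions
vanishing off `{x_u > a}` converge. Comparing this limit with the lower bound for another root `v`
shows that the two laws agree where `x_u` and `x_v` are both positive, so consistency between roots
is a consequence of convergence. The laws are then glued (`exponentMeasure`), a partition of unity
gives convergence in `𝓜₀`, and uniqueness holds because the sets `{x_u > 0}` cover the punctured
orthant.

For the maxima, the margins `1/a` make the exceedance sets continuity sets of `μ`, so `(1 - c_n/n)^n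
→ exp(-c)` applies. The limit is a distribution function because the scaled maxima are tight, and
max-stability comes from regarding a maximum of `nk` vectors as a maximum of `n` blocks of size `k`.
-/

section BlockGraphs

/-! ### Block graphs: separators, uniqueness of shortest paths, and the order in which cliques are
added. -/

variable {V : Type*} {G : SimpleGraph V}

/-- A path from `a` to `c` closes up through `s` to a cycle. A cycle is biconnected, so it lies in a
block, and blocks are complete. All other facts on block graphs below derive from this one. -/
lemma IsBlockGraph.adj_of_walk [Finite V] (hG : IsBlockGraph G) {s a c : V} (ha : G.Adj s a)
    (hc : G.Adj s c) (p : G.Walk a c) (hp : s ∉ p.support) (hac : a ≠ c) : G.Adj a c := by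
  classical
  wlog hpath : p.IsPath generalizing p
  · exact this p.bypass (fun h => hp (p.support_bypass_subset_support h)) p.bypass_isPath
  have hB : IsBiconnectedSet G (insert s {v | v ∈ p.support}) := by
    have key : ∀ x, x ≠ s → ∀ y (hy : y ∈ insert s {v | v ∈ p.support} \ {x})
        (hs : s ∈ insert s {v | v ∈ p.support} \ {x}),
        (G.induce (insert s {v | v ∈ p.support} \ {x})).Reachable ⟨s, hs⟩ ⟨y, hy⟩ := by
      intro x hxs y hy hs
      rcases eq_or_ne y s with rfl | hys
      · rfl
      have hyp : y ∈ p.support := by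
        rcases hy.1 with h | h
        · exact absurd h hys
        · exact h
      have hyx : y ≠ x := fun h => hy.2 h
      -- When `x` is removed from the cycle, a node `y` before `x` on the path is reached from `s`
      -- through `a`, and a node after `x` through `c`.
      have main : ∃ q : G.Walk s y, ∀ v ∈ q.support, v ∈ insert s {v | v ∈ p.support} \ {x} := by
        by_cases hx : x ∈ p.support
        · rw [← p.take_spec hx, SimpleGraph.Walk.mem_support_append_iff] at hyp
          rcases hyp with h | h
          · refine ⟨.cons ha ((p.takeUntil x hx).takeUntil y h), ?_⟩
            intro v hv
            rw [SimpleGraph.Walk.support_cons, List.mem_cons] at hv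
            rcases hv with rfl | hv
            · exact hs
            refine ⟨Or.inr (p.support_takeUntil_subset_support hx
              ((p.takeUntil x hx).support_takeUntil_subset_support h hv)), ?_⟩
            rintro rfl
            exact SimpleGraph.Walk.endpoint_notMem_support_takeUntil (hpath.takeUntil hx) h hyx.symm hv
          · have h' : y ∈ (p.dropUntil x hx).reverse.support := by simpa using h
            refine ⟨.cons hc ((p.dropUntil x hx).reverse.takeUntil y h'), ?_⟩
            intro v hv
            rw [SimpleGraph.Walk.support_cons, List.mem_cons] at hv
            rcases hv with rfl | hv
            · exact hs
            refine ⟨Or.inr (p.support_dropUntil_subset_support hx ?_), ?_⟩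
            · simpa using (p.dropUntil x hx).reverse.support_takeUntil_subset_support h' hv
            rintro rfl
            exact SimpleGraph.Walk.endpoint_notMem_support_takeUntil
              (hpath.dropUntil hx).reverse h' hyx.symm hv
        · refine ⟨.cons ha (p.takeUntil y hyp), ?_⟩
          intro v hv
          rw [SimpleGraph.Walk.support_cons, List.mem_cons] at hv
          rcases hv with rfl | hv
          · exact hs
          refine ⟨Or.inr (p.support_takeUntil_subset_support hyp hv), ?_⟩
          rintro rfl
          exact hx (p.support_takeUntil_subset_support hyp hv)
      obtain ⟨q, hq⟩ := main
      exact ⟨q.induce _ hq⟩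
    have hrem : ∀ x, x ≠ s → (G.induce (insert s {v | v ∈ p.support} \ {x})).Preconnected := by
      intro x hx y z
      have hs : s ∈ insert s {v | v ∈ p.support} \ {x} := ⟨Or.inl rfl, fun h => hx h.symm⟩
      exact (key x hx y.1 y.2 hs).symm.trans (key x hx z.1 z.2 hs)
    refine ⟨?_, ?_⟩
    · have hpc : (G.induce {v | v ∈ p.support}).Connected := p.connected_induce_support
      have hps : (G.induce ({s, a} : Set V)).Connected := SimpleGraph.induce_pair_connected_of_adj ha
      have := SimpleGraph.induce_union_connected hps.preconnected hpc.preconnected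
        ⟨a, by simp, p.start_mem_support⟩
      have hset : insert s {v | v ∈ p.support} = {s, a} ∪ {v | v ∈ p.support} := by
        rw [Set.insert_union, Set.singleton_union, Set.insert_eq_of_mem (a := a)]
        exact p.start_mem_support
      rw [hset]
      exact this
    · intro x _
      rcases eq_or_ne x s with rfl | hx
      · have : insert x {v | v ∈ p.support} \ {x} = {v | v ∈ p.support} := by
          ext v
          simp only [Set.mem_sdiff, Set.mem_insert_iff, Set.mem_ofPred_eq, Set.mem_singleton_iff]
          constructor
          · rintro ⟨h | h, h'⟩
            · exact absurd h h'
            · exact h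
          · intro h
            exact ⟨Or.inr h, fun h' => hp (h' ▸ h)⟩
        rw [this]
        exact p.connected_induce_support.preconnected
      · exact hrem x hx
  obtain ⟨M, hM, hmax⟩ := (Set.toFinite {B | IsBiconnectedSet G B}).exists_le_maximal hB
  exact hG.2 M hmax (hM (Or.inr p.start_mem_support)) (hM (Or.inr p.end_mem_support)) hac

lemma exists_maxClique_superset [Finite V] {K : Set V} (hK : G.IsClique K) :
    ∃ C : MaxClique G, K ⊆ C.1 := by
  obtain ⟨M, hM, hmax⟩ := (Set.toFinite {B | G.IsClique B}).exists_le_maximal hK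
  exact ⟨⟨M, hmax⟩, hM⟩

lemma exists_maxClique_of_adj [Finite V] {a b : V} (h : G.Adj a b) :
    ∃ C : MaxClique G, a ∈ C.1 ∧ b ∈ C.1 := by
  obtain ⟨C, hC⟩ := exists_maxClique_superset (G := G) (K := {a, b})
    (by rw [SimpleGraph.isClique_pair]; exact fun _ => h)
  exact ⟨C, hC (by simp), hC (by simp)⟩

lemma MaxClique.adj (C : MaxClique G) {x y : V} (hx : x ∈ C.1) (hy : y ∈ C.1) (h : x ≠ y) :
    G.Adj x y := C.2.1 hx hy h

lemma MaxClique.nonempty [Nonempty V] (C : MaxClique G) : C.1.Nonempty := by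
  by_contra h
  rw [Set.not_nonempty_iff_eq_empty] at h
  obtain ⟨v⟩ := ‹Nonempty V›
  have := C.2.2 (y := {v}) (by simp) (by simp [h])
  rw [h] at this
  exact this rfl

lemma MaxClique.mem_of_forall_adj (C : MaxClique G) {a : V} (h : ∀ x ∈ C.1, x ≠ a → G.Adj x a) :
    a ∈ C.1 := by
  have hc : G.IsClique (insert a C.1) := by
    rw [SimpleGraph.isClique_insert]
    exact ⟨C.2.1, fun b hb hab => (h b hb hab.symm).symm⟩
  exact C.2.2 hc (Set.subset_insert _ _) (Set.mem_insert _ _)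

/-- For `c ∈ C` and `d ∈ D`, the walk `d, y, c` joins two neighbours of `x` while avoiding `x`, so
`c` and `d` are adjacent; maximality then gives each inclusion. -/
lemma IsBlockGraph.maxClique_eq [Finite V] (hG : IsBlockGraph G) {C D : MaxClique G} {x y : V}
    (hxy : x ≠ y) (hxC : x ∈ C.1) (hyC : y ∈ C.1) (hxD : x ∈ D.1) (hyD : y ∈ D.1) : C = D := by
  have key : ∀ {C D : MaxClique G}, x ∈ C.1 → y ∈ C.1 → x ∈ D.1 → y ∈ D.1 → C.1 ⊆ D.1 := by
    intro C D hxC hyC hxD hyD c hc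
    refine D.mem_of_forall_adj fun d hd hdc => ?_
    rcases eq_or_ne c x with rfl | hcx
    · exact D.adj hd hxD hdc
    rcases eq_or_ne d x with rfl | hdx
    · exact C.adj hxC hc hdc
    rcases eq_or_ne c y with rfl | hcy
    · exact D.adj hd hyD hdc
    rcases eq_or_ne d y with rfl | hdy
    · exact C.adj hyC hc hdc
    refine hG.adj_of_walk (D.adj hxD hd hdx.symm) (C.adj hxC hc hcx.symm)
      (.cons (D.adj hd hyD hdy) (.cons (C.adj hyC hc hcy.symm) .nil)) ?_ hdc
    simp [hxy, hcx.symm, hdx.symm]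
  exact Subtype.ext ((key hxC hyC hxD hyD).antisymm (key hxD hyD hxC hyC))

/-- If a walk avoided `s`, its ends would be adjacent, and the triangle `s, a, c` would lie in a
clique sharing two nodes with `C` and two with `D`. -/
lemma IsBlockGraph.mem_support_of_ne [Finite V] (hG : IsBlockGraph G) {C D : MaxClique G}
    (hCD : C ≠ D) {s a c : V} (hsC : s ∈ C.1) (hsD : s ∈ D.1) (ha : a ∈ C.1) (hc : c ∈ D.1)
    (p : G.Walk a c) : s ∈ p.support := by
  by_contra hs
  have has : s ≠ a := fun h => hs (h ▸ p.start_mem_support)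
  have hcs : s ≠ c := fun h => hs (h ▸ p.end_mem_support)
  rcases eq_or_ne a c with rfl | hac
  · exact hCD (hG.maxClique_eq has hsC ha hsD hc)
  have h1 := C.adj hsC ha has
  have h2 := D.adj hsD hc hcs
  have h3 := hG.adj_of_walk h1 h2 p hs hac
  obtain ⟨K, hK⟩ := exists_maxClique_superset (G := G) (K := {s, a, c}) (by
    rw [SimpleGraph.isClique_insert, SimpleGraph.isClique_pair]
    refine ⟨fun _ => h3, ?_⟩
    rintro b (rfl | rfl) _ <;> assumption)
  have hs := hK (show s ∈ _ by simp)
  have ha' := hK (show a ∈ _ by simp)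
  have hc' := hK (show c ∈ _ by simp)
  exact hCD ((hG.maxClique_eq has hsC ha hs ha').trans (hG.maxClique_eq hcs hs hc' hsD hc))

/-- The separator is the node `s` of `C` nearest to `u`. Its neighbour `a` on a shortest path to `u`
lies outside `C`. A walk from `u` into `C` avoiding `s` would connect `a` to every other node of `C`
off `s`, making `a` adjacent to all of `C`, against maximality. -/
lemma IsBlockGraph.exists_sepNode [Finite V] (hG : IsBlockGraph G) {u : V} {C : MaxClique G}
    (hu : u ∉ C.1) : ∃ s ∈ C.1, ∀ v ∈ C.1, ∀ p : G.Walk u v, s ∈ p.support := by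
  classical
  have : Nonempty V := ⟨u⟩
  obtain ⟨s, hs, hmin⟩ := Set.exists_min_image C.1 (fun v => G.dist u v) (Set.toFinite _) C.nonempty
  refine ⟨s, hs, fun v hv q => ?_⟩
  by_contra hsq
  have hvs : s ≠ v := fun h => hsq (h ▸ q.end_mem_support)
  obtain ⟨p, hp⟩ := hG.1.exists_walk_length_eq_dist s u
  have hsu : s ≠ u := fun h => hu (h ▸ hs)
  cases p with
  | nil => exact hsu rfl
  | @cons _ a _ h r =>
    have hlen : r.length + 1 = G.dist s u := by simpa using hp
    have hau : G.dist u a < G.dist u s := by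
      have := SimpleGraph.dist_le r
      rw [SimpleGraph.dist_comm, SimpleGraph.dist_comm (u := u) (v := s)]
      omega
    have haC : a ∉ C.1 := fun h => absurd (hmin a h) (by simpa using hau)
    have hsr : s ∉ r.support := by
      intro h
      have h1 := SimpleGraph.dist_le (r.dropUntil s h)
      have h2 := r.length_dropUntil_le_length h
      omega
    have hav : ∀ v' ∈ C.1, v' ≠ s → G.Adj a v' := by
      intro v' hv' hvs'
      have hw : ∃ w : G.Walk v v', s ∉ w.support := by
        rcases eq_or_ne v v' with rfl | hne
        · exact ⟨.nil, by simpa using hvs⟩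
        · exact ⟨.cons (C.adj hv hv' hne) .nil, by simp [hvs, hvs'.symm]⟩
      obtain ⟨w, hw⟩ := hw
      refine hG.adj_of_walk h (C.adj hs hv' hvs'.symm) ((r.append q).append w) ?_ ?_
      · simp [SimpleGraph.Walk.mem_support_append_iff, hsr, hsq, hw]
      · rintro rfl; exact haC hv'
    refine haC (C.mem_of_forall_adj fun x hx hxa => ?_)
    rcases eq_or_ne x s with rfl | hxs
    · exact h
    · exact (hav x hx hxs).symm

lemma sepNode_of_mem {u : V} {C : MaxClique G} (hu : u ∈ C.1) : sepNode G u C = u := by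
  simp [sepNode, hu]

lemma IsBlockGraph.sepNode_spec [Finite V] (hG : IsBlockGraph G) (u : V) (C : MaxClique G) :
    sepNode G u C ∈ C.1 ∧ ∀ v ∈ C.1, ∀ p : G.Walk u v, sepNode G u C ∈ p.support := by
  classical
  by_cases hu : u ∈ C.1
  · rw [sepNode_of_mem hu]
    exact ⟨hu, fun v _ p => p.start_mem_support⟩
  · have h := hG.exists_sepNode hu
    have : sepNode G u C = h.choose := by simp [sepNode, hu, h]
    rw [this]
    exact h.choose_spec

lemma SimpleGraph.Walk.dist_eq_of_length_eq_dist {u v : V} {p : G.Walk u v} (hG : G.Connected)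
    (hp : p.length = G.dist u v) {n : ℕ} (hn : n ≤ p.length) : G.dist u (p.getVert n) = n := by
  have h1 := SimpleGraph.dist_le (p.take n)
  have h2 := SimpleGraph.dist_le (p.drop n)
  have h3 := hG.dist_triangle (u := u) (v := p.getVert n) (w := v)
  rw [SimpleGraph.Walk.take_length] at h1
  rw [SimpleGraph.Walk.drop_length] at h2
  omega

lemma SimpleGraph.Walk.getVert_dist {u v x : V} {p : G.Walk u v} (hG : G.Connected)
    (hp : p.length = G.dist u v) (hx : x ∈ p.support) :
    p.getVert (G.dist u x) = x ∧ G.dist u x ≤ p.length := by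
  obtain ⟨n, rfl, hn⟩ := SimpleGraph.Walk.mem_support_iff_exists_getVert.1 hx
  rw [SimpleGraph.Walk.dist_eq_of_length_eq_dist hG hp hn]
  exact ⟨rfl, hn⟩

lemma SimpleGraph.Walk.eq_of_dist_eq {u v x y : V} {p : G.Walk u v} (hG : G.Connected)
    (hp : p.length = G.dist u v) (hx : x ∈ p.support) (hy : y ∈ p.support)
    (h : G.dist u x = G.dist u y) : x = y := by
  rw [← (p.getVert_dist hG hp hx).1, h, (p.getVert_dist hG hp hy).1]

lemma SimpleGraph.Walk.dist_lt_of_mem_support {u v x : V} {p : G.Walk u v} (hG : G.Connected)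
    (hp : p.length = G.dist u v) (hx : x ∈ p.support) (hxv : x ≠ v) : G.dist u x < G.dist u v := by
  have h1 := (p.getVert_dist hG hp hx).2
  rw [hp] at h1
  refine lt_of_le_of_ne h1 fun h => hxv ?_
  exact p.eq_of_dist_eq hG hp hx p.end_mem_support h

lemma shortestPath_length (hG : G.Connected) (u v : V) :
    (shortestPath hG u v).length = G.dist u v :=
  (hG.exists_walk_length_eq_dist u v).choose_spec

lemma IsBlockGraph.dist_eq_sepNode_add_one [Finite V] (hG : IsBlockGraph G) {u v : V}
    {C : MaxClique G} (hv : v ∈ C.1) (hvs : v ≠ sepNode G u C) :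
    G.dist u v = G.dist u (sepNode G u C) + 1 := by
  have hs := hG.sepNode_spec u C
  have h1 := SimpleGraph.Walk.dist_lt_of_mem_support hG.1 (shortestPath_length hG.1 u v)
    (hs.2 v hv _) hvs.symm
  have h2 := hG.1.dist_triangle (u := u) (v := sepNode G u C) (w := v)
  have h3 : G.dist (sepNode G u C) v = 1 :=
    SimpleGraph.dist_eq_one_iff_adj.2 (C.adj hs.1 hv hvs.symm)
  omega

/-- If two geodesics towards `u` left `v` by different nodes `a` and `b`, then `v, a, b` would lie
in one clique. In a clique only the separator node is nearer to `u` than the rest, so `a` and `b`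
cannot both be nearer than `v`. -/
lemma IsBlockGraph.walk_eq_of_length_eq_dist [Finite V] (hG : IsBlockGraph G) {u v : V}
    (p q : G.Walk v u) (hp : p.length = G.dist v u) (hq : q.length = G.dist v u) : p = q := by
  induction p with
  | nil =>
    rw [SimpleGraph.dist_self] at hq
    exact (SimpleGraph.Walk.length_eq_zero_iff.1 hq).eq_nil.symm
  | @cons v a u h p ih =>
    cases q with
    | nil => simp at hp
    | @cons _ b _ h' q =>
      rw [SimpleGraph.Walk.length_cons] at hp hq
      have hpa : p.length = G.dist a u := by
        have h1 := SimpleGraph.dist_le p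
        have h2 := hG.1.dist_triangle (u := v) (v := a) (w := u)
        rw [SimpleGraph.dist_eq_one_iff_adj.2 h] at h2
        omega
      have hqb : q.length = G.dist b u := by
        have h1 := SimpleGraph.dist_le q
        have h2 := hG.1.dist_triangle (u := v) (v := b) (w := u)
        rw [SimpleGraph.dist_eq_one_iff_adj.2 h'] at h2
        omega
      have hab : a = b := by
        by_contra hab
        have hnot : ∀ {a : V} (r : G.Walk a u), r.length + 1 = G.dist v u → v ∉ r.support := by
          classical
          intro a r hr hv
          have h1 := SimpleGraph.dist_le (r.dropUntil v hv)
          have h2 := r.length_dropUntil_le_length hv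
          omega
        have hadj := hG.adj_of_walk h h' (p.append q.reverse) (by
          simp [SimpleGraph.Walk.mem_support_append_iff, hnot p hp, hnot q hq]) hab
        obtain ⟨C, hC⟩ := exists_maxClique_superset (G := G) (K := {v, a, b}) (by
          rw [SimpleGraph.isClique_insert, SimpleGraph.isClique_pair]
          refine ⟨fun _ => hadj, ?_⟩
          rintro b (rfl | rfl) _ <;> assumption)
        have hv := hC (show v ∈ _ by simp)
        have ha := hC (show a ∈ _ by simp)
        have hb := hC (show b ∈ _ by simp)
        have e1 := G.dist_comm (u := u) (v := v)
        have e2 := G.dist_comm (u := u) (v := a)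
        have e3 := G.dist_comm (u := u) (v := b)
        have hd : ∀ x ∈ C.1, x = sepNode G u C ∨ G.dist u x = G.dist u (sepNode G u C) + 1 :=
          fun x hx => or_iff_not_imp_left.2 fun h => hG.dist_eq_sepNode_add_one hx h
        rcases hd v hv with h1 | h1 <;> rcases hd a ha with h2 | h2 <;>
          rcases hd b hb with h3 | h3
        · exact hab (h2.trans h3.symm)
        · rw [← h2] at h3; omega
        · rw [← h1] at h2; omega
        · rw [← h1] at h2; omega
        · exact hab (h2.trans h3.symm)
        · rw [← h2] at h3; omega
        · rw [← h3] at h2; omega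
        · omega
      subst hab
      rw [ih q hpa hqb]

lemma IsBlockGraph.shortestPath_eq [Finite V] (hG : IsBlockGraph G) {u v : V} (p : G.Walk u v)
    (hp : p.length = G.dist u v) : shortestPath hG.1 u v = p := by
  have h := hG.walk_eq_of_length_eq_dist (shortestPath hG.1 u v).reverse p.reverse
    (by rw [SimpleGraph.Walk.length_reverse, shortestPath_length, SimpleGraph.dist_comm])
    (by rw [SimpleGraph.Walk.length_reverse, hp, SimpleGraph.dist_comm])
  simpa using congrArg SimpleGraph.Walk.reverse h

lemma IsBlockGraph.shortestPath_self [Finite V] (hG : IsBlockGraph G) (u : V) :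
    shortestPath hG.1 u u = .nil := hG.shortestPath_eq _ (by simp)

lemma IsBlockGraph.shortestPath_eq_concat [Finite V] (hG : IsBlockGraph G) {u v : V}
    {C : MaxClique G} (hv : v ∈ C.1) (hvs : v ≠ sepNode G u C) :
    shortestPath hG.1 u v = (shortestPath hG.1 u (sepNode G u C)).concat
      (C.adj (hG.sepNode_spec u C).1 hv hvs.symm) := by
  apply hG.shortestPath_eq
  rw [SimpleGraph.Walk.length_concat, shortestPath_length, hG.dist_eq_sepNode_add_one hv hvs]

/-- The clique is the one containing the last edge of a geodesic from `u` to `s`, through which `s`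
is entered. -/
lemma IsBlockGraph.exists_maxClique_sepNode_ne [Finite V] (hG : IsBlockGraph G) {u s : V}
    (hs : s ≠ u) : ∃ C : MaxClique G, s ∈ C.1 ∧ s ≠ sepNode G u C := by
  obtain ⟨p, hp⟩ := hG.1.exists_walk_length_eq_dist s u
  cases p with
  | nil => exact absurd rfl hs
  | @cons _ a _ h r =>
    obtain ⟨C, hsC, haC⟩ := exists_maxClique_of_adj h
    refine ⟨C, hsC, fun heq => ?_⟩
    have h1 := SimpleGraph.dist_le r
    have h2 := hG.dist_eq_sepNode_add_one (u := u) haC (heq ▸ h.ne')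
    rw [← heq, G.dist_comm (u := u) (v := a), G.dist_comm (u := u) (v := s), ← hp,
      SimpleGraph.Walk.length_cons] at h2
    omega

lemma IsBlockGraph.eq_sepNode_of_mem_shortestPath [Finite V] (hG : IsBlockGraph G) {u w : V}
    {C : MaxClique G} (hw : w ∈ (shortestPath hG.1 u (sepNode G u C)).support) (hwC : w ∈ C.1) :
    w = sepNode G u C := by
  by_contra hne
  have h1 := hG.dist_eq_sepNode_add_one hwC hne
  have h2 := SimpleGraph.Walk.dist_lt_of_mem_support hG.1 (shortestPath_length hG.1 _ _) hw hne
  omega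

/-- The node separates `C` from the clique through which it is entered. Together with
`IsBlockGraph.eq_sepNode_of_mem_shortestPath` this makes `NoReturnFromZero` applicable at the
separator node of `C`. -/
lemma IsBlockGraph.isMinCliqueSep_sepNode [Finite V] (hG : IsBlockGraph G) {u : V}
    {C : MaxClique G} (hs : sepNode G u C ≠ u) : IsMinCliqueSep G (sepNode G u C) := by
  have : Nonempty V := ⟨u⟩
  obtain ⟨D, hsD, hne⟩ := hG.exists_maxClique_sepNode_ne hs
  have hCD : C ≠ D := by rintro rfl; exact hne rfl
  refine ⟨C, D, hCD, ?_, ?_⟩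
  · intro a ha b hb p
    exact ⟨_, rfl, hG.mem_support_of_ne hCD (hG.sepNode_spec u C).1 hsD ha hb p⟩
  -- In a connected graph a separator of two non-empty sets is non-empty, so a singleton separator
  -- is minimal.
  · intro T hT _ x hx
    obtain ⟨a, ha⟩ := C.nonempty
    obtain ⟨b, hb⟩ := D.nonempty
    obtain ⟨p⟩ := hG.1.preconnected a b
    obtain ⟨y, hy, -⟩ := hT a ha b hb p
    have : T ⊆ {sepNode G u C} := by assumption
    rw [Set.mem_singleton_iff.1 hx, ← Set.mem_singleton_iff.1 (this hy)]
    exact hy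

/-- The nodes reached from `u` through the cliques in `D`. -/
def reached (G : SimpleGraph V) (u : V) (D : Finset (MaxClique G)) : Set V :=
  insert u {v | ∃ C ∈ D, v ∈ C.1}

lemma IsBlockGraph.sepNode_mem_reached [Finite V] (hG : IsBlockGraph G) {u : V}
    {D : Finset (MaxClique G)} {C : MaxClique G}
    (hD : ∀ K, G.dist u (sepNode G u K) < G.dist u (sepNode G u C) → K ∈ D) :
    sepNode G u C ∈ reached G u D := by
  by_cases hs : sepNode G u C = u
  · exact Or.inl hs
  · obtain ⟨K, hK, hne⟩ := hG.exists_maxClique_sepNode_ne hs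
    refine Or.inr ⟨K, hD K ?_, hK⟩
    rw [hG.dist_eq_sepNode_add_one hK hne]
    omega

/-- Suppose a walk from `a ∈ K ∈ D` to `C` avoids `s`. Preceded by the geodesic from `u` to `a` it
must meet `s`, so `s` lies on that geodesic strictly before `a`. As the separator node of `K` is no
farther from `u` than `s`, the two coincide, and then `s` is a common node of the distinct cliques
`K` and `C`, which every such walk meets. -/
lemma IsBlockGraph.isSeparatorOf_reached [Finite V] (hG : IsBlockGraph G) {u : V}
    {D : Finset (MaxClique G)} {C : MaxClique G} (hC : C ∉ D)
    (hD : ∀ K ∈ D, G.dist u (sepNode G u K) ≤ G.dist u (sepNode G u C)) :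
    IsSeparatorOf G (reached G u D) C.1 {sepNode G u C} := by
  intro a ha c hc p
  refine ⟨_, rfl, ?_⟩
  by_contra hs
  have has : a ≠ sepNode G u C := by rintro rfl; exact hs p.start_mem_support
  rcases ha with rfl | ⟨K, hK, haK⟩
  · exact hs ((hG.sepNode_spec a C).2 c hc p)
  · have hq := shortestPath_length hG.1 u a
    have hsq : sepNode G u C ∈ (shortestPath hG.1 u a).support := by
      have := (hG.sepNode_spec u C).2 c hc ((shortestPath hG.1 u a).append p)
      rw [SimpleGraph.Walk.mem_support_append_iff] at this
      exact this.resolve_right hs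
    have h1 := SimpleGraph.Walk.dist_lt_of_mem_support hG.1 hq hsq has.symm
    have h2 := hD K hK
    by_cases haK' : a = sepNode G u K
    · rw [← haK'] at h2; omega
    · have h3 := hG.dist_eq_sepNode_add_one haK haK'
      have h4 := SimpleGraph.Walk.eq_of_dist_eq hG.1 hq hsq ((hG.sepNode_spec u K).2 a haK _)
        (by omega)
      have hKC : K ≠ C := by rintro rfl; exact hC hK
      exact hs (hG.mem_support_of_ne hKC (h4 ▸ (hG.sepNode_spec u K).1) (hG.sepNode_spec u C).1
        haK hc p)

lemma IsBlockGraph.disjoint_reached [Finite V] (hG : IsBlockGraph G) {u : V}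
    {D : Finset (MaxClique G)} {C : MaxClique G} (hC : C ∉ D)
    (hD : ∀ K ∈ D, G.dist u (sepNode G u K) ≤ G.dist u (sepNode G u C)) :
    Disjoint (reached G u D) (C.1 \ {sepNode G u C}) := by
  rw [Set.disjoint_left]
  rintro a ha ⟨hac, has⟩
  -- The trivial walk at a common node has to meet the separator, so that node is the separator.
  obtain ⟨s, hs, h⟩ := hG.isSeparatorOf_reached hC hD a ha a hac .nil
  rw [Set.mem_singleton_iff.1 hs] at h
  exact has (by simpa [eq_comm] using h)

lemma reached_insert [DecidableEq (MaxClique G)] (u : V) (D : Finset (MaxClique G))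
    (C : MaxClique G) : reached G u (insert C D) = reached G u D ∪ C.1 := by
  ext v
  simp [reached, or_and_right, exists_or, or_comm, or_left_comm]

lemma reached_univ [Finite V] (u : V) : reached G u Finset.univ = Set.univ := by
  refine Set.eq_univ_of_forall fun v => Or.inr ?_
  obtain ⟨C, hC⟩ := exists_maxClique_superset (G := G) (K := {v}) (by simp)
  exact ⟨C, Finset.mem_univ _, hC rfl⟩

end BlockGraphs

/-! ### Portmanteau-type lower bounds and a Fatou lemma for possibly infinite measures. -/

section WeakLowerBounds

variable {ι E : Type*} [TopologicalSpace E] [MeasurableSpace E] [OpensMeasurableSpace E]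

/-- Superlevel sets of `f` are open, so the layer-cake formula and Fatou's lemma on the half-line
give the bound. -/
lemma lintegral_le_liminf_of_lowerSemicontinuous {l : Filter ι} [l.IsCountablyGenerated]
    {μ : Measure E} {μs : ι → Measure E}
    (h : ∀ O, IsOpen O → μ O ≤ liminf (fun i => μs i O) l) {f : E → ℝ≥0∞}
    (hf : LowerSemicontinuous f) : ∫⁻ x, f x ∂μ ≤ liminf (fun i => ∫⁻ x, f x ∂μs i) l := by
  have hfm : Measurable f := hf.measurable
  -- The truncation at `n` makes the integrand real-valued, as the layer-cake formula requires.
  have hmin : ∀ n : ℕ, ∀ ν : Measure E, ∫⁻ x, min (f x) n ∂ν =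
      ∫⁻ r in Set.Ioi (0 : ℝ), ν {x | ENNReal.ofReal r < min (f x) n} := by
    intro n ν
    have h1 := lintegral_eq_lintegral_meas_lt ν (f := fun x => (min (f x) n).toReal)
      (Eventually.of_forall fun _ => ENNReal.toReal_nonneg)
      (hfm.min measurable_const).ennreal_toReal.aemeasurable
    have h2 : ∀ x, min (f x) (n : ℝ≥0∞) ≠ ∞ := fun x =>
      ((min_le_right _ _).trans_lt (ENNReal.natCast_lt_top n)).ne
    simp_rw [ENNReal.ofReal_toReal (h2 _)] at h1
    rw [h1]
    refine setLIntegral_congr_fun measurableSet_Ioi fun r hr => ?_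
    congr 1
    ext x
    exact (ENNReal.ofReal_lt_iff_lt_toReal (le_of_lt hr) (h2 x)).symm
  have hopen : ∀ (n : ℕ) (r : ℝ), IsOpen {x | ENNReal.ofReal r < min (f x) n} := by
    intro n r
    have : {x | ENNReal.ofReal r < min (f x) n} =
        f ⁻¹' (Set.Ioi (ENNReal.ofReal r)) ∩ {_x | ENNReal.ofReal r < n} := by
      ext x; exact lt_min_iff (a := ENNReal.ofReal r) (b := f x) (c := (n : ℝ≥0∞))
    rw [this]
    exact (hf.isOpen_preimage _).inter isOpen_const
  have hmeas : ∀ (n : ℕ) (ν : Measure E),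
      Measurable fun r : ℝ => ν {x | ENNReal.ofReal r < min (f x) n} := fun n ν =>
    Antitone.measurable fun r r' hr => measure_mono fun x hx =>
      (ENNReal.ofReal_le_ofReal hr).trans_lt hx
  have hn : ∀ n : ℕ, ∫⁻ x, min (f x) n ∂μ ≤ liminf (fun i => ∫⁻ x, f x ∂μs i) l := by
    intro n
    calc ∫⁻ x, min (f x) n ∂μ
        = ∫⁻ r in Set.Ioi (0 : ℝ), μ {x | ENNReal.ofReal r < min (f x) n} := hmin n μ
      _ ≤ ∫⁻ r in Set.Ioi (0 : ℝ),
          liminf (fun i => μs i {x | ENNReal.ofReal r < min (f x) n}) l :=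
        lintegral_mono fun r => h _ (hopen n r)
      _ ≤ liminf (fun i => ∫⁻ r in Set.Ioi (0 : ℝ),
          μs i {x | ENNReal.ofReal r < min (f x) n}) l :=
        lintegral_liminf_le fun i => hmeas n (μs i)
      _ ≤ liminf (fun i => ∫⁻ x, f x ∂μs i) l := by
        refine liminf_le_liminf (Eventually.of_forall fun i => ?_)
        rw [← hmin n (μs i)]
        exact lintegral_mono fun x => min_le_left _ _
  have hsup : ∀ x, ⨆ n : ℕ, min (f x) (n : ℝ≥0∞) = f x := by
    intro x
    rw [← inf_iSup_eq, ENNReal.iSup_natCast, inf_top_eq]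
  calc ∫⁻ x, f x ∂μ = ∫⁻ x, ⨆ n : ℕ, min (f x) n ∂μ := by simp_rw [hsup]
    _ = ⨆ n : ℕ, ∫⁻ x, min (f x) n ∂μ := by
      refine lintegral_iSup (fun n => hfm.min measurable_const) fun m n hmn x => ?_
      exact min_le_min_left _ (by exact_mod_cast hmn)
    _ ≤ _ := iSup_le hn

/-- The infimum of the integrands over a tail of the filter, regularised from below, is a lower
semicontinuous function `L n`. It lies below `F i` for `i` in that tail, and it increases in `n` to
at least the joint liminf. The previous lemma applies to each `L n`, and monotone convergence
finishes. Regularisation removes any need for measurability of `F` and `F₀`. -/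
lemma lintegral_le_liminf_of_le_liminf_prod {l : Filter ι} [l.IsCountablyGenerated]
    {μ : Measure E} {μs : ι → Measure E}
    (h : ∀ O, IsOpen O → μ O ≤ liminf (fun i => μs i O) l) {F : ι → E → ℝ≥0∞} {F₀ : E → ℝ≥0∞}
    (hF : ∀ᵐ x ∂μ, F₀ x ≤ liminf (fun p : ι × E => F p.1 p.2) (l ×ˢ 𝓝 x)) :
    ∫⁻ x, F₀ x ∂μ ≤ liminf (fun i => ∫⁻ x, F i x ∂μs i) l := by
  obtain ⟨s, hs⟩ := l.exists_antitone_basis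
  set L : ℕ → E → ℝ≥0∞ := fun n x => liminf (fun y => ⨅ i ∈ s n, F i y) (𝓝 x) with hL
  have hlsc : ∀ n, LowerSemicontinuous (L n) := by
    intro n x r hr
    obtain ⟨r', hr, hr'⟩ := exists_between hr
    filter_upwards [eventually_eventually_nhds.2 (eventually_lt_of_lt_liminf hr')] with x' hx'
    exact hr.trans_le (le_liminf_of_le (by isBoundedDefault) (hx'.mono fun _ => le_of_lt))
  have hle : ∀ n x, ∀ i ∈ s n, L n x ≤ F i x := by
    intro n x i hi
    refine le_of_forall_lt fun r hr => ?_
    exact (eventually_lt_of_lt_liminf hr).self_of_nhds.trans_le (iInf₂_le i hi)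
  have hmono : Monotone L := by
    intro m n hmn x
    exact liminf_le_liminf (Eventually.of_forall fun y => biInf_mono fun i hi => hs.antitone hmn hi)
  have hsup : ∀ x, F₀ x ≤ liminf (fun p : ι × E => F p.1 p.2) (l ×ˢ 𝓝 x) →
      F₀ x ≤ ⨆ n, L n x := by
    intro x hx
    refine hx.trans (le_of_forall_lt fun r hr => ?_)
    obtain ⟨r', hr, hr'⟩ := exists_between hr
    obtain ⟨pa, ha, pb, hb, hab⟩ := eventually_prod_iff.1 (eventually_lt_of_lt_liminf hr')
    obtain ⟨n, hn⟩ := hs.mem_iff.1 ha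
    refine hr.trans_le (le_trans ?_ (le_iSup _ n))
    exact le_liminf_of_le (by isBoundedDefault)
      (hb.mono fun y hy => le_iInf₂ fun i hi => (hab (hn hi) hy).le)
  calc ∫⁻ x, F₀ x ∂μ ≤ ∫⁻ x, ⨆ n, L n x ∂μ := lintegral_mono_ae (hF.mono hsup)
    _ = ⨆ n, ∫⁻ x, L n x ∂μ := lintegral_iSup (fun n => (hlsc n).measurable) hmono
    _ ≤ _ := iSup_le fun n => ?_
  refine (lintegral_le_liminf_of_lowerSemicontinuous h (hlsc n)).trans (liminf_le_liminf ?_)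
  filter_upwards [hs.mem n] with i hi
  exact lintegral_mono fun x => hle n x i hi

end WeakLowerBounds

/-- By the Lindelöf property `O` is a countable union of members of `S`; masses of finite unions
converge by inclusion–exclusion. -/
lemma IsPiSystem.le_liminf_measure_of_isOpen {ι E : Type*} [TopologicalSpace E]
    [MeasurableSpace E] [SecondCountableTopology E] {S : Set (Set E)}
    (hS : IsPiSystem S) {μs : ι → Measure E} {μ : Measure E} {l : Filter ι}
    (hmeas : ∀ s ∈ S, MeasurableSet s) (hμ : ∀ s ∈ S, μ s ≠ ∞) (hμs : ∀ s ∈ S, ∀ i, μs i s ≠ ∞)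
    (h : ∀ s ∈ S, Tendsto (fun i => μs i s) l (𝓝 (μ s))) {O : Set E}
    (hO : ∀ x ∈ O, ∃ s ∈ S, s ∈ 𝓝 x ∧ s ⊆ O) : μ O ≤ liminf (fun i => μs i O) l := by
  choose! s hsS hs_nhds hsO using hO
  obtain ⟨T, hTc, hT⟩ := TopologicalSpace.isOpen_iUnion_countable
    (fun x : O => interior (s x)) fun x => isOpen_interior
  have hOeq : O = ⋃ x ∈ T, s x := by
    refine Set.Subset.antisymm (fun x hx => ?_) (Set.iUnion₂_subset fun x _ => hsO x x.2)
    have : x ∈ ⋃ y : O, interior (s y) :=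
      Set.mem_iUnion.2 ⟨⟨x, hx⟩, mem_interior_iff_mem_nhds.2 (hs_nhds x hx)⟩
    rw [← hT] at this
    exact Set.iUnion₂_mono (fun y _ => interior_subset) this
  rcases T.eq_empty_or_nonempty with hT0 | hT0
  · rw [hOeq]; simp [hT0]
  obtain ⟨f, rfl⟩ := hTc.exists_eq_range hT0
  rw [Set.biUnion_range] at hOeq
  refine le_of_forall_lt fun r hr => ?_
  have hacc := tendsto_measure_iUnion_accumulate (μ := μ) (f := fun n => s (f n))
  rw [← hOeq] at hacc
  obtain ⟨n, hn⟩ := ((tendsto_order.1 hacc).1 r hr).exists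
  classical
  set t : Finset (Set E) := (Finset.range (n + 1)).image fun k => s (f k)
  have ht : ∀ a ∈ t, a ∈ S := by
    intro a ha
    obtain ⟨k, -, rfl⟩ := Finset.mem_image.1 ha
    exact hsS _ (f k).2
  have hteq : Set.accumulate (fun n => s (f n)) n = ⋃ a ∈ t, a := by
    ext x
    simp [t, Set.mem_accumulate]
  have hreal := hS.tendsto_measureReal_biUnion (l := l) (μ := μs) (ν := μ) ht hmeas
    (fun a ha => (ENNReal.tendsto_toReal (hμ a ha)).comp (h a ha)) hμ hμs
  have hfin : ∀ ν : Measure E, (∀ a ∈ S, ν a ≠ ∞) → ν (⋃ a ∈ t, a) ≠ ∞ := fun ν hν =>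
    ((measure_biUnion_lt_top t.finite_toSet fun a ha => (hν a (ht a ha)).lt_top)).ne
  have hten : Tendsto (fun i => μs i (⋃ a ∈ t, a)) l (𝓝 (μ (⋃ a ∈ t, a))) :=
    (ENNReal.tendsto_toReal_iff (fun i => hfin _ fun a ha => hμs a ha i) (hfin _ hμ)).1 hreal
  rw [hteq] at hn
  obtain ⟨r', hr, hr'⟩ := exists_between hn
  refine hr.trans_le (le_liminf_of_le (by isBoundedDefault) ?_)
  filter_upwards [(tendsto_order.1 hten).1 r' hr'] with i hi
  refine hi.le.trans (measure_mono ?_)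
  rw [← hteq]
  exact (Set.accumulate_subset_iUnion n).trans hOeq.ge

/-! ### The radial measure `z⁻² dz`. -/

section Radial

/-- The measure `z⁻² dz` on `[0, ∞)`. -/
noncomputable def radialMeasure : Measure ℝ≥0 :=
  ((volume.restrict (Set.Ioi (0 : ℝ))).withDensity fun z => ENNReal.ofReal (z ^ 2)⁻¹).map
    Real.toNNReal

instance : SFinite radialMeasure := by
  unfold radialMeasure; infer_instance

lemma lintegral_radialMeasure {g : ℝ≥0 → ℝ≥0∞} (hg : Measurable g) :
    ∫⁻ r, g r ∂radialMeasure =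
      ∫⁻ z in Set.Ioi (0 : ℝ), g z.toNNReal * ENNReal.ofReal (z ^ 2)⁻¹ := by
  rw [radialMeasure, lintegral_map hg measurable_real_toNNReal,
    lintegral_withDensity_eq_lintegral_mul _ (by fun_prop)
      (show Measurable fun z : ℝ => g z.toNNReal from hg.comp measurable_real_toNNReal)]
  simp [mul_comm]

lemma radialMeasure_Ioi {a : ℝ≥0} (ha : 0 < a) : radialMeasure (Set.Ioi a) = (a : ℝ≥0∞)⁻¹ := by
  have h1 : radialMeasure (Set.Ioi a) =
      ∫⁻ z in Set.Ioi (a : ℝ), ENNReal.ofReal (z ^ (-2 : ℝ)) := by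
    rw [← lintegral_indicator_one measurableSet_Ioi,
      lintegral_radialMeasure (measurable_one.indicator measurableSet_Ioi),
      ← lintegral_indicator measurableSet_Ioi, ← lintegral_indicator measurableSet_Ioi]
    refine lintegral_congr fun z => ?_
    by_cases hz : (a : ℝ) < z
    · have hz0 : 0 < z := lt_of_le_of_lt a.2 hz
      have : a < z.toNNReal := (Real.lt_toNNReal_iff_coe_lt).2 hz
      rw [Set.indicator_of_mem (Set.mem_Ioi.2 hz0), Set.indicator_of_mem (Set.mem_Ioi.2 hz),
        Set.indicator_of_mem (Set.mem_Ioi.2 this)]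
      rw [Real.rpow_neg hz0.le]
      norm_cast
      simp
    · have : ¬ a < z.toNNReal := fun h => hz ((Real.lt_toNNReal_iff_coe_lt).1 h)
      rw [Set.indicator_of_notMem (s := Set.Ioi (a : ℝ)) (by simpa using hz)]
      by_cases hz0 : 0 < z
      · rw [Set.indicator_of_mem (Set.mem_Ioi.2 hz0), Set.indicator_of_notMem (by simpa using this),
          zero_mul]
      · rw [Set.indicator_of_notMem (by simpa using hz0)]
  have ha' : (0 : ℝ) < a := ha
  rw [h1, ← ofReal_integral_eq_lintegral_ofReal
    (integrableOn_Ioi_rpow_of_lt (by norm_num) ha')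
    ((ae_restrict_iff' measurableSet_Ioi).2 (Eventually.of_forall fun z hz =>
      Real.rpow_nonneg (ha'.le.trans (le_of_lt hz)) _)),
    integral_Ioi_rpow_of_lt (by norm_num) ha']
  have : -(a : ℝ) ^ (-2 + 1 : ℝ) / (-2 + 1) = ((a⁻¹ : ℝ≥0) : ℝ) := by
    norm_num
    rw [Real.rpow_neg_one]
  rw [this, ENNReal.ofReal_coe_nnreal, ENNReal.coe_inv ha.ne']

lemma radialMeasure_zero : radialMeasure {0} = 0 := by
  rw [← lintegral_indicator_one (measurableSet_singleton _),
    lintegral_radialMeasure (measurable_one.indicator (measurableSet_singleton _)),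
    setLIntegral_eq_zero measurableSet_Ioi]
  intro z hz
  simp [Set.indicator, not_le.2 (Set.mem_Ioi.1 hz)]

lemma radialMeasure_Ioc {a b : ℝ≥0} (ha : 0 < a) (hab : a ≤ b) :
    radialMeasure (Set.Ioc a b) = (a : ℝ≥0∞)⁻¹ - (b : ℝ≥0∞)⁻¹ := by
  rw [← Set.Ioi_sdiff_Ioi, measure_sdiff (Set.Ioi_subset_Ioi hab) measurableSet_Ioi.nullMeasurableSet,
    radialMeasure_Ioi ha, radialMeasure_Ioi (ha.trans_le hab)]
  rw [radialMeasure_Ioi (ha.trans_le hab)]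
  simp [(ha.trans_le hab).ne']

lemma radialMeasure_le_liminf {μs : ℝ≥0 → Measure ℝ≥0} [∀ t, IsFiniteMeasure (μs t)]
    (h : ∀ a : ℝ≥0, 0 < a → Tendsto (fun t => μs t (Set.Ioi a)) atTop (𝓝 (a : ℝ≥0∞)⁻¹))
    {O : Set ℝ≥0} (hO : IsOpen O) : radialMeasure O ≤ liminf (fun t => μs t O) atTop := by
  set S : Set (Set ℝ≥0) := {s | ∃ a b : ℝ≥0, 0 < a ∧ a ≤ b ∧ s = Set.Ioc a b}
  have hS : IsPiSystem S := by
    rintro _ ⟨a, b, ha, hab, rfl⟩ _ ⟨a', b', ha', hab', rfl⟩ ⟨x, hx⟩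
    rw [Set.Ioc_inter_Ioc] at hx ⊢
    exact ⟨_, _, lt_sup_of_lt_left ha, (hx.1.trans_le hx.2).le, rfl⟩
  have hlim : ∀ s ∈ S, Tendsto (fun t => μs t s) atTop (𝓝 (radialMeasure s)) := by
    rintro _ ⟨a, b, ha, hab, rfl⟩
    rw [radialMeasure_Ioc ha hab]
    have : ∀ t, μs t (Set.Ioc a b) = μs t (Set.Ioi a) - μs t (Set.Ioi b) := fun t => by
      rw [← Set.Ioi_sdiff_Ioi, measure_sdiff (Set.Ioi_subset_Ioi hab)
        measurableSet_Ioi.nullMeasurableSet (measure_ne_top _ _)]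
    simp_rw [this]
    exact ENNReal.Tendsto.sub (h a ha) (h b (ha.trans_le hab)) (Or.inl (by simp [ha.ne']))
  -- The intervals in `S` stay away from the origin, near which the mass is infinite; removing the
  -- null point `0` lets them exhaust the set.
  have h1 : radialMeasure O = radialMeasure (O \ {0}) :=
    (measure_sdiff_null radialMeasure_zero).symm
  rw [h1]
  refine (hS.le_liminf_measure_of_isOpen (O := O \ {0}) (l := atTop) (μs := μs) ?_ ?_
    (fun s _ t => measure_ne_top _ _) hlim ?_).trans
    (liminf_le_liminf (Eventually.of_forall fun t => measure_mono Set.sdiff_subset))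
  · rintro _ ⟨a, b, -, -, rfl⟩; exact measurableSet_Ioc
  · rintro _ ⟨a, b, ha, hab, rfl⟩
    rw [radialMeasure_Ioc ha hab]
    exact (tsub_le_self.trans_lt (by simp [ha])).ne
  · rintro x ⟨hx, hx0⟩
    have hx0 : 0 < x := pos_iff_ne_zero.2 hx0
    obtain ⟨a, b, ⟨hax, hxb⟩, hs⟩ := (mem_nhds_iff_exists_Ioo_subset' ⟨0, hx0⟩ ⟨x + 1, by simp⟩).1
      (hO.mem_nhds hx)
    obtain ⟨a', ha1, ha2⟩ := exists_between (max_lt hax hx0)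
    obtain ⟨b', hb1, hb2⟩ := exists_between hxb
    refine ⟨Set.Ioc a' b', ⟨a', b', (le_max_right _ _).trans_lt ha1, (ha2.trans hb1).le, rfl⟩,
      Ioc_mem_nhds ha2 hb1, fun y hy => ⟨hs ⟨?_, hy.2.trans_lt hb2⟩, ?_⟩⟩
    · exact (le_max_left _ _).trans_lt (ha1.trans hy.1)
    · rintro rfl
      exact not_lt_zero hy.1

end Radial

/-! ### Vectors truncated to a set of nodes and extended by one clique. -/

section Glue

variable {V : Type*}

open Classical in
/-- The vector with coordinates `y` on `B` and coordinates `x` off `B`. -/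
noncomputable def glue (B : Set V) (x : V → ℝ≥0) (y : B → ℝ≥0) : V → ℝ≥0 :=
  fun v => if h : v ∈ B then y ⟨v, h⟩ else x v

lemma continuous_glue (B : Set V) :
    Continuous fun p : (V → ℝ≥0) × (B → ℝ≥0) => glue B p.1 p.2 := by
  refine continuous_pi fun v => ?_
  by_cases h : v ∈ B
  · simp only [glue, h, dite_true]; fun_prop
  · simp only [glue, h, dite_false]; fun_prop

lemma measurable_glue (B : Set V) :
    Measurable fun p : (V → ℝ≥0) × (B → ℝ≥0) => glue B p.1 p.2 := by
  refine measurable_pi_lambda _ fun v => ?_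
  by_cases h : v ∈ B
  · simp only [glue, h, dite_true]; fun_prop
  · simp only [glue, h, dite_false]; fun_prop

lemma Measurable.glue {α : Type*} [MeasurableSpace α] {B : Set V} {f : α → V → ℝ≥0}
    {g : α → B → ℝ≥0} (hf : Measurable f) (hg : Measurable g) :
    Measurable fun a => glue B (f a) (g a) :=
  (measurable_glue B).comp (hf.prodMk hg)

lemma measurableSet_apply_ne_zero (s : V) : MeasurableSet {x : V → ℝ≥0 | x s ≠ 0} :=
  (measurable_pi_apply s (measurableSet_singleton 0)).compl

lemma measurable_indicator_pi (W : Set V) : Measurable fun x : V → ℝ≥0 => W.indicator x := by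
  refine measurable_pi_lambda _ fun v => ?_
  by_cases h : v ∈ W
  · simp only [Set.indicator, h, if_true]; fun_prop
  · simp only [Set.indicator, h, if_false]; fun_prop

lemma glue_zero_subvec (B : Set V) (x : V → ℝ≥0) : glue B 0 (subvec B x) = B.indicator x := by
  ext v
  by_cases h : v ∈ B <;> simp [glue, subvec, h]

/-- Since `s ∈ W`, overwriting the coordinates in `C ∖ s` is all that is needed to pass from `W` to
`W ∪ C`. -/
lemma indicator_union_eq_glue {W C : Set V} {s : V} (hs : s ∈ W) (x : V → ℝ≥0) :
    (W ∪ C).indicator x = glue (C \ {s}) (W.indicator x) (subvec (C \ {s}) x) := by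
  ext v
  by_cases h : v ∈ C \ {s}
  · simp [glue, subvec, h, h.1]
  · by_cases hW : v ∈ W
    · simp [glue, h, hW]
    · have : v ∉ C := fun hC => h ⟨hC, fun hv => hW (hv ▸ hs)⟩
      simp [glue, this, hW]

end Glue

/-! ### Disintegration under conditional independence. -/

section ConditionalLaws

/-- Conditional independence says that the law of `f` given `(k, g)` depends on `k` only, hence is
almost everywhere the given version `κ`. -/
lemma CondIndepFun.measure_eq_lintegral {E β β' γ : Type*} [MeasurableSpace E]
    [StandardBorelSpace E] [MeasurableSpace β] [StandardBorelSpace β] [Nonempty β]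
    [MeasurableSpace β'] [StandardBorelSpace β'] [Nonempty β'] [MeasurableSpace γ]
    {μ : Measure E} [IsFiniteMeasure μ] {f : E → β} {g : E → β'} {k : E → γ} (hf : Measurable f)
    (hg : Measurable g) (hk : Measurable k) (h : g ⟂ᵢ[k, hk; μ] f) {κ : Kernel γ β}
    [IsMarkovKernel κ] (hκ : HasCondDistrib f k κ μ) {T : Set ((γ × β') × β)}
    (hT : MeasurableSet T) :
    μ {x | ((k x, g x), f x) ∈ T} = ∫⁻ x, κ (k x) {y | ((k x, g x), y) ∈ T} ∂μ := by
  have hkg : Measurable fun x => (k x, g x) := hk.prodMk hg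
  have h1 := (condIndepFun_iff_condDistrib_prod_ae_eq_prodMkRight hf hg hk).1 h
  have h2 : condDistrib f k μ =ᵐ[μ.map k] κ :=
    condDistrib_ae_eq_of_measure_eq_compProd k hf.aemeasurable hκ.map_eq
  have h3 : condDistrib f (fun x => (k x, g x)) μ =ᵐ[μ.map fun x => (k x, g x)]
      κ.prodMkRight β' := by
    have h4 : ∀ᵐ p ∂(μ.map fun x => (k x, g x)), condDistrib f k μ p.1 = κ p.1 := by
      have : μ.map k = (μ.map fun x => (k x, g x)).map Prod.fst := by
        rw [Measure.map_map measurable_fst hkg]; rfl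
      rw [this] at h2
      exact ae_of_ae_map measurable_fst.aemeasurable h2
    filter_upwards [h1, h4] with p hp hp'
    rw [hp, Kernel.prodMkRight_apply, Kernel.prodMkRight_apply, hp']
  have h4 : (μ.map fun x => (k x, g x)) ⊗ₘ condDistrib f (fun x => (k x, g x)) μ =
      μ.map fun x => ((k x, g x), f x) := compProd_map_condDistrib hf.aemeasurable
  rw [Measure.compProd_congr h3] at h4
  have h5 : μ {x | ((k x, g x), f x) ∈ T} = μ.map (fun x => ((k x, g x), f x)) T :=
    (Measure.map_apply (hkg.prodMk hf) hT).symm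
  rw [h5, ← h4, Measure.compProd_apply hT, lintegral_map _ hkg]
  · rfl
  · exact Kernel.measurable_kernel_prodMk_left hT

lemma IsMarkovRandomField.measure_eq_lintegral {V Ω : Type*} [Finite V] [MeasurableSpace Ω]
    {G : SimpleGraph V} {P : Measure Ω} [IsProbabilityMeasure P] {X : Ω → V → ℝ≥0}
    (hMarkov : IsMarkovRandomField G P X) (hX : Measurable X) {A B : Set V} {s : V}
    (hAB : Disjoint A B) (hsA : s ∉ A) (hsB : s ∉ B) (hsep : IsSeparatorOf G A B {s})
    {κ : Kernel ℝ≥0 (B → ℝ≥0)} [IsMarkovKernel κ]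
    (hκ : HasCondDistrib (fun ω => subvec B (X ω)) (fun ω => X ω s) κ P)
    {T : Set ((V → ℝ≥0) × (B → ℝ≥0))} (hT : MeasurableSet T) :
    P {ω | ((insert s A).indicator (X ω), subvec B (X ω)) ∈ T} =
      ∫⁻ ω, κ (X ω s) {y | ((insert s A).indicator (X ω), y) ∈ T} ∂P := by
  classical
  have : IsProbabilityMeasure (P.map X) := Measure.isProbabilityMeasure_map hX.aemeasurable
  have hind : CondIndepFun (MeasurableSpace.comap (subvec {s}) inferInstance)
      (measurable_subvec {s}).comap_le (subvec A) (subvec B) (P.map X) := by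
    -- The Markov property is assumed for non-empty sets only; for an empty set the sub-vector is
    -- constant.
    rcases A.eq_empty_or_nonempty with hA | hA
    · have : IsEmpty A := Set.isEmpty_coe_sort.2 hA
      have h : (subvec A : (V → ℝ≥0) → A → ℝ≥0) = fun _ => isEmptyElim :=
        funext fun _ => Subsingleton.elim _ _
      rw [h]
      exact condIndepFun_const_left _ _
    rcases B.eq_empty_or_nonempty with hB | hB
    · have : IsEmpty B := Set.isEmpty_coe_sort.2 hB
      have h : (subvec B : (V → ℝ≥0) → B → ℝ≥0) = fun _ => isEmptyElim :=
        funext fun _ => Subsingleton.elim _ _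
      rw [h]
      exact condIndepFun_const_right _ _
    exact hMarkov A B {s} hA hB (Set.singleton_nonempty s) hAB
      (Set.disjoint_singleton_right.2 hsA) (Set.disjoint_singleton_right.2 hsB) hsep
  -- The kernel conditions on the number `X_s`, the Markov property on the one-coordinate vector;
  -- `e` identifies the two.
  let e : ℝ≥0 ≃ᵐ (({s} : Set V) → ℝ≥0) := (MeasurableEquiv.funUnique ({s} : Set V) ℝ≥0).symm
  have hcd : HasCondDistrib (subvec B) (subvec {s}) (κ.comap e.symm e.symm.measurable)
      (P.map X) := by
    have h1 : HasCondDistrib (subvec B) (fun x : V → ℝ≥0 => x s) κ (P.map X) := by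
      refine ⟨((measurable_pi_apply s).prodMk (measurable_subvec B)).aemeasurable, ?_⟩
      rw [Measure.map_map ((measurable_pi_apply s).prodMk (measurable_subvec B)) hX,
        Measure.map_map (measurable_pi_apply s) hX]
      exact hκ.map_eq
    have h2 := h1.measurableEquiv_comp_right e
    have h3 : (e ∘ fun x : V → ℝ≥0 => x s) = subvec {s} := by
      funext x v
      have : v = ⟨s, rfl⟩ := Subsingleton.elim _ _
      subst this
      rfl
    rwa [h3] at h2
  let r : ((({s} : Set V) → ℝ≥0) × (A → ℝ≥0)) × (B → ℝ≥0) → (V → ℝ≥0) × (B → ℝ≥0) :=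
    fun p => (glue {s} (glue A 0 p.1.2) p.1.1, p.2)
  have hr : Measurable r := by
    refine Measurable.prodMk ?_ measurable_snd
    refine (measurable_glue {s}).comp (Measurable.prodMk ?_ (by fun_prop))
    exact (measurable_glue A).comp (measurable_const.prodMk (by fun_prop))
  have hglue : ∀ x : V → ℝ≥0,
      glue {s} (glue A 0 (subvec A x)) (subvec {s} x) = (insert s A).indicator x := by
    intro x
    rw [glue_zero_subvec]
    ext v
    by_cases hv : v = s
    · subst hv; simp [glue, subvec]
    · by_cases hvA : v ∈ A <;> simp [glue, hv, hvA]
  have key := CondIndepFun.measure_eq_lintegral (measurable_subvec B) (measurable_subvec A)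
    (measurable_subvec {s}) hind hcd (hr hT)
  have hres : ∀ x : V → ℝ≥0, e.symm (subvec {s} x) = x s := fun x => rfl
  simp only [Set.mem_preimage, r, hglue, Kernel.comap_apply, hres] at key
  rw [Measure.map_apply hX, lintegral_map _ hX] at key
  · exact key
  · have h1 : Measurable fun x : V → ℝ≥0 => (x s, (insert s A).indicator x) :=
      (measurable_pi_apply s).prodMk (measurable_indicator_pi _)
    have h2 := Kernel.measurable_kernel_prodMk_left (κ := κ.prodMkRight (V → ℝ≥0))
      (t := {q : (ℝ≥0 × (V → ℝ≥0)) × (B → ℝ≥0) | (q.1.2, q.2) ∈ T})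
      ((by fun_prop : Measurable fun q : (ℝ≥0 × (V → ℝ≥0)) × (B → ℝ≥0) => (q.1.2, q.2)) hT)
    exact h2.comp h1
  · exact ((measurable_indicator_pi _).prodMk (measurable_subvec B)) hT

/-- Resampling one coordinate from its own law preserves a product law. It is used to integrate out
the increments of a single clique. -/
lemma lintegral_pi_update {ι : Type*} [Fintype ι] [DecidableEq ι] {E : ι → Type*}
    [∀ i, MeasurableSpace (E i)] (μ : ∀ i, Measure (E i)) [∀ i, IsProbabilityMeasure (μ i)]
    (i : ι) {H : (∀ i, E i) → ℝ≥0∞} (hH : Measurable H) :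
    ∫⁻ z, H z ∂(Measure.pi μ) = ∫⁻ z, ∫⁻ w, H (Function.update z i w) ∂(μ i) ∂(Measure.pi μ) := by
  have hm : Measurable fun z => ∫⁻ w, H (Function.update z i w) ∂(μ i) := by
    have := hH.lmarginal (s := {i}) μ
    simpa [lmarginal_singleton] using this
  refine lintegral_eq_of_lmarginal_eq {i} hH hm ?_
  rw [lmarginal_singleton, lmarginal_singleton]
  simp

end ConditionalLaws

/-! ### The tail field, its law, and the starting case of a single node. -/

section TailFieldLaws

variable {V : Type*} {G : SimpleGraph V}

lemma measurable_edgeIncrement (u a b : V) :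
    Measurable fun z : IncrementSpace G u => edgeIncrement G u z a b := by
  unfold edgeIncrement
  split
  · next h =>
    exact (measurable_pi_apply (⟨b, h.choose_spec.2⟩ : ↥(h.choose.1 \ {sepNode G u h.choose}))).comp
      (measurable_pi_apply h.choose)
  · exact measurable_const

lemma measurable_tailField (hG : G.Connected) (u v : V) :
    Measurable fun z : IncrementSpace G u => tailField hG u z v := by
  unfold tailField
  induction (shortestPath hG u v).darts with
  | nil => simp
  | cons d l ih =>
    simp only [List.map_cons, List.prod_cons]
    exact (measurable_edgeIncrement u _ _).mul ih

lemma IsBlockGraph.edgeIncrement_eq [Finite V] (hG : IsBlockGraph G) {u v : V} {C : MaxClique G}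
    (hv : v ∈ C.1 \ {sepNode G u C}) (z : IncrementSpace G u) :
    edgeIncrement G u z (sepNode G u C) v = z C ⟨v, hv⟩ := by
  have h : ∃ K : MaxClique G, sepNode G u K = sepNode G u C ∧ v ∈ K.1 \ {sepNode G u K} :=
    ⟨C, rfl, hv⟩
  rw [edgeIncrement, dif_pos h]
  have hK : h.choose = C := by
    have hs := h.choose_spec
    refine hG.maxClique_eq (x := sepNode G u C) (y := v) (fun h => hv.2 h.symm) ?_ hs.2.1
      (hG.sepNode_spec u C).1 hv.1
    exact Set.mem_of_eq_of_mem hs.1.symm (hG.sepNode_spec u h.choose).1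
  -- The type of the block `z K` depends on `K`, so the equality of cliques is substituted before
  -- the coordinates are compared.
  have aux : ∀ K : MaxClique G, K = C → ∀ hK : v ∈ K.1 \ {sepNode G u K},
      z K ⟨v, hK⟩ = z C ⟨v, hv⟩ := by
    rintro _ rfl _; rfl
  exact aux _ hK _

lemma IsBlockGraph.tailField_self [Finite V] (hG : IsBlockGraph G) (u : V)
    (z : IncrementSpace G u) : tailField hG.1 u z u = 1 := by
  simp [tailField, hG.shortestPath_self]

lemma IsBlockGraph.tailField_eq_mul [Finite V] (hG : IsBlockGraph G) {u v : V} {C : MaxClique G}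
    (hv : v ∈ C.1 \ {sepNode G u C}) (z : IncrementSpace G u) :
    tailField hG.1 u z v = tailField hG.1 u z (sepNode G u C) * z C ⟨v, hv⟩ := by
  rw [← hG.edgeIncrement_eq hv z]
  simp only [tailField]
  rw [hG.shortestPath_eq_concat hv.1 hv.2]
  simp [SimpleGraph.Walk.darts_concat]

/-- The law of `z A_u`, where `z` is distributed according to `z⁻² dz`. -/
noncomputable def tailLaw [Finite V] (hG : G.Connected)
    (ν : (C : MaxClique G) → (s : V) → ProbabilityMeasure (↥(C.1 \ {s}) → ℝ≥0)) (u : V) :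
    Measure (V → ℝ≥0) :=
  ((incrementLaw G ν u).prod radialMeasure).map fun p v => p.2 * tailField hG u p.1 v

/-- The measure `t P(X / t ∈ ·)` on `[0, ∞)^V`. -/
noncomputable def scaledLaw {Ω : Type*} [MeasurableSpace Ω] (P : Measure Ω) (X : Ω → V → ℝ≥0)
    (t : ℝ≥0) : Measure (V → ℝ≥0) := t • P.map (fun ω v => X ω v / t)

instance {Ω : Type*} [MeasurableSpace Ω] (P : Measure Ω) [IsFiniteMeasure P] (X : Ω → V → ℝ≥0)
    (t : ℝ≥0) : IsFiniteMeasure (scaledLaw P X t) := by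
  unfold scaledLaw; infer_instance

lemma measurable_div_const {Ω : Type*} [MeasurableSpace Ω] {X : Ω → V → ℝ≥0} (hX : Measurable X)
    (t : ℝ≥0) : Measurable fun ω v => X ω v / t :=
  measurable_pi_lambda _ fun v => ((measurable_pi_apply v).comp hX).div_const t

lemma scaledLaw_apply {Ω : Type*} [MeasurableSpace Ω] {P : Measure Ω} {X : Ω → V → ℝ≥0}
    (hX : Measurable X) (t : ℝ≥0) {S : Set (V → ℝ≥0)} (hS : MeasurableSet S) :
    scaledLaw P X t S = t * P {ω | (fun v => X ω v / t) ∈ S} := by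
  rw [scaledLaw, Measure.smul_apply, Measure.map_apply (measurable_div_const hX t) hS]
  rfl

lemma measurable_mul_tailField (hG : G.Connected) (u : V) :
    Measurable fun (p : IncrementSpace G u × ℝ≥0) (v : V) => p.2 * tailField hG u p.1 v :=
  measurable_pi_lambda _ fun v =>
    measurable_snd.mul ((measurable_tailField hG u v).comp measurable_fst)

lemma tendsto_mul_measure_lt_div {Ω : Type*} [MeasurableSpace Ω] {P : Measure Ω}
    {Y : Ω → ℝ≥0} (htail : Tendsto (fun t : ℝ≥0 => (t : ℝ≥0∞) * P {ω | t < Y ω}) atTop (𝓝 1))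
    {a : ℝ≥0} (ha : 0 < a) :
    Tendsto (fun t : ℝ≥0 => (t : ℝ≥0∞) * P {ω | a < Y ω / t}) atTop (𝓝 (a : ℝ≥0∞)⁻¹) := by
  have h1 : Tendsto (fun t : ℝ≥0 => a * t) atTop atTop := tendsto_id.const_mul_atTop ha
  have h2 := (ENNReal.Tendsto.const_mul (a := (a : ℝ≥0∞)⁻¹) (htail.comp h1)
    (Or.inl one_ne_zero))
  rw [mul_one] at h2
  refine h2.congr' ?_
  filter_upwards [eventually_gt_atTop 0] with t ht
  simp only [Function.comp]
  rw [← mul_assoc, ENNReal.coe_mul, ← mul_assoc, ENNReal.inv_mul_cancel (by simpa using ha.ne')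
    (by simp), one_mul]
  congr 2
  ext ω
  exact (lt_div_iff₀ ht).symm

lemma tendsto_scaledLaw_lt {Ω : Type*} [MeasurableSpace Ω] {P : Measure Ω} {X : Ω → V → ℝ≥0}
    (hX : Measurable X) {v : V}
    (htail : Tendsto (fun t : ℝ≥0 => (t : ℝ≥0∞) * P {ω | t < X ω v}) atTop (𝓝 1))
    {a : ℝ≥0} (ha : 0 < a) :
    Tendsto (fun t : ℝ≥0 => scaledLaw P X t {x | a < x v}) atTop (𝓝 (a : ℝ≥0∞)⁻¹) := by
  refine (tendsto_mul_measure_lt_div htail ha).congr fun t => ?_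
  rw [scaledLaw_apply hX t (measurableSet_lt measurable_const (measurable_pi_apply v))]
  rfl

variable [Finite V]

instance (ν : (C : MaxClique G) → (s : V) → ProbabilityMeasure (↥(C.1 \ {s}) → ℝ≥0)) (u : V) :
    IsProbabilityMeasure (incrementLaw G ν u) := by
  unfold incrementLaw; infer_instance

lemma lintegral_tailLaw (hG : G.Connected)
    (ν : (C : MaxClique G) → (s : V) → ProbabilityMeasure (↥(C.1 \ {s}) → ℝ≥0)) (u : V)
    {f : (V → ℝ≥0) → ℝ≥0∞} (hf : Measurable f) :
    ∫⁻ x, f x ∂(tailLaw hG ν u) =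
      ∫⁻ ζ, ∫⁻ r, f (fun v => r * tailField hG u ζ v) ∂radialMeasure ∂(incrementLaw G ν u) := by
  rw [tailLaw, lintegral_map hf (measurable_mul_tailField hG u),
    lintegral_prod (fun p : IncrementSpace G u × ℝ≥0 => f fun v => p.2 * tailField hG u p.1 v)
      (hf.comp (measurable_mul_tailField hG u)).aemeasurable]

/-- As `A_{uu} = 1`, the coordinate at the root is `z` itself. -/
lemma IsBlockGraph.tailLaw_Ioi (hG : IsBlockGraph G)
    (ν : (C : MaxClique G) → (s : V) → ProbabilityMeasure (↥(C.1 \ {s}) → ℝ≥0)) (u : V)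
    {S : Set ℝ≥0} (hS : MeasurableSet S) :
    tailLaw hG.1 ν u {x | x u ∈ S} = radialMeasure S := by
  have hm : MeasurableSet {x : V → ℝ≥0 | x u ∈ S} := measurable_pi_apply u hS
  rw [← lintegral_indicator_one hm, lintegral_tailLaw _ _ _ (measurable_one.indicator hm),
    ← lintegral_indicator_one hS]
  have : ∀ ζ : IncrementSpace G u, ∀ r : ℝ≥0, {x : V → ℝ≥0 | x u ∈ S}.indicator (1 : (V → ℝ≥0) → ℝ≥0∞)
      (fun v => r * tailField hG.1 u ζ v) = S.indicator 1 r := by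
    intro ζ r
    have h1 : r * tailField hG.1 u ζ u = r := by rw [hG.tailField_self, mul_one]
    have hiff : (fun v => r * tailField hG.1 u ζ v) ∈ {x : V → ℝ≥0 | x u ∈ S} ↔ r ∈ S := by
      change r * tailField hG.1 u ζ u ∈ S ↔ r ∈ S
      rw [h1]
    by_cases h : r ∈ S
    · rw [Set.indicator_of_mem (hiff.2 h), Set.indicator_of_mem h]; rfl
    · rw [Set.indicator_of_notMem (fun h' => h (hiff.1 h')), Set.indicator_of_notMem h]
  rw [lintegral_congr fun ζ => lintegral_congr (this ζ), lintegral_const, measure_univ, mul_one]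

lemma IsBlockGraph.tailLaw_singleton_le_liminf (hG : IsBlockGraph G)
    (ν : (C : MaxClique G) → (s : V) → ProbabilityMeasure (↥(C.1 \ {s}) → ℝ≥0)) {u : V}
    {Ω : Type*} [MeasurableSpace Ω] {P : Measure Ω} [IsFiniteMeasure P] {X : Ω → V → ℝ≥0}
    (hX : Measurable X)
    (htail : Tendsto (fun t : ℝ≥0 => (t : ℝ≥0∞) * P {ω | t < X ω u}) atTop (𝓝 1))
    {O : Set (V → ℝ≥0)} (hO : IsOpen O) :
    (tailLaw hG.1 ν u).map (fun x => ({u} : Set V).indicator x) O ≤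
      liminf (fun t => (scaledLaw P X t).map (fun x => ({u} : Set V).indicator x) O) atTop := by
  classical
  set j : ℝ≥0 → V → ℝ≥0 := fun r => Pi.single u r with hj
  have hjc : Continuous j := continuous_single (A := fun _ : V => ℝ≥0) u
  have hind : ∀ x : V → ℝ≥0, ({u} : Set V).indicator x = j (x u) := by
    intro x
    ext v
    by_cases hv : v = u
    · subst hv; simp [hj]
    · simp [hj, hv]
  have hm := (measurable_indicator_pi ({u} : Set V))
  have hpre : (fun x => ({u} : Set V).indicator x) ⁻¹' O = {x : V → ℝ≥0 | x u ∈ j ⁻¹' O} := by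
    ext x; simp only [Set.mem_preimage, Set.mem_ofPred_eq, hind]
  have hOj := hO.preimage hjc
  rw [Measure.map_apply hm hO.measurableSet, hpre, hG.tailLaw_Ioi ν u hOj.measurableSet]
  have hpush : ∀ (t : ℝ≥0) (S : Set ℝ≥0), MeasurableSet S →
      scaledLaw P X t {x | x u ∈ S} = (scaledLaw P X t).map (fun x => x u) S := fun t S hS =>
    (Measure.map_apply (measurable_pi_apply u) hS).symm
  refine (radialMeasure_le_liminf (μs := fun t => (scaledLaw P X t).map fun x => x u) ?_ hOj).trans
    (le_of_eq ?_)
  · intro a ha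
    refine (tendsto_scaledLaw_lt hX htail ha).congr fun t => ?_
    exact hpush t _ measurableSet_Ioi
  · congr 1
    ext t
    rw [Measure.map_apply hm hO.measurableSet, hpre, hpush t _ hOj.measurableSet]

end TailFieldLaws

/-! ### Pointwise lower bounds for the conditional laws on one clique. -/

section CliqueStep

variable {V : Type*} [Finite V]

/-- For `x'` near `x` the level `t x'_s` still tends to infinity because `x_s > 0`, so the
conditional law rescaled by `t x'_s` tends weakly to `ν`. Multiplying back by `x'_s` turns this into
the rescaling by `t`. -/
lemma le_liminf_of_tendsto_rescaledCondLaw {B : Set V} {s : V} {κ : Kernel ℝ≥0 (B → ℝ≥0)}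
    [IsMarkovKernel κ] {ν : ProbabilityMeasure (B → ℝ≥0)}
    (hν : Tendsto (fun t : ℝ≥0 => rescaledCondLaw κ t) atTop (𝓝 ν)) {O : Set (V → ℝ≥0)}
    (hO : IsOpen O) {x : V → ℝ≥0} (hx : 0 < x s) :
    (ν : Measure (B → ℝ≥0)) {w | glue B x (fun v => x s * w v) ∈ O} ≤
      liminf (fun p : ℝ≥0 × (V → ℝ≥0) => κ (p.1 * p.2 s) {y | glue B p.2 (fun v => y v / p.1) ∈ O})
        (atTop ×ˢ 𝓝 x) := by
  have hcs : ∀ x : V → ℝ≥0, Continuous fun w : B → ℝ≥0 => glue B x (fun v => x s * w v) := by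
    intro x
    exact (continuous_glue B).comp (continuous_const.prodMk
      (continuous_pi fun v => continuous_const.mul (continuous_apply v)))
  have hs : Tendsto (fun p : ℝ≥0 × (V → ℝ≥0) => p.2 s) (atTop ×ˢ 𝓝 x) (𝓝 (x s)) :=
    ((continuous_apply s).tendsto x).comp tendsto_snd
  have htop : Tendsto (fun p : ℝ≥0 × (V → ℝ≥0) => p.1 * p.2 s) (atTop ×ˢ 𝓝 x) atTop :=
    tendsto_fst.atTop_mul_pos hx hs
  have hweak := hν.comp htop
  have hopen : ∀ U, IsOpen U → (ν : Measure (B → ℝ≥0)) U ≤ liminf (fun p : ℝ≥0 × (V → ℝ≥0) =>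
      (rescaledCondLaw κ (p.1 * p.2 s) : Measure (B → ℝ≥0)) U) (atTop ×ˢ 𝓝 x) := fun U hU =>
    ProbabilityMeasure.le_liminf_measure_open_of_tendsto hweak hU
  -- The index is the pair `(t, x')` and the variable of integration is `w`; membership in `O` is an
  -- open condition on `(x', w)` jointly, which gives the required bound on the indicators.
  have key := lintegral_le_liminf_of_le_liminf_prod (l := (atTop ×ˢ 𝓝 x)) hopen
    (F₀ := {w : B → ℝ≥0 | glue B x (fun v => x s * w v) ∈ O}.indicator 1)
    (F := fun p => {w : B → ℝ≥0 | glue B p.2 (fun v => p.2 s * w v) ∈ O}.indicator 1) ?_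
  · have hms : ∀ x : V → ℝ≥0, MeasurableSet {w : B → ℝ≥0 | glue B x (fun v => x s * w v) ∈ O} :=
      fun x => (hO.preimage (hcs x)).measurableSet
    rw [lintegral_indicator_one (hms x)] at key
    refine key.trans (liminf_le_liminf ?_)
    filter_upwards [hs.eventually (lt_mem_nhds hx)] with p hp
    have hp : p.2 s ≠ 0 := (pos_iff_ne_zero.1 hp)
    rw [lintegral_indicator_one (hms p.2)]
    simp only [rescaledCondLaw, ProbabilityMeasure.coe_mk]
    rw [Measure.map_apply (by fun_prop) (hms p.2)]
    refine (congrArg _ ?_).le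
    ext y
    have : ∀ v, p.2 s * (y v / (p.1 * p.2 s)) = y v / p.1 := by
      intro v
      rw [mul_comm p.1, ← mul_div_assoc, mul_div_mul_left _ _ hp]
    simp only [Set.mem_preimage, Set.mem_ofPred_eq, this]
  · refine Eventually.of_forall fun w => ?_
    by_cases hw : glue B x (fun v => x s * w v) ∈ O
    · rw [Set.indicator_of_mem (by exact hw)]
      refine le_liminf_of_le (by isBoundedDefault) ?_
      have hc' : Continuous fun (q : (V → ℝ≥0) × (B → ℝ≥0)) (v : B) => q.1 s * q.2 v :=
        continuous_pi fun v => by fun_prop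
      have hc : Continuous fun q : (V → ℝ≥0) × (B → ℝ≥0) =>
          glue B q.1 (fun v => q.1 s * q.2 v) :=
        (continuous_glue B).comp (continuous_fst.prodMk hc')
      have hev : ∀ᶠ q : (V → ℝ≥0) × (B → ℝ≥0) in 𝓝 x ×ˢ 𝓝 w,
          glue B q.1 (fun v => q.1 s * q.2 v) ∈ O := by
        rw [← nhds_prod_eq]
        exact (hO.preimage hc).mem_nhds hw
      have hten : Tendsto (fun q : (ℝ≥0 × (V → ℝ≥0)) × (B → ℝ≥0) => (q.1.2, q.2))
          ((atTop ×ˢ 𝓝 x) ×ˢ 𝓝 w) (𝓝 x ×ˢ 𝓝 w) :=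
        (tendsto_snd.comp tendsto_fst).prodMk tendsto_snd
      filter_upwards [hten.eventually hev] with q hq
      rw [Set.indicator_of_mem (by exact hq)]
      rfl
    · rw [Set.indicator_of_notMem (by exact hw)]
      exact zero_le

/-- At `x_s = 0` the limit field vanishes on `C ∖ s`. The hypothesis keeps all of `X_{C∖s}/t` below
`η` with probability close to one, uniformly over `x'_s ≤ δ`, so the glued vector stays in a product
neighbourhood inside `O`. -/
lemma one_le_liminf_of_limsup_eq_zero {B : Set V} {s : V} {κ : Kernel ℝ≥0 (B → ℝ≥0)}
    [IsMarkovKernel κ]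
    (hκ : ∀ η : ℝ≥0, 0 < η → limsup (fun δ : ℝ≥0 => limsup (fun t : ℝ≥0 =>
      ⨆ x ∈ Set.Icc (0 : ℝ≥0) δ, κ (t * x) {y | ∃ v, η < y v / t}) atTop) (𝓝[>] 0) = 0)
    {O : Set (V → ℝ≥0)} (hO : IsOpen O) {x : V → ℝ≥0} (hx : x s = 0) (hxO : glue B x 0 ∈ O) :
    1 ≤ liminf (fun p : ℝ≥0 × (V → ℝ≥0) => κ (p.1 * p.2 s)
      {y | glue B p.2 (fun v => y v / p.1) ∈ O}) (atTop ×ˢ 𝓝 x) := by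
  have := Fintype.ofFinite B
  have hnhds : (fun p : (V → ℝ≥0) × (B → ℝ≥0) => glue B p.1 p.2) ⁻¹' O ∈
      𝓝 x ×ˢ 𝓝 (0 : B → ℝ≥0) := by
    rw [← nhds_prod_eq]
    exact (hO.preimage (continuous_glue B)).mem_nhds hxO
  obtain ⟨N, hN, N', hN', hNN'⟩ := mem_prod_iff.1 hnhds
  obtain ⟨η, hη, hηN⟩ := Metric.nhds_basis_closedBall.mem_iff.1 hN'
  lift η to ℝ≥0 using hη.le
  have hη' : 0 < η := hη
  have hball : ∀ y : B → ℝ≥0, (∀ v, y v ≤ η) → y ∈ N' := by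
    intro y hy
    refine hηN ?_
    rw [Metric.mem_closedBall, dist_pi_le_iff hη.le]
    intro v
    rw [NNReal.dist_eq]
    simpa using hy v
  refine le_of_forall_lt fun r hr => ?_
  obtain ⟨r', hr, hr'⟩ := exists_between hr
  refine hr.trans_le ?_
  have hε : (0 : ℝ≥0∞) < 1 - r' := tsub_pos_of_lt hr'
  have h1 : ∀ᶠ δ : ℝ≥0 in 𝓝[>] 0, limsup (fun t : ℝ≥0 =>
      ⨆ x ∈ Set.Icc (0 : ℝ≥0) δ, κ (t * x) {y | ∃ v, η < y v / t}) atTop < 1 - r' :=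
    eventually_lt_of_limsup_lt (by rw [hκ η hη']; exact hε)
  obtain ⟨δ, hδ, hδ0⟩ := (h1.and self_mem_nhdsWithin).exists
  have h2 := eventually_lt_of_limsup_lt hδ
  have hδx : ∀ᶠ x' : V → ℝ≥0 in 𝓝 x, x' s ≤ δ := by
    have : ∀ᶠ z in 𝓝 (x s), z < δ := Iio_mem_nhds (by rw [hx]; exact hδ0)
    exact ((continuous_apply s).tendsto x).eventually (this.mono fun _ => le_of_lt)
  refine le_liminf_of_le (by isBoundedDefault) ?_
  filter_upwards [h2.prod_mk (hδx.and hN)] with p ⟨hp1, hp2, hp3⟩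
  have hle : κ (p.1 * p.2 s) {y | ∃ v, η < y v / p.1} ≤ 1 - r' :=
    (le_iSup₂ (f := fun x (_ : x ∈ Set.Icc (0 : ℝ≥0) δ) =>
      κ (p.1 * x) {y | ∃ v, η < y v / p.1}) (p.2 s) ⟨zero_le, hp2⟩).trans hp1.le
  have hmeas : MeasurableSet {y : B → ℝ≥0 | ∃ v, η < y v / p.1} := by
    have : {y : B → ℝ≥0 | ∃ v, η < y v / p.1} = ⋃ v, {y | η < y v / p.1} := by ext; simp
    rw [this]
    exact MeasurableSet.iUnion fun v =>
      measurableSet_lt measurable_const ((measurable_pi_apply v).div_const _)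
  calc r' = 1 - (1 - r') := (ENNReal.sub_sub_cancel ENNReal.one_ne_top hr'.le).symm
    _ ≤ 1 - κ (p.1 * p.2 s) {y | ∃ v, η < y v / p.1} := tsub_le_tsub_left hle _
    _ = κ (p.1 * p.2 s) {y | ∃ v, η < y v / p.1}ᶜ := (prob_compl_eq_one_sub hmeas).symm
    _ ≤ _ := measure_mono fun y hy => ?_
  have hy' : ∀ v, y v / p.1 ≤ η := by
    intro v
    by_contra h
    exact hy ⟨v, not_le.1 h⟩
  exact hNN' (Set.mk_mem_prod hp3 (hball _ hy'))

end CliqueStep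

/-! ### The lower bound on open sets, by induction over the cliques. -/

section Induction

variable {V : Type*} [Finite V] {G : SimpleGraph V}

lemma ae_edgeIncrement_ne_zero
    (ν : (C : MaxClique G) → (s : V) → ProbabilityMeasure (↥(C.1 \ {s}) → ℝ≥0)) (u a b : V)
    (h0 : ∀ K : MaxClique G, a ∈ K.1 → ∀ hb : b ∈ K.1 \ {a},
      (ν K a : Measure (↥(K.1 \ {a}) → ℝ≥0)) {y | y ⟨b, hb⟩ = 0} = 0)
    (hsep : ∀ K : MaxClique G, sepNode G u K ∈ K.1) :
    ∀ᵐ ζ ∂(incrementLaw G ν u), edgeIncrement G u ζ a b ≠ 0 := by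
  unfold edgeIncrement
  split
  · next h =>
    have hK := h.choose_spec
    have aux : ∀ K : MaxClique G, sepNode G u K = a → ∀ hb : b ∈ K.1 \ {sepNode G u K},
        (ν K (sepNode G u K) : Measure (↥(K.1 \ {sepNode G u K}) → ℝ≥0)) {y | y ⟨b, hb⟩ = 0} = 0 := by
      rintro K rfl hb
      exact h0 K (hsep K) hb
    have h1 := aux h.choose hK.1 hK.2
    have hmp := measurePreserving_eval
      (fun C : MaxClique G => (ν C (sepNode G u C) : Measure (↥(C.1 \ {sepNode G u C}) → ℝ≥0))) h.choose
    have h2 : ∀ᵐ y ∂(ν h.choose (sepNode G u h.choose) :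
        Measure (↥(h.choose.1 \ {sepNode G u h.choose}) → ℝ≥0)), y ⟨b, hK.2⟩ ≠ 0 := by
      rw [ae_iff]
      simpa using h1
    exact hmp.quasiMeasurePreserving.ae h2
  · exact Eventually.of_forall fun _ => one_ne_zero

lemma ae_tailField_ne_zero (hG : G.Connected)
    (ν : (C : MaxClique G) → (s : V) → ProbabilityMeasure (↥(C.1 \ {s}) → ℝ≥0)) (u s : V)
    (h0 : ∀ d ∈ (shortestPath hG u s).darts, ∀ K : MaxClique G, d.fst ∈ K.1 →
      ∀ hb : d.snd ∈ K.1 \ {d.fst},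
        (ν K d.fst : Measure (↥(K.1 \ {d.fst}) → ℝ≥0)) {y | y ⟨d.snd, hb⟩ = 0} = 0)
    (hsep : ∀ K : MaxClique G, sepNode G u K ∈ K.1) :
    ∀ᵐ ζ ∂(incrementLaw G ν u), tailField hG u ζ s ≠ 0 := by
  have h1 : ∀ᵐ ζ ∂(incrementLaw G ν u), ∀ d ∈ {d | d ∈ (shortestPath hG u s).darts},
      edgeIncrement G u ζ d.fst d.snd ≠ 0 :=
    (eventually_all_finite (List.finite_toSet _)).2 fun d hd =>
      ae_edgeIncrement_ne_zero ν u d.fst d.snd (h0 d hd) hsep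
  filter_upwards [h1] with ζ hζ h
  rw [tailField, List.prod_eq_zero_iff, List.mem_map] at h
  obtain ⟨d, hd, hd0⟩ := h
  exact hζ d hd hd0

lemma ae_tailLaw_ne_zero (hG : G.Connected)
    (ν : (C : MaxClique G) → (s : V) → ProbabilityMeasure (↥(C.1 \ {s}) → ℝ≥0)) (u s : V)
    (h : ∀ᵐ ζ ∂(incrementLaw G ν u), tailField hG u ζ s ≠ 0) :
    ∀ᵐ x ∂(tailLaw hG ν u), x s ≠ 0 := by
  rw [tailLaw, ae_map_iff (measurable_mul_tailField hG u).aemeasurable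
    (measurableSet_apply_ne_zero s)]
  have h1 := Measure.quasiMeasurePreserving_fst (μ := incrementLaw G ν u)
    (ν := radialMeasure).ae h
  have h2 : ∀ᵐ r ∂radialMeasure, r ≠ 0 := by
    rw [ae_iff]
    simpa using radialMeasure_zero
  have h3 := Measure.quasiMeasurePreserving_snd (μ := incrementLaw G ν u)
    (ν := radialMeasure).ae h2
  filter_upwards [h1, h3] with p hp1 hp2
  exact mul_ne_zero hp2 hp1

/-- If some edge on the path from `u` to `s` has an atom at zero, `NoReturnFromZero` handles the
points with `x_s = 0`; otherwise `A_{us} ≠ 0` almost surely and those points are null. Elsewhere the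
weak limits suffice. -/
lemma IsBlockGraph.ae_le_liminf (hG : IsBlockGraph G)
    {κ : (C : MaxClique G) → (s : V) → Kernel ℝ≥0 (↥(C.1 \ {s}) → ℝ≥0)}
    [∀ C s, IsMarkovKernel (κ C s)]
    {ν : (C : MaxClique G) → (s : V) → ProbabilityMeasure (↥(C.1 \ {s}) → ℝ≥0)}
    (hν : CliqueLimits G κ ν) (hzero : NoReturnFromZero hG.1 κ ν) {u : V} {C : MaxClique G}
    {W : Set V} (hsW : sepNode G u C ∈ W) {O : Set (V → ℝ≥0)} (hO : IsOpen O) :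
    ∀ᵐ x ∂((tailLaw hG.1 ν u).map fun x => W.indicator x),
      (ν C (sepNode G u C) : Measure (↥(C.1 \ {sepNode G u C}) → ℝ≥0))
          {w | glue (C.1 \ {sepNode G u C}) x (fun v => x (sepNode G u C) * w v) ∈ O} ≤
        liminf (fun p : ℝ≥0 × (V → ℝ≥0) => κ C (sepNode G u C) (p.1 * p.2 (sepNode G u C))
          {y | glue (C.1 \ {sepNode G u C}) p.2 (fun v => y v / p.1) ∈ O}) (atTop ×ˢ 𝓝 x) := by
  set s := sepNode G u C with hs
  have hsC : s ∈ C.1 := (hG.sepNode_spec u C).1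
  by_cases hd : ∃ d ∈ (shortestPath hG.1 u s).darts, ∃ K : MaxClique G, d.fst ∈ K.1 ∧
      ∃ hb : d.snd ∈ K.1 \ {d.fst},
        0 < (ν K d.fst : Measure (↥(K.1 \ {d.fst}) → ℝ≥0)) {y | y ⟨d.snd, hb⟩ = 0}
  -- The path to `s` contains an edge, so it is not the trivial path at `u`.
  · have hsu : sepNode G u C ≠ u := by
      intro h
      obtain ⟨d, hd, -⟩ := hd
      have h1 := List.length_pos_of_mem hd
      rw [SimpleGraph.Walk.length_darts, shortestPath_length, hs, h, SimpleGraph.dist_self] at h1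
      exact lt_irrefl _ h1
    have hlim := hzero u s (hG.isMinCliqueSep_sepNode hsu) C hsC
      (fun w hw hwC => hG.eq_sepNode_of_mem_shortestPath hw hwC) hd
    refine Eventually.of_forall fun x => ?_
    rcases eq_zero_or_pos (x s) with hx | hx
    · by_cases hxO : glue (C.1 \ {s}) x 0 ∈ O
      · exact prob_le_one.trans (one_le_liminf_of_limsup_eq_zero hlim hO hx hxO)
      · have : {w : ↥(C.1 \ {s}) → ℝ≥0 | glue (C.1 \ {s}) x (fun v => x s * w v) ∈ O} = ∅ := by
          ext w
          simp only [hx, zero_mul, Set.mem_ofPred_eq, Set.mem_empty_iff_false, iff_false]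
          exact hxO
        rw [this, measure_empty]
        exact zero_le
    · exact le_liminf_of_tendsto_rescaledCondLaw (hν C s hsC) hO hx
  · have h1 : ∀ᵐ x ∂(tailLaw hG.1 ν u), x s ≠ 0 := by
      refine ae_tailLaw_ne_zero _ _ _ _ (ae_tailField_ne_zero _ _ _ _ ?_
        fun K => (hG.sepNode_spec u K).1)
      intro d hdd K hK hb
      by_contra hne
      exact hd ⟨d, hdd, K, hK, hb, pos_iff_ne_zero.2 hne⟩
    have h2 : ∀ᵐ x ∂((tailLaw hG.1 ν u).map fun x => W.indicator x), x s ≠ 0 := by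
      refine (ae_map_iff (measurable_indicator_pi W).aemeasurable
        (measurableSet_apply_ne_zero s)).2 ?_
      filter_upwards [h1] with x hx
      rwa [Set.indicator_of_mem hsW]
    filter_upwards [h2] with x hx
    exact le_liminf_of_tendsto_rescaledCondLaw (hν C s hsC) hO (pos_iff_ne_zero.2 hx)

/-- By `hind` the tail field on `W` does not involve the increments of `C`, so these can be
resampled and integrated first; on `C ∖ s` the field is `A_{us}` times them. -/
lemma IsBlockGraph.tailLaw_map_union (hG : IsBlockGraph G)
    (ν : (C : MaxClique G) → (s : V) → ProbabilityMeasure (↥(C.1 \ {s}) → ℝ≥0)) {u : V}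
    [DecidableEq (MaxClique G)] {C : MaxClique G} {W : Set V} (hsW : sepNode G u C ∈ W)
    (hind : ∀ v ∈ W, ∀ (ζ : IncrementSpace G u) (w : ↥(C.1 \ {sepNode G u C}) → ℝ≥0),
      tailField hG.1 u (Function.update ζ C w) v = tailField hG.1 u ζ v)
    {O : Set (V → ℝ≥0)} (hO : MeasurableSet O) :
    (tailLaw hG.1 ν u).map (fun x => (W ∪ C.1).indicator x) O =
      ∫⁻ x, (ν C (sepNode G u C) : Measure (↥(C.1 \ {sepNode G u C}) → ℝ≥0))
          {w | glue (C.1 \ {sepNode G u C}) x (fun v => x (sepNode G u C) * w v) ∈ O}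
        ∂((tailLaw hG.1 ν u).map fun x => W.indicator x) := by
  set s := sepNode G u C with hs
  set T : Set ((V → ℝ≥0) × (↥(C.1 \ {s}) → ℝ≥0)) :=
    {p | glue (C.1 \ {s}) p.1 (fun v => p.1 s * p.2 v) ∈ O} with hTdef
  have hT : MeasurableSet T := by
    have : Measurable fun p : (V → ℝ≥0) × (↥(C.1 \ {s}) → ℝ≥0) =>
        glue (C.1 \ {s}) p.1 (fun v => p.1 s * p.2 v) :=
      measurable_fst.glue (measurable_pi_lambda _ fun v => by fun_prop)
    exact this hO
  set φ : (V → ℝ≥0) × (↥(C.1 \ {s}) → ℝ≥0) → ℝ≥0∞ := T.indicator 1 with hφ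
  have hφm : Measurable φ := measurable_one.indicator hT
  have hWm := measurable_indicator_pi W
  have hUm := measurable_indicator_pi (W ∪ C.1)
  have hAm : Measurable fun p : IncrementSpace G u × ℝ≥0 =>
      W.indicator fun v => p.2 * tailField hG.1 u p.1 v :=
    hWm.comp (measurable_mul_tailField hG.1 u)
  have hpoint : ∀ (ζ : IncrementSpace G u) (r : ℝ≥0),
      ((fun x : V → ℝ≥0 => (W ∪ C.1).indicator x) ⁻¹' O).indicator (1 : (V → ℝ≥0) → ℝ≥0∞)
        (fun v => r * tailField hG.1 u ζ v) =
      φ (W.indicator (fun v => r * tailField hG.1 u ζ v), ζ C) := by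
    intro ζ r
    have h1 : (W ∪ C.1).indicator (fun v => r * tailField hG.1 u ζ v) =
        glue (C.1 \ {s}) (W.indicator fun v => r * tailField hG.1 u ζ v)
          (fun v => (W.indicator fun v => r * tailField hG.1 u ζ v) s * ζ C v) := by
      rw [indicator_union_eq_glue hsW]
      congr 1
      ext v
      rw [Set.indicator_of_mem hsW, subvec, hG.tailField_eq_mul v.2 ζ, mul_assoc]
    have h2 : (fun v => r * tailField hG.1 u ζ v) ∈
        ((fun x : V → ℝ≥0 => (W ∪ C.1).indicator x) ⁻¹' O) ↔
        (W.indicator (fun v => r * tailField hG.1 u ζ v), ζ C) ∈ T := by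
      rw [Set.mem_preimage, h1]; rfl
    by_cases h : (W.indicator (fun v => r * tailField hG.1 u ζ v), ζ C) ∈ T
    · rw [hφ, Set.indicator_of_mem h, Set.indicator_of_mem (h2.2 h)]; rfl
    · rw [hφ, Set.indicator_of_notMem h, Set.indicator_of_notMem (fun h' => h (h2.1 h'))]
  have hHm : Measurable fun ζ : IncrementSpace G u =>
      ∫⁻ r, φ (W.indicator (fun v => r * tailField hG.1 u ζ v), ζ C) ∂radialMeasure := by
    refine Measurable.lintegral_prod_right
      (f := fun (ζ : IncrementSpace G u) r =>
        φ (W.indicator (fun v => r * tailField hG.1 u ζ v), ζ C)) ?_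
    exact hφm.comp (hAm.prodMk ((measurable_pi_apply C).comp measurable_fst))
  have hsec : ∀ x : V → ℝ≥0, (ν C s : Measure (↥(C.1 \ {s}) → ℝ≥0))
      {w | glue (C.1 \ {s}) x (fun v => x s * w v) ∈ O} = ∫⁻ w, φ (x, w) ∂(ν C s : Measure _) := by
    intro x
    have : (fun w => φ (x, w)) =
        ({w | glue (C.1 \ {s}) x (fun v => x s * w v) ∈ O} : Set _).indicator 1 := rfl
    rw [this, lintegral_indicator_one]
    exact measurable_prodMk_left hT
  have hRm : Measurable fun x : V → ℝ≥0 => ∫⁻ w, φ (x, w) ∂(ν C s : Measure _) :=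
    Measurable.lintegral_prod_right (f := fun x w => φ (x, w)) hφm
  calc (tailLaw hG.1 ν u).map (fun x => (W ∪ C.1).indicator x) O
      = ∫⁻ ζ, ∫⁻ r, φ (W.indicator (fun v => r * tailField hG.1 u ζ v), ζ C) ∂radialMeasure
          ∂(incrementLaw G ν u) := by
        rw [Measure.map_apply hUm hO, ← lintegral_indicator_one (hUm hO),
          lintegral_tailLaw _ _ _ (measurable_one.indicator (hUm hO))]
        exact lintegral_congr fun ζ => lintegral_congr fun r => hpoint ζ r
    _ = ∫⁻ ζ, ∫⁻ w, ∫⁻ r, φ (W.indicator (fun v => r * tailField hG.1 u ζ v), w) ∂radialMeasure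
          ∂(ν C s : Measure (↥(C.1 \ {s}) → ℝ≥0)) ∂(incrementLaw G ν u) := by
        rw [incrementLaw, lintegral_pi_update _ C hHm]
        refine lintegral_congr fun ζ => lintegral_congr fun w => lintegral_congr fun r => ?_
        congr 2
        · ext v
          by_cases hv : v ∈ W
          · rw [Set.indicator_of_mem hv, Set.indicator_of_mem hv, hind v hv]
          · rw [Set.indicator_of_notMem hv, Set.indicator_of_notMem hv]
        · simp
    _ = ∫⁻ ζ, ∫⁻ r, ∫⁻ w, φ (W.indicator (fun v => r * tailField hG.1 u ζ v), w)
          ∂(ν C s : Measure (↥(C.1 \ {s}) → ℝ≥0)) ∂radialMeasure ∂(incrementLaw G ν u) := by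
        refine lintegral_congr fun ζ => ?_
        refine lintegral_lintegral_swap (f := fun (w : ↥(C.1 \ {s}) → ℝ≥0) (r : ℝ≥0) =>
          φ (W.indicator (fun v => r * tailField hG.1 u ζ v), w)) ?_
        refine (hφm.comp (Measurable.prodMk ?_ measurable_fst)).aemeasurable
        exact hAm.comp (measurable_const.prodMk measurable_snd)
    _ = _ := by
        simp_rw [hsec]
        rw [lintegral_map hRm hWm]
        exact (lintegral_tailLaw _ _ _ (hRm.comp hWm)).symm

/-- This is the counterpart, before the limit, of `IsBlockGraph.tailLaw_map_union`, with the Markov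
property at `s` in place of independence of the increments. -/
lemma scaledLaw_map_union {Ω : Type*} [MeasurableSpace Ω] {P : Measure Ω} [IsProbabilityMeasure P]
    {X : Ω → V → ℝ≥0} (hX : Measurable X) (hMarkov : IsMarkovRandomField G P X) {W C : Set V}
    {s : V} (hsW : s ∈ W) (hdisj : Disjoint W (C \ {s})) (hsep : IsSeparatorOf G W C {s})
    {κ : Kernel ℝ≥0 (↥(C \ {s}) → ℝ≥0)} [IsMarkovKernel κ]
    (hκ : HasCondDistrib (fun ω => subvec (C \ {s}) (X ω)) (fun ω => X ω s) κ P)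
    {O : Set (V → ℝ≥0)} (hO : MeasurableSet O) {t : ℝ≥0} (ht : 0 < t) :
    (scaledLaw P X t).map (fun x => (W ∪ C).indicator x) O =
      ∫⁻ x, κ (t * x s) {y | glue (C \ {s}) x (fun v => y v / t) ∈ O}
        ∂((scaledLaw P X t).map fun x => W.indicator x) := by
  have hWm := measurable_indicator_pi W
  have hUm := measurable_indicator_pi (W ∪ C)
  set T : Set ((V → ℝ≥0) × (↥(C \ {s}) → ℝ≥0)) :=
    {p | glue (C \ {s}) (fun v => p.1 v / t) (fun v => p.2 v / t) ∈ O} with hTdef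
  have hT : MeasurableSet T := by
    have : Measurable fun p : (V → ℝ≥0) × (↥(C \ {s}) → ℝ≥0) =>
        glue (C \ {s}) (fun v => p.1 v / t) (fun v => p.2 v / t) :=
      Measurable.glue (measurable_pi_lambda _ fun v => by fun_prop)
        (measurable_pi_lambda _ fun v => by fun_prop)
    exact this hO
  have hins : insert s (W \ {s}) = W := by
    rw [Set.insert_sdiff_singleton, Set.insert_eq_of_mem hsW]
  have key := hMarkov.measure_eq_lintegral hX (A := W \ {s}) (hdisj.mono_left Set.sdiff_subset)
    (by simp) (by simp) (fun a ha b hb p => hsep a ha.1 b hb.1 p) hκ hT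
  rw [hins] at key
  have hdiv : ∀ x : V → ℝ≥0, (fun v => W.indicator x v / t) = W.indicator fun v => x v / t := by
    intro x
    ext v
    by_cases hv : v ∈ W <;> simp [hv]
  have hleft : {ω | (W.indicator (X ω), subvec (C \ {s}) (X ω)) ∈ T} =
      {ω | (fun v => X ω v / t) ∈ (fun x : V → ℝ≥0 => (W ∪ C).indicator x) ⁻¹' O} := by
    ext ω
    simp only [hTdef, Set.mem_ofPred_eq, Set.mem_preimage, hdiv, indicator_union_eq_glue hsW]
    rfl
  have hm : Measurable fun x : V → ℝ≥0 =>
      κ (t * x s) {y | glue (C \ {s}) x (fun v => y v / t) ∈ O} := by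
    have hms : MeasurableSet {p : (V → ℝ≥0) × (↥(C \ {s}) → ℝ≥0) |
        glue (C \ {s}) p.1 (fun v => p.2 v / t) ∈ O} := by
      have : Measurable fun p : (V → ℝ≥0) × (↥(C \ {s}) → ℝ≥0) =>
          glue (C \ {s}) p.1 (fun v => p.2 v / t) :=
        measurable_fst.glue (measurable_pi_lambda _ fun v => by fun_prop)
      exact this hO
    have hg : Measurable fun x : V → ℝ≥0 => t * x s := by fun_prop
    exact Kernel.measurable_kernel_prodMk_left (κ := κ.comap _ hg) hms
  rw [Measure.map_apply hUm hO, scaledLaw_apply hX t (hUm hO), ← hleft, key, lintegral_map hm hWm,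
    scaledLaw, lintegral_smul_measure, lintegral_map (show Measurable fun x : V → ℝ≥0 =>
      κ (t * W.indicator x s) {y | glue (C \ {s}) (W.indicator x) (fun v => y v / t) ∈ O} from
      hm.comp hWm) (measurable_div_const hX t)]
  rw [ENNReal.smul_def, smul_eq_mul]
  congr 1
  refine lintegral_congr fun ω => ?_
  rw [Set.indicator_of_mem hsW, mul_div_cancel₀ _ ht.ne']
  congr 1
  ext y
  simp only [hTdef, Set.mem_ofPred_eq, hdiv]

lemma IsBlockGraph.tailField_update (hG : IsBlockGraph G) {u : V} [DecidableEq (MaxClique G)]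
    {C : MaxClique G} {D : Finset (MaxClique G)} (hCD : C ∉ D)
    {K : MaxClique G} (hK : K ∈ D) {v : V} (hv : v ∈ K.1)
    (ζ : IncrementSpace G u) (w : ↥(C.1 \ {sepNode G u C}) → ℝ≥0)
    (h : tailField hG.1 u (Function.update ζ C w) (sepNode G u K) =
      tailField hG.1 u ζ (sepNode G u K)) :
    tailField hG.1 u (Function.update ζ C w) v = tailField hG.1 u ζ v := by
  by_cases hvs : v = sepNode G u K
  · rw [hvs, h]
  · have hKC : K ≠ C := by rintro rfl; exact hCD hK
    rw [hG.tailField_eq_mul ⟨hv, hvs⟩, hG.tailField_eq_mul ⟨hv, hvs⟩, h,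
      Function.update_of_ne hKC]

theorem IsBlockGraph.tailLaw_le_liminf (hG : IsBlockGraph G) {Ω : Type*} [MeasurableSpace Ω]
    {P : Measure Ω} [IsProbabilityMeasure P]
    {X : Ω → V → ℝ≥0} (hX : Measurable X) (hMarkov : IsMarkovRandomField G P X)
    {κ : (C : MaxClique G) → (s : V) → Kernel ℝ≥0 (↥(C.1 \ {s}) → ℝ≥0)}
    [∀ C s, IsMarkovKernel (κ C s)] (hκ : AreCliqueCondLaws G P X κ)
    {ν : (C : MaxClique G) → (s : V) → ProbabilityMeasure (↥(C.1 \ {s}) → ℝ≥0)}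
    (hν : CliqueLimits G κ ν) (hzero : NoReturnFromZero hG.1 κ ν) {u : V}
    (htail : Tendsto (fun t : ℝ≥0 => (t : ℝ≥0∞) * P {ω | t < X ω u}) atTop (𝓝 1))
    {O : Set (V → ℝ≥0)} (hO : IsOpen O) :
    tailLaw hG.1 ν u O ≤ liminf (fun t => scaledLaw P X t O) atTop := by
  classical
  -- The induction runs over families of cliques closed under passing to cliques with nearer
  -- separators. The second conclusion, that the field on reached nodes does not involve increments
  -- outside `D`, is the independence used when the next clique is added.
  have main : ∀ D : Finset (MaxClique G),
      (∀ C ∈ D, ∀ K, G.dist u (sepNode G u K) < G.dist u (sepNode G u C) → K ∈ D) →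
      (∀ O, IsOpen O → (tailLaw hG.1 ν u).map (fun x => (reached G u D).indicator x) O ≤
        liminf (fun t => (scaledLaw P X t).map (fun x => (reached G u D).indicator x) O) atTop) ∧
      ∀ C ∉ D, ∀ v ∈ reached G u D, ∀ (ζ : IncrementSpace G u)
        (w : ↥(C.1 \ {sepNode G u C}) → ℝ≥0),
        tailField hG.1 u (Function.update ζ C w) v = tailField hG.1 u ζ v := by
    intro D
    -- Removing a clique at maximal distance keeps the family closed and leaves the separator of the
    -- removed clique among the reached nodes.
    induction D using Finset.induction_on_max_value (fun C => G.dist u (sepNode G u C)) with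
    | empty =>
      intro _
      have hr : reached G u ∅ = {u} := by simp [reached]
      rw [hr]
      refine ⟨fun O hO => hG.tailLaw_singleton_le_liminf ν hX htail hO, ?_⟩
      rintro C _ v rfl ζ w
      rw [hG.tailField_self, hG.tailField_self]
    | insert C D hCD hmax ih =>
      intro hlow
      have hlowD : ∀ K, G.dist u (sepNode G u K) < G.dist u (sepNode G u C) → K ∈ D := by
        intro K hK
        refine (Finset.mem_insert.1 (hlow C (Finset.mem_insert_self _ _) K hK)).resolve_left ?_
        rintro rfl
        exact lt_irrefl _ hK
      have hlowD' : ∀ K ∈ D, ∀ L,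
          G.dist u (sepNode G u L) < G.dist u (sepNode G u K) → L ∈ D :=
        fun K hK L hL => hlowD L (hL.trans_le (hmax K hK))
      obtain ⟨ih1, ih2⟩ := ih hlowD'
      have hsW := hG.sepNode_mem_reached hlowD
      refine ⟨fun O hO => ?_, ?_⟩
      · rw [reached_insert, hG.tailLaw_map_union ν hsW (ih2 C hCD) hO.measurableSet]
        have hfatou := lintegral_le_liminf_of_le_liminf_prod (l := atTop)
          (F := fun (t : ℝ≥0) (x : V → ℝ≥0) => κ C (sepNode G u C) (t * x (sepNode G u C))
            {y | glue (C.1 \ {sepNode G u C}) x (fun v => y v / t) ∈ O})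
          ih1 (hG.ae_le_liminf hν hzero hsW hO)
        refine hfatou.trans (liminf_le_liminf ?_)
        filter_upwards [eventually_gt_atTop 0] with t ht
        exact (scaledLaw_map_union hX hMarkov hsW (hG.disjoint_reached hCD hmax)
          (hG.isSeparatorOf_reached hCD hmax) (hκ C _ (hG.sepNode_spec u C).1)
          hO.measurableSet ht).ge
      · intro K hK v hv ζ w
        rw [Finset.mem_insert, not_or] at hK
        rw [reached_insert] at hv
        rcases hv with hv | hv
        · exact ih2 K hK.2 v hv ζ w
        · refine hG.tailField_update (C := K) (D := insert C D) ?_ (Finset.mem_insert_self _ _) hv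
            ζ w (ih2 K hK.2 _ hsW ζ w)
          rw [Finset.mem_insert, not_or]
          exact hK
  have h := (main Finset.univ fun _ _ _ _ => Finset.mem_univ _).1 O hO
  rw [reached_univ] at h
  simpa using h

end Induction

/-! ### From lower bounds and convergence of mass to convergence of integrals. -/

section VagueConvergence

/-- When the two lower bounds add up to the finite limit of the sum, neither term can exceed its
bound in the limit. -/
lemma ENNReal.tendsto_of_le_liminf_of_tendsto_add {ι : Type*} {l : Filter ι} {f g : ι → ℝ≥0∞}
    {a b : ℝ≥0∞} (hab : a + b ≠ ∞) (h : Tendsto (fun i => f i + g i) l (𝓝 (a + b)))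
    (hf : a ≤ liminf f l) (hg : b ≤ liminf g l) : Tendsto f l (𝓝 a) := by
  refine tendsto_order.2 ⟨fun c hc => eventually_lt_of_lt_liminf (hc.trans_le hf), fun c hc => ?_⟩
  obtain ⟨c', hac', hc'⟩ := exists_between hc
  have ha : a ≠ ∞ := hac'.ne_top
  have hb : b ≠ ∞ := fun h => hab (by simp [h])
  set ε := c' - a with hε
  have hε0 : ε ≠ 0 := (tsub_pos_of_lt hac').ne'
  have hεt : ε ≠ ∞ := (tsub_le_self.trans_lt (lt_top_of_lt hc')).ne
  have h1 : ∀ᶠ i in l, f i + g i < a + b + ε / 2 := by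
    refine (tendsto_order.1 h).2 _ (ENNReal.lt_add_right hab ?_)
    simpa using hε0
  have h2 : ∀ᶠ i in l, b - ε / 2 ≤ g i := by
    rcases eq_or_ne b 0 with hb0 | hb0
    · simp [hb0]
    · have : b - ε / 2 < b := ENNReal.sub_lt_self hb hb0 (by simpa using hε0)
      exact (eventually_lt_of_lt_liminf (this.trans_le hg)).mono fun _ => le_of_lt
  filter_upwards [h1, h2] with i hi1 hi2
  refine lt_of_lt_of_le ?_ hc'.le
  have h3 : f i + (b - ε / 2) < c' + (b - ε / 2) := by
    calc f i + (b - ε / 2) ≤ f i + g i := by gcongr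
      _ < a + b + ε / 2 := hi1
      _ ≤ a + (b - ε / 2 + ε / 2) + ε / 2 := by gcongr; exact le_tsub_add
      _ = a + (ε / 2 + ε / 2) + (b - ε / 2) := by ring
      _ = c' + (b - ε / 2) := by
        rw [ENNReal.add_halves, hε, add_tsub_cancel_of_le hac'.le]
  exact lt_of_add_lt_add_right h3

lemma isOpen_setOf_lt_apply {V : Type*} (u : V) (a : ℝ≥0) : IsOpen {x : V → ℝ≥0 | a < x u} :=
  isOpen_lt continuous_const (continuous_apply u)

variable {V : Type*} [Finite V] {M : Measure (V → ℝ≥0)} {Mt : ℝ≥0 → Measure (V → ℝ≥0)} {u : V}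

/-- The lower bound applies both to `f` and to `b - f` cut off to `{x_u > a}`; they add up to `b` on
that set, whose mass converges. -/
lemma tendsto_lintegral_of_forall_isOpen
    (hM : ∀ O, IsOpen O → M O ≤ liminf (fun t => Mt t O) atTop) {a : ℝ≥0}
    (ht : Tendsto (fun t => Mt t {x | a < x u}) atTop (𝓝 (M {x | a < x u})))
    (hMa : M {x | a < x u} ≠ ∞)
    {f : (V → ℝ≥0) → ℝ≥0} (hf : Continuous f) {b : ℝ≥0} (hb : ∀ x, f x ≤ b)
    (hfa : ∀ x, ¬ a < x u → f x = 0) :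
    Tendsto (fun t => ∫⁻ x, f x ∂(Mt t)) atTop (𝓝 (∫⁻ x, f x ∂M)) := by
  classical
  set U : Set (V → ℝ≥0) := {x | a < x u} with hU
  have hUo : IsOpen U := isOpen_setOf_lt_apply u a
  set g : (V → ℝ≥0) → ℝ≥0∞ := U.indicator fun x => ((b - f x : ℝ≥0) : ℝ≥0∞) with hg
  have hglsc : LowerSemicontinuous g := by
    intro x r hr
    by_cases hx : x ∈ U
    · rw [hg, Set.indicator_of_mem hx] at hr
      have hc : Continuous fun x => ((b - f x : ℝ≥0) : ℝ≥0∞) :=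
        ENNReal.continuous_coe.comp (continuous_const.sub hf)
      filter_upwards [hUo.mem_nhds hx, hc.tendsto x (Ioi_mem_nhds hr)] with y hy hy'
      rw [hg, Set.indicator_of_mem hy]
      exact hy'
    · rw [hg, Set.indicator_of_notMem hx] at hr
      exact absurd hr not_lt_zero
  have hsum : ∀ x, (f x : ℝ≥0∞) + g x = U.indicator (fun _ => (b : ℝ≥0∞)) x := by
    intro x
    by_cases hx : x ∈ U
    · rw [hg, Set.indicator_of_mem hx, Set.indicator_of_mem hx, ← ENNReal.coe_add,
        add_tsub_cancel_of_le (hb x)]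
    · rw [hg, Set.indicator_of_notMem hx, Set.indicator_of_notMem hx, hfa x hx]
      simp
  have hint : ∀ m : Measure (V → ℝ≥0), ∫⁻ x, f x ∂m + ∫⁻ x, g x ∂m = b * m U := by
    intro m
    rw [← lintegral_add_left (by fun_prop)]
    simp_rw [hsum]
    rw [lintegral_indicator_const hUo.measurableSet]
  refine ENNReal.tendsto_of_le_liminf_of_tendsto_add (b := ∫⁻ x, g x ∂M)
    (g := fun t => ∫⁻ x, g x ∂(Mt t)) ?_ ?_ ?_ ?_
  · rw [hint]
    exact ENNReal.mul_ne_top (by simp) hMa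
  · simp_rw [hint]
    exact ENNReal.Tendsto.const_mul ht (Or.inr (by simp))
  · exact lintegral_le_liminf_of_lowerSemicontinuous hM
      (ENNReal.continuous_coe.comp hf).lowerSemicontinuous
  · exact lintegral_le_liminf_of_lowerSemicontinuous hM hglsc

lemma integrable_of_bound_of_eq_zero {m : Measure (V → ℝ≥0)} {S : Set (V → ℝ≥0)}
    (hm : m S ≠ ∞) {f : (V → ℝ≥0) → ℝ} (hf : Continuous f) {b : ℝ}
    (hb : ∀ x, |f x| ≤ b) (hfS : ∀ x ∉ S, f x = 0) : Integrable f m := by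
  have h1 : IntegrableOn f S m :=
    Measure.integrableOn_of_bounded hm hf.aestronglyMeasurable (M := b)
      (Eventually.of_forall hb)
  exact (integrableOn_iff_integrable_of_support_subset fun x hx => by
    by_contra h; exact hx (hfS x h)).1 h1

lemma tendsto_integral_of_forall_isOpen
    (hM : ∀ O, IsOpen O → M O ≤ liminf (fun t => Mt t O) atTop) [∀ t, IsFiniteMeasure (Mt t)]
    {a : ℝ≥0}
    (ht : Tendsto (fun t => Mt t {x | a < x u}) atTop (𝓝 (M {x | a < x u})))
    (hMa : M {x | a < x u} ≠ ∞)
    {f : (V → ℝ≥0) → ℝ} (hf : Continuous f) {b : ℝ} (hb : ∀ x, |f x| ≤ b)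
    (hfa : ∀ x, ¬ a < x u → f x = 0) :
    Tendsto (fun t => ∫ x, f x ∂(Mt t)) atTop (𝓝 (∫ x, f x ∂M)) := by
  have hi : ∀ m : Measure (V → ℝ≥0), m {x | a < x u} ≠ ∞ → Integrable f m := fun m hm =>
    integrable_of_bound_of_eq_zero hm hf hb hfa
  have hfin : ∀ (f : (V → ℝ≥0) → ℝ), Integrable f M → ∫⁻ x, ENNReal.ofReal (f x) ∂M ≠ ∞ := by
    intro f hf
    refine ((lintegral_mono fun x => ?_).trans_lt hf.2).ne
    rw [← ofReal_norm]
    exact ENNReal.ofReal_le_ofReal (le_abs_self _)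
  simp_rw [fun t => integral_eq_lintegral_pos_part_sub_lintegral_neg_part
    (hi (Mt t) (measure_ne_top _ _)), integral_eq_lintegral_pos_part_sub_lintegral_neg_part
    (hi M hMa)]
  have hpos : ∀ f : (V → ℝ≥0) → ℝ, Continuous f → (∀ x, |f x| ≤ b) →
      (∀ x, ¬ a < x u → f x = 0) →
      Tendsto (fun t => ∫⁻ x, ENNReal.ofReal (f x) ∂(Mt t)) atTop
        (𝓝 (∫⁻ x, ENNReal.ofReal (f x) ∂M)) := by
    intro f hf hb hfa
    refine tendsto_lintegral_of_forall_isOpen hM ht hMa (f := fun x => (f x).toNNReal)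
      (b := b.toNNReal) (continuous_real_toNNReal.comp hf) (fun x => ?_) fun x hx => ?_
    · exact Real.toNNReal_le_toNNReal ((le_abs_self _).trans (hb x))
    · simp [hfa x hx]
  refine Tendsto.sub ?_ ?_
  · exact (ENNReal.tendsto_toReal (hfin f (hi M hMa))).comp (hpos f hf hb hfa)
  · exact (ENNReal.tendsto_toReal (hfin (fun x => -f x) (hi M hMa).neg)).comp
      (hpos (fun x => -f x) hf.neg (by simpa using hb) fun x hx => by simp [hfa x hx])

/-- On `{x_u > a}` the measure `M` is the actual limit while `M'` is only a lower bound for it. The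
comparison passes from Urysohn functions to open sets, by outer regularity to arbitrary sets, and
then lets `a` decrease to `0`. -/
lemma measure_le_of_forall_isOpen {M' : Measure (V → ℝ≥0)}
    (hM : ∀ O, IsOpen O → M O ≤ liminf (fun t => Mt t O) atTop)
    (hM' : ∀ O, IsOpen O → M' O ≤ liminf (fun t => Mt t O) atTop)
    (ht : ∀ a : ℝ≥0, 0 < a →
      Tendsto (fun t => Mt t {x | a < x u}) atTop (𝓝 (M {x | a < x u})))
    (hMa : ∀ a : ℝ≥0, 0 < a → M {x | a < x u} ≠ ∞) {S : Set (V → ℝ≥0)}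
    (hS : S ⊆ {x | 0 < x u}) : M' S ≤ M S := by
  have := Fintype.ofFinite V
  have hopen : ∀ a : ℝ≥0, 0 < a → ∀ O, IsOpen O → O ⊆ {x | a < x u} → M' O ≤ M O := by
    intro a ha O hO hOa
    obtain ⟨F, hF, hFO, hFU, hFm⟩ := hO.exists_iUnion_isClosed
    have hsup : M' O = ⨆ n, M' (F n) := by rw [← hFU, hFm.measure_iUnion]
    rw [hsup]
    refine iSup_le fun n => ?_
    obtain ⟨h, h0, h1, h01⟩ := exists_continuous_zero_one_of_isClosed hO.isClosed_compl (hF n)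
      (Set.disjoint_left.2 fun x hx hx' => hx (hFO n hx'))
    have hlim := tendsto_lintegral_of_forall_isOpen hM (ht a ha) (hMa a ha)
      (f := fun x => (h x).toNNReal) (b := 1) (continuous_real_toNNReal.comp h.continuous)
      (fun x => by simpa using (h01 x).2) (fun x hx => by
        have : h x = 0 := h0 (fun hxO => hx (hOa hxO))
        simp [this])
    calc M' (F n) = ∫⁻ x, (F n).indicator 1 x ∂M' :=
          (lintegral_indicator_one (hF n).measurableSet).symm
      _ ≤ ∫⁻ x, ((h x).toNNReal : ℝ≥0∞) ∂M' := by
          refine lintegral_mono fun x => ?_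
          by_cases hx : x ∈ F n
          · have : h x = 1 := h1 hx
            rw [Set.indicator_of_mem hx, this]
            simp
          · rw [Set.indicator_of_notMem hx]
            exact zero_le
      _ ≤ liminf (fun t => ∫⁻ x, ((h x).toNNReal : ℝ≥0∞) ∂(Mt t)) atTop :=
          lintegral_le_liminf_of_lowerSemicontinuous hM' (ENNReal.continuous_coe.comp
            (continuous_real_toNNReal.comp h.continuous)).lowerSemicontinuous
      _ = ∫⁻ x, ((h x).toNNReal : ℝ≥0∞) ∂M := hlim.liminf_eq
      _ ≤ ∫⁻ x, O.indicator 1 x ∂M := by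
          refine lintegral_mono fun x => ?_
          by_cases hx : x ∈ O
          · rw [Set.indicator_of_mem hx]
            have : (h x).toNNReal ≤ 1 := by simpa using (h01 x).2
            rw [Pi.one_apply]
            exact ENNReal.coe_le_one_iff.2 this
          · have : h x = 0 := h0 hx
            simp [this]
      _ = M O := lintegral_indicator_one hO.measurableSet
  have hset : ∀ a : ℝ≥0, 0 < a → M' (S ∩ {x | a < x u}) ≤ M S := by
    intro a ha
    have hUo := isOpen_setOf_lt_apply (V := V) u a
    have : IsFiniteMeasure (M.restrict {x | a < x u}) :=
      ⟨by rw [Measure.restrict_apply_univ]; exact (hMa a ha).lt_top⟩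
    have h1 := Set.measure_eq_iInf_isOpen (S ∩ {x | a < x u}) (M.restrict {x | a < x u})
    have h2 : M.restrict {x | a < x u} (S ∩ {x | a < x u}) ≤ M S :=
      (Measure.restrict_apply_le _ _).trans (measure_mono Set.inter_subset_left)
    refine le_trans ?_ h2
    rw [h1]
    refine le_iInf₂ fun O hSO => le_iInf fun hO => ?_
    rw [Measure.restrict_apply hO.measurableSet]
    exact (measure_mono (Set.subset_inter hSO Set.inter_subset_right)).trans
      (hopen a ha _ (hO.inter hUo) Set.inter_subset_right)
  obtain ⟨a, ha, ha0, hlim⟩ := exists_seq_strictAnti_tendsto (0 : ℝ≥0)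
  have hun : S = ⋃ n, S ∩ {x | a n < x u} := by
    refine Set.Subset.antisymm (fun x hx => ?_) (Set.iUnion_subset fun n => Set.inter_subset_left)
    obtain ⟨n, hn⟩ := ((tendsto_order.1 hlim).2 _ (hS hx)).exists
    exact Set.mem_iUnion.2 ⟨n, hx, hn⟩
  have hmono : Monotone fun n => S ∩ {x : V → ℝ≥0 | a n < x u} := fun m n hmn x hx =>
    ⟨hx.1, (ha.antitone hmn).trans_lt hx.2⟩
  calc M' S = M' (⋃ n, S ∩ {x | a n < x u}) := by rw [← hun]
    _ = ⨆ n, M' (S ∩ {x | a n < x u}) := hmono.measure_iUnion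
    _ ≤ M S := iSup_le fun n => hset _ (ha0 n)

end VagueConvergence

/-! ### Gluing the laws for different roots into one measure. -/

section ExponentMeasure

variable {V : Type*} [Fintype V]

/-- The number of positive coordinates. -/
noncomputable def positiveCount (x : V → ℝ≥0) : ℝ≥0∞ := ∑ v, {x : V → ℝ≥0 | 0 < x v}.indicator 1 x

/-- The measure whose restriction to `{x | 0 < x u}` is `M u` for every `u`, provided that the `M u`
are consistent. -/
noncomputable def exponentMeasure (M : V → Measure (V → ℝ≥0)) : Measure (V → ℝ≥0) :=
  ∑ v, (M v).withDensity fun x => (positiveCount x)⁻¹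

lemma measurableSet_lt_apply (u : V) (a : ℝ≥0) : MeasurableSet {x : V → ℝ≥0 | a < x u} :=
  (isOpen_setOf_lt_apply u a).measurableSet

lemma measurable_positiveCount : Measurable (positiveCount : (V → ℝ≥0) → ℝ≥0∞) :=
  Finset.measurable_fun_sum _ fun v _ => measurable_one.indicator (measurableSet_lt_apply v 0)

lemma positiveCount_ne_top (x : V → ℝ≥0) : positiveCount x ≠ ∞ := by
  refine (ENNReal.sum_lt_top.2 fun v _ => ?_).ne
  refine lt_of_le_of_lt (Set.indicator_le_self _ _ _) ?_
  simp

lemma positiveCount_ne_zero {x : V → ℝ≥0} {u : V} (hx : 0 < x u) : positiveCount x ≠ 0 := by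
  intro h
  have := (Finset.sum_eq_zero_iff.1 h) u (Finset.mem_univ u)
  rw [Set.indicator_of_mem (by exact hx)] at this
  exact one_ne_zero this

/-- On `{x_u > 0}` consistency replaces each `M v` by `M u` cut off to `{x_v > 0}`. A point is then
counted once for every positive coordinate, and the density cancels this multiplicity. -/
lemma exponentMeasure_restrict {M : V → Measure (V → ℝ≥0)}
    (hcons : ∀ u v, (M v).restrict {x | 0 < x u} = (M u).restrict {x | 0 < x v})
    (hpos : ∀ u, ∀ᵐ x ∂(M u), 0 < x u) (u : V) :
    (exponentMeasure M).restrict {x | 0 < x u} = M u := by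
  have hU := fun v : V => measurableSet_lt_apply v 0
  have hNm : Measurable fun x : V → ℝ≥0 => (positiveCount x)⁻¹ := measurable_positiveCount.inv
  ext S hS
  rw [Measure.restrict_apply hS, exponentMeasure, Measure.finsetSum_apply]
  have h1 : ∀ v, (M v).withDensity (fun x => (positiveCount x)⁻¹) (S ∩ {x | 0 < x u}) =
      ∫⁻ x in S, {x : V → ℝ≥0 | 0 < x v}.indicator (fun x => (positiveCount x)⁻¹) x ∂(M u) := by
    intro v
    rw [withDensity_apply _ (hS.inter (hU u)), ← Measure.restrict_restrict hS, hcons u v,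
      Measure.restrict_restrict hS, lintegral_indicator (hU v), Measure.restrict_restrict (hU v),
      Set.inter_comm]
  simp_rw [h1]
  rw [← lintegral_finsetSum _ fun v _ => hNm.indicator (hU v)]
  have h2 : ∀ᵐ x ∂((M u).restrict S), ∑ v : V, {x : V → ℝ≥0 | 0 < x v}.indicator
      (fun x => (positiveCount x)⁻¹) x = 1 := by
    refine ae_restrict_of_ae ?_
    filter_upwards [hpos u] with x hx
    rw [← ENNReal.mul_inv_cancel (positiveCount_ne_zero hx) (positiveCount_ne_top x)]
    nth_rewrite 1 [positiveCount]
    rw [Finset.sum_mul]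
    refine Finset.sum_congr rfl fun v _ => ?_
    by_cases hv : 0 < x v
    · rw [Set.indicator_of_mem (by exact hv), Set.indicator_of_mem (by exact hv), Pi.one_apply,
        one_mul]
    · rw [Set.indicator_of_notMem (by exact hv), Set.indicator_of_notMem (by exact hv), zero_mul]
  rw [lintegral_congr_ae h2]
  simp

lemma measure_setOf_lt_of_restrict {m : V → Measure (V → ℝ≥0)} {μ : Measure (V → ℝ≥0)}
    (hμ : ∀ u, μ.restrict {x | 0 < x u} = m u) (u : V) (a : ℝ≥0) :
    μ {x | a < x u} = m u {x | a < x u} := by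
  rw [← hμ u, Measure.restrict_apply (measurableSet_lt_apply u a)]
  congr 1
  exact (Set.inter_eq_left.2 fun x hx => (zero_le (a := a)).trans_lt hx).symm

lemma tendsto_integral_of_eq_zero_near_zero {M : V → Measure (V → ℝ≥0)}
    {Mt : ℝ≥0 → Measure (V → ℝ≥0)} [∀ t, IsFiniteMeasure (Mt t)] {μ : Measure (V → ℝ≥0)}
    (hM : ∀ u, ∀ O, IsOpen O → M u O ≤ liminf (fun t => Mt t O) atTop)
    (ht : ∀ u, ∀ a : ℝ≥0, 0 < a →
      Tendsto (fun t => Mt t {x | a < x u}) atTop (𝓝 (M u {x | a < x u})))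
    (hMa : ∀ u, ∀ a : ℝ≥0, 0 < a → M u {x | a < x u} ≠ ∞)
    (hμ : ∀ u, μ.restrict {x | 0 < x u} = M u)
    {f : (V → ℝ≥0) → ℝ} (hf : Continuous f) {b : ℝ} (hb : ∀ x, |f x| ≤ b) {ε : ℝ≥0} (hε : 0 < ε)
    (hfε : ∀ x : V → ℝ≥0, (∀ v, x v < ε) → f x = 0) :
    Tendsto (fun t => ∫ x, f x ∂(Mt t)) atTop (𝓝 (∫ x, f x ∂μ)) := by
  -- The weights `(x_u - δ) / ∑ (x_v - δ)`, with truncated subtraction, form a partition of unity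
  -- wherever some coordinate is at least `ε`, since the sum is then at least `δ`. Each vanishes
  -- unless `x_u > δ`. The maximum with `δ` in `D` only keeps the denominator positive elsewhere.
  set δ := ε / 2 with hδ
  have hδ0 : 0 < δ := by positivity
  set D : (V → ℝ≥0) → ℝ≥0 := fun x => max (∑ v, (x v - δ)) δ with hD
  have hDpos : ∀ x, D x ≠ 0 := fun x => (hδ0.trans_le (le_max_right _ _)).ne'
  set w : V → (V → ℝ≥0) → ℝ≥0 := fun u x => (x u - δ) / D x with hw
  have hwc : ∀ u, Continuous (w u) := fun u =>
    Continuous.div (by fun_prop) (by fun_prop) hDpos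
  have hw1 : ∀ u x, w u x ≤ 1 := fun u x => by
    refine div_le_one_of_le₀ ?_ zero_le
    exact (Finset.single_le_sum (f := fun v => x v - δ) (fun _ _ => zero_le)
      (Finset.mem_univ u)).trans (le_max_left _ _)
  have hsum : ∀ x, f x = ∑ u, f x * (w u x : ℝ) := by
    intro x
    by_cases hx : ∀ v, x v < ε
    · simp [hfε x hx]
    · push Not at hx
      obtain ⟨v, hv⟩ := hx
      have h1 : δ ≤ ∑ v, (x v - δ) := by
        have h2 : δ ≤ x v - δ := by
          rw [le_tsub_iff_right ((half_le_self (zero_le (a := ε))).trans hv)]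
          rw [hδ, add_halves]
          exact hv
        exact h2.trans (Finset.single_le_sum (f := fun v => x v - δ) (fun _ _ => zero_le)
          (Finset.mem_univ v))
      have h2 : ∑ u, w u x = 1 := by
        simp only [hw]
        rw [← Finset.sum_div, hD]
        simp only [max_eq_left h1]
        exact div_self (hδ0.trans_le h1).ne'
      rw [← Finset.mul_sum]
      have h3 : ∑ u, (w u x : ℝ) = 1 := by exact_mod_cast congrArg NNReal.toReal h2
      rw [h3, mul_one]
  set g : V → (V → ℝ≥0) → ℝ := fun u x => f x * (w u x : ℝ) with hg
  have hgc : ∀ u, Continuous (g u) := fun u =>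
    hf.mul (NNReal.continuous_coe.comp (hwc u))
  have hgb : ∀ u x, |g u x| ≤ b := by
    intro u x
    rw [hg]
    simp only [abs_mul, NNReal.abs_eq]
    exact (mul_le_of_le_one_right (abs_nonneg _) (by exact_mod_cast hw1 u x)).trans (hb x)
  have hg0 : ∀ u x, ¬ δ < x u → g u x = 0 := by
    intro u x hx
    have : x u - δ = 0 := tsub_eq_zero_of_le (not_lt.1 hx)
    simp [hg, hw, this]
  have hint : ∀ (m : Measure (V → ℝ≥0)) u, m {x | δ < x u} ≠ ∞ → Integrable (g u) m :=
    fun m u hm => integrable_of_bound_of_eq_zero hm (hgc u) (hgb u) (hg0 u)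
  have hμfin : ∀ u, μ {x | δ < x u} ≠ ∞ := fun u => by
    rw [measure_setOf_lt_of_restrict hμ]; exact hMa u δ hδ0
  have heq : ∀ u, ∫ x, g u x ∂(M u) = ∫ x, g u x ∂μ := by
    intro u
    rw [← hμ u]
    refine setIntegral_eq_integral_of_forall_compl_eq_zero fun x hx => hg0 u x fun h => ?_
    exact hx ((zero_le (a := δ)).trans_lt h)
  have hsplit : ∀ m : Measure (V → ℝ≥0), ∫ x, f x ∂m = ∫ x, ∑ u, g u x ∂m := fun m =>
    integral_congr_ae (Eventually.of_forall hsum)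
  simp_rw [hsplit]
  rw [integral_finsetSum _ fun u _ => hint μ u (hμfin u)]
  simp_rw [fun t => integral_finsetSum (μ := Mt t) Finset.univ
    fun u _ => hint (Mt t) u (measure_ne_top _ _)]
  refine tendsto_finsetSum _ fun u _ => ?_
  rw [← heq u]
  exact tendsto_integral_of_forall_isOpen (hM u) (ht u δ hδ0) (hMa u δ hδ0) (hgc u) (hgb u) (hg0 u)

end ExponentMeasure

/-! ### Transfer to the punctured orthant, and uniqueness. -/

section PuncturedOrthants

lemma MZero.tendsto_iff {V ι : Type*} {l : Filter ι} {μs : ι → MZero V} {μ : MZero V} :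
    Tendsto μs l (𝓝 μ) ↔ ∀ f : PuncturedOrthant V →ᵇ ℝ,
      (∃ ε : ℝ≥0, 0 < ε ∧ ∀ x : PuncturedOrthant V, (∀ v, x.1 v < ε) → f x = 0) →
      Tendsto (fun i => ∫ x, f x ∂(μs i).1) l (𝓝 (∫ x, f x ∂μ.1)) := by
  rw [nhds_iInf, tendsto_iInf]
  simp_rw [nhds_induced, tendsto_comap_iff]
  exact ⟨fun h f hf => h ⟨f, hf⟩, fun h f => h f.1 f.2⟩

open Classical in
/-- The extension by zero of a function on the punctured orthant. -/
noncomputable def extendZero {V : Type*} (f : PuncturedOrthant V → ℝ) (x : V → ℝ≥0) : ℝ :=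
  if h : x ≠ 0 then f ⟨x, h⟩ else 0

lemma extendZero_coe {V : Type*} (f : PuncturedOrthant V → ℝ) (y : PuncturedOrthant V) :
    extendZero f y.1 = f y := by
  rw [extendZero, dif_pos y.2]

variable {V : Type*} [Finite V]

lemma measurableSet_ne_zero : MeasurableSet {x : V → ℝ≥0 | x ≠ 0} :=
  (measurableSet_singleton 0).compl

lemma continuous_extendZero {f : PuncturedOrthant V → ℝ} (hf : Continuous f) {ε : ℝ≥0}
    (hε : 0 < ε) (h : ∀ x : PuncturedOrthant V, (∀ v, x.1 v < ε) → f x = 0) :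
    Continuous (extendZero f) := by
  rw [continuous_iff_continuousAt]
  intro x
  by_cases hx : x = 0
  · have h1 : ∀ᶠ y : V → ℝ≥0 in 𝓝 x, ∀ v, y v < ε := by
      refine eventually_all.2 fun v => ?_
      refine (continuous_apply v).tendsto x (Iio_mem_nhds ?_)
      simpa [hx] using hε
    have h2 : ∀ᶠ y in 𝓝 x, extendZero f y = 0 := by
      filter_upwards [h1] with y hy
      by_cases hy0 : y = 0
      · simp [extendZero, hy0]
      · rw [extendZero, dif_pos hy0]
        exact h ⟨y, hy0⟩ hy
    refine ContinuousAt.congr (f := fun _ => (0 : ℝ)) continuousAt_const ?_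
    filter_upwards [h2] with y hy using hy.symm
  · have he : IsOpenEmbedding (Subtype.val : PuncturedOrthant V → V → ℝ≥0) :=
      isOpen_compl_singleton.isOpenEmbedding_subtypeVal
    refine (he.continuousAt_iff (x := ⟨x, hx⟩)).1 ?_
    have : extendZero f ∘ Subtype.val = f := funext (extendZero_coe f)
    rw [this]
    exact hf.continuousAt

/-- The extension vanishes at the origin, so a possible atom of `μ` there does not contribute. -/
lemma integral_comap_val (μ : Measure (V → ℝ≥0)) (f : PuncturedOrthant V → ℝ) :
    ∫ y, f y ∂(μ.comap Subtype.val) = ∫ x, extendZero f x ∂μ := by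
  have h1 : ∫ y : PuncturedOrthant V, extendZero f y.1 ∂(μ.comap Subtype.val) =
      ∫ x in {x : V → ℝ≥0 | x ≠ 0}, extendZero f x ∂μ :=
    integral_subtype_comap measurableSet_ne_zero (extendZero f)
  simp_rw [extendZero_coe] at h1
  rw [h1]
  refine setIntegral_eq_integral_of_forall_compl_eq_zero fun x hx => ?_
  have : x = 0 := by simpa using hx
  simp [extendZero, this]

lemma comap_val_apply (μ : Measure (V → ℝ≥0)) {S : Set (V → ℝ≥0)} (hS0 : (0 : V → ℝ≥0) ∉ S) :
    μ.comap Subtype.val {y : PuncturedOrthant V | y.1 ∈ S} = μ S := by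
  have he : MeasurableEmbedding (Subtype.val : PuncturedOrthant V → V → ℝ≥0) :=
    MeasurableEmbedding.subtype_coe measurableSet_ne_zero
  rw [he.comap_apply]
  congr 1
  ext x
  constructor
  · rintro ⟨y, hy, rfl⟩; exact hy
  · intro hx
    exact ⟨⟨x, fun h => hS0 (h ▸ hx)⟩, hx, rfl⟩

/-- Indicator functions in the defining identity fix the restriction to each `{y_u > 0}`, and these
sets cover the punctured orthant. -/
lemma IsTailFieldMeasure.unique {G : SimpleGraph V} {hG : G.Connected}
    {ν : (C : MaxClique G) → (s : V) → ProbabilityMeasure (↥(C.1 \ {s}) → ℝ≥0)}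
    {μ μ' : Measure (PuncturedOrthant V)} (hμ : IsTailFieldMeasure hG ν μ)
    (hμ' : IsTailFieldMeasure hG ν μ') : μ' = μ := by
  have hU : ∀ u : V, MeasurableSet {y : PuncturedOrthant V | 0 < y.1 u} := fun u =>
    measurableSet_lt measurable_const ((measurable_pi_apply u).comp measurable_subtype_coe)
  have hcover : ⋃ u : V, {y : PuncturedOrthant V | 0 < y.1 u} = Set.univ := by
    refine Set.eq_univ_of_forall fun y => ?_
    obtain ⟨v, hv⟩ := Function.ne_iff.1 y.2
    exact Set.mem_iUnion.2 ⟨v, pos_iff_ne_zero.2 hv⟩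
  rw [Measure.ext_iff_of_iUnion_eq_univ hcover]
  intro u
  ext S hS
  obtain ⟨S', hS', rfl⟩ := hS
  have hind : ∀ m : Measure (PuncturedOrthant V),
      m.restrict {y | 0 < y.1 u} (Subtype.val ⁻¹' S') =
      ∫⁻ y, {y : PuncturedOrthant V | 0 < y.1 u}.indicator
        (fun y => S'.indicator (1 : (V → ℝ≥0) → ℝ≥0∞) y.1) y ∂m := by
    intro m
    rw [lintegral_indicator (hU u), ← lintegral_indicator_one (measurable_subtype_coe hS')]
    rfl
  rw [hind, hind, hμ u _ (measurable_one.indicator hS'), hμ' u _ (measurable_one.indicator hS')]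

lemma isTailFieldMeasure_comap {G : SimpleGraph V} (hG : G.Connected)
    (ν : (C : MaxClique G) → (s : V) → ProbabilityMeasure (↥(C.1 \ {s}) → ℝ≥0))
    {μ : Measure (V → ℝ≥0)} (hμ : ∀ u, μ.restrict {x | 0 < x u} = tailLaw hG ν u) :
    IsTailFieldMeasure hG ν (μ.comap Subtype.val) := by
  intro u f hf
  have hU : MeasurableSet {x : V → ℝ≥0 | 0 < x u} := (isOpen_setOf_lt_apply u 0).measurableSet
  have h1 : ∫⁻ y : PuncturedOrthant V, {y : PuncturedOrthant V | 0 < y.1 u}.indicator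
      (fun y => f y.1) y ∂(μ.comap Subtype.val) =
      ∫⁻ x in {x : V → ℝ≥0 | x ≠ 0}, {x : V → ℝ≥0 | 0 < x u}.indicator f x ∂μ :=
    lintegral_subtype_comap measurableSet_ne_zero ({x : V → ℝ≥0 | 0 < x u}.indicator f)
  have h2 : {x : V → ℝ≥0 | x ≠ 0} ∩ {x : V → ℝ≥0 | 0 < x u} = {x | 0 < x u} := by
    refine Set.inter_eq_right.2 fun x hx h => ?_
    rw [h] at hx
    exact lt_irrefl (0 : ℝ≥0) hx
  rw [h1, ← lintegral_indicator measurableSet_ne_zero, Set.indicator_indicator, h2,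
    lintegral_indicator hU, hμ u, lintegral_tailLaw hG ν u hf]
  refine lintegral_congr fun ζ => ?_
  exact lintegral_radialMeasure (hf.comp (measurable_pi_lambda _ fun v => by fun_prop))

end PuncturedOrthants

/-! ### Exceedance sets as continuity sets of the exponent measure. -/

section Exceedance

variable {V : Type*}

/-- The set of the vectors that exceed `x` in some coordinate. -/
def exceedance (x : V → ℝ≥0) : Set (V → ℝ≥0) := {y | ∃ v, x v < y v}

lemma compl_exceedance (x : V → ℝ≥0) : (exceedance x)ᶜ = {y | ∀ v, y v ≤ x v} := by
  ext y; simp [exceedance]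

lemma tendsto_mul_nhds_one (x : V → ℝ≥0) :
    Tendsto (fun (p : ℝ≥0) v => p * x v) (𝓝 1) (𝓝 x) := by
  have hc : Continuous (fun (p : ℝ≥0) v => p * x v) := continuous_pi fun v => by fun_prop
  simpa using hc.tendsto 1

variable [Fintype V]

lemma measurableSet_exceedance (x : V → ℝ≥0) : MeasurableSet (exceedance x) := by
  have : exceedance x = ⋃ v, {y | x v < y v} := by ext y; simp [exceedance]
  rw [this]
  exact MeasurableSet.iUnion fun v => measurableSet_lt_apply v (x v)

lemma measure_exceedance_le (μ : Measure (V → ℝ≥0)) (x : V → ℝ≥0) :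
    μ (exceedance x) ≤ ∑ v, μ {y | x v < y v} := by
  have : exceedance x = ⋃ v, {y | x v < y v} := by ext y; simp [exceedance]
  rw [this]
  exact measure_iUnion_fintype_le _ _

/-- A continuous function that is `1` on `exceedance y` and `0` outside `exceedance x`, if
`x v < y v` for all `v`. -/
noncomputable def exceedanceRamp (x y z : V → ℝ≥0) : ℝ≥0 :=
  min 1 (∑ v, (z v - x v) / (y v - x v))

lemma continuous_exceedanceRamp (x y : V → ℝ≥0) : Continuous (exceedanceRamp x y) := by
  unfold exceedanceRamp; fun_prop

lemma exceedanceRamp_of_notMem {x y z : V → ℝ≥0} (hz : z ∉ exceedance x) :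
    exceedanceRamp x y z = 0 := by
  simp only [exceedance, Set.mem_ofPred_eq, not_exists, not_lt] at hz
  simp [exceedanceRamp, fun v => tsub_eq_zero_of_le (hz v)]

lemma exceedanceRamp_of_mem {x y z : V → ℝ≥0} (hxy : ∀ v, x v < y v) (hz : z ∈ exceedance y) :
    exceedanceRamp x y z = 1 := by
  obtain ⟨v, hv⟩ := hz
  refine min_eq_left (le_trans ?_ (Finset.single_le_sum
    (f := fun v => (z v - x v) / (y v - x v)) (fun _ _ => zero_le) (Finset.mem_univ v)))
  rw [one_le_div (tsub_pos_of_lt (hxy v))]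
  exact tsub_le_tsub_right hv.le _

lemma exists_pos_forall_le {x : V → ℝ≥0} (hx : ∀ v, 0 < x v) : ∃ ε : ℝ≥0, 0 < ε ∧ ∀ v, ε ≤ x v := by
  -- The summand `1` keeps the constant positive also when there are no nodes.
  refine ⟨(1 + ∑ v, (x v)⁻¹)⁻¹, by positivity, fun v => ?_⟩
  rw [inv_le_comm₀ (by positivity) (hx v)]
  exact (Finset.single_le_sum (f := fun v => (x v)⁻¹) (fun _ _ => zero_le)
    (Finset.mem_univ v)).trans (le_add_of_nonneg_left zero_le)

variable {μ : Measure (V → ℝ≥0)}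

lemma measure_exceedance_ne_top (hμ : ∀ v, ∀ a : ℝ≥0, 0 < a → μ {y | a < y v} = (a : ℝ≥0∞)⁻¹)
    {x : V → ℝ≥0} (hx : ∀ v, 0 < x v) : μ (exceedance x) ≠ ∞ := by
  refine ((measure_exceedance_le μ x).trans_lt (ENNReal.sum_lt_top.2 fun v _ => ?_)).ne
  rw [hμ v _ (hx v)]
  simpa using hx v

/-- Points exceeding `x` but not `y` lie in slabs `x_v < z_v ≤ y_v`, whose masses are known from the
margins. -/
lemma measureReal_exceedance_le
    (hμ : ∀ v, ∀ a : ℝ≥0, 0 < a → μ {y | a < y v} = (a : ℝ≥0∞)⁻¹)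
    {x y : V → ℝ≥0} (hx : ∀ v, 0 < x v) (hy : ∀ v, 0 < y v) :
    μ.real (exceedance x) ≤ μ.real (exceedance y) + ∑ v, |(x v : ℝ)⁻¹ - (y v : ℝ)⁻¹| := by
  have hr : ∀ v, ∀ a : ℝ≥0, 0 < a → μ.real {y | a < y v} = (a : ℝ)⁻¹ := fun v a ha => by
    rw [measureReal_def, hμ v a ha, ENNReal.toReal_inv, ENNReal.coe_toReal]
  have hfin : ∀ v, ∀ a : ℝ≥0, 0 < a → μ {y | a < y v} ≠ ∞ := fun v a ha => by
    rw [hμ v a ha]; simpa using ha.ne'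
  set D : V → Set (V → ℝ≥0) := fun v => {z | x v < z v} \ {z | y v < z v} with hD
  have hsub : exceedance x ⊆ exceedance y ∪ ⋃ v, D v := by
    rintro z ⟨v, hv⟩
    by_cases hz : z ∈ exceedance y
    · exact Or.inl hz
    · exact Or.inr (Set.mem_iUnion.2 ⟨v, hv, fun h => hz ⟨v, h⟩⟩)
  have hDfin : ∀ v, μ (D v) ≠ ∞ := fun v => measure_ne_top_of_subset Set.sdiff_subset (hfin v _ (hx v))
  have hUfin : μ (⋃ v, D v) ≠ ∞ :=
    ((measure_iUnion_fintype_le _ _).trans_lt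
      (ENNReal.sum_lt_top.2 fun v _ => (hDfin v).lt_top)).ne
  have hDr : ∀ v, μ.real (D v) ≤ |(x v : ℝ)⁻¹ - (y v : ℝ)⁻¹| := by
    intro v
    rcases le_or_gt (x v) (y v) with h | h
    · have h1 : {z : V → ℝ≥0 | y v < z v} ⊆ {z | x v < z v} := fun z hz => h.trans_lt hz
      rw [hD]
      simp only
      rw [measureReal_sdiff h1 (measurableSet_lt_apply v _) (hfin v _ (hx v)), hr v _ (hx v),
        hr v _ (hy v)]
      exact le_abs_self _
    · have : D v = ∅ := Set.sdiff_eq_empty.2 fun z hz => h.trans hz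
      rw [this, measureReal_empty]
      exact abs_nonneg _
  calc μ.real (exceedance x) ≤ μ.real (exceedance y ∪ ⋃ v, D v) :=
        measureReal_mono hsub (measure_union_ne_top (measure_exceedance_ne_top hμ hy) hUfin)
    _ ≤ μ.real (exceedance y) + μ.real (⋃ v, D v) := measureReal_union_le _ _
    _ ≤ _ := by
        refine add_le_add le_rfl ((measureReal_iUnion_fintype_le _).trans ?_)
        exact Finset.sum_le_sum fun v _ => hDr v

lemma continuousAt_measureReal_exceedance
    (hμ : ∀ v, ∀ a : ℝ≥0, 0 < a → μ {y | a < y v} = (a : ℝ≥0∞)⁻¹)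
    {x : V → ℝ≥0} (hx : ∀ v, 0 < x v) :
    ContinuousAt (fun x => μ.real (exceedance x)) x := by
  have hlim : Tendsto (fun y : V → ℝ≥0 => ∑ v, |(x v : ℝ)⁻¹ - (y v : ℝ)⁻¹|) (𝓝 x) (𝓝 0) := by
    have hc : ContinuousAt (fun y : V → ℝ≥0 => ∑ v, |(x v : ℝ)⁻¹ - (y v : ℝ)⁻¹|) x := by
      refine tendsto_finsetSum _ fun v _ => ?_
      refine (tendsto_const_nhds.sub (Tendsto.inv₀ ?_ ?_)).abs
      · exact (NNReal.continuous_coe.comp (continuous_apply v)).tendsto x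
      · exact_mod_cast (hx v).ne'
    have := hc.tendsto
    simpa using this
  have hpos : ∀ᶠ y : V → ℝ≥0 in 𝓝 x, ∀ v, 0 < y v :=
    eventually_all.2 fun v => (continuous_apply v).tendsto x (Ioi_mem_nhds (hx v))
  refine tendsto_iff_dist_tendsto_zero.2 (squeeze_zero' (Eventually.of_forall fun _ => dist_nonneg)
    ?_ hlim)
  filter_upwards [hpos] with y hy
  rw [Real.dist_eq, abs_sub_le_iff]
  have h1 := measureReal_exceedance_le hμ hx hy
  have h2 := measureReal_exceedance_le hμ hy hx
  simp_rw [abs_sub_comm ((y _ : ℝ)⁻¹)] at h2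
  constructor <;> linarith

/-- Continuous ramps between the exceedance sets of `x` and of a multiple `q x` sandwich the
indicator from both sides; continuity along the ray closes the gap as `q → 1`. -/
lemma tendsto_measureReal_exceedance {Mt : ℝ≥0 → Measure (V → ℝ≥0)} [∀ t, IsFiniteMeasure (Mt t)]
    (hμ : ∀ v, ∀ a : ℝ≥0, 0 < a → μ {y | a < y v} = (a : ℝ≥0∞)⁻¹)
    (hvague : ∀ f : (V → ℝ≥0) → ℝ, Continuous f → (∀ x, |f x| ≤ 1) →
      (∃ ε : ℝ≥0, 0 < ε ∧ ∀ x : V → ℝ≥0, (∀ v, x v < ε) → f x = 0) →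
      Tendsto (fun t => ∫ x, f x ∂(Mt t)) atTop (𝓝 (∫ x, f x ∂μ)))
    {x : V → ℝ≥0} (hx : ∀ v, 0 < x v) :
    Tendsto (fun t => (Mt t).real (exceedance x)) atTop (𝓝 (μ.real (exceedance x))) := by
  have hint : ∀ (m : Measure (V → ℝ≥0)) (x y : V → ℝ≥0), m (exceedance x) ≠ ∞ →
      (∀ v, x v < y v) →
      m.real (exceedance y) ≤ ∫ z, (exceedanceRamp x y z : ℝ) ∂m ∧
        ∫ z, (exceedanceRamp x y z : ℝ) ∂m ≤ m.real (exceedance x) := by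
    intro m x y hm hxy
    have hyx : exceedance y ⊆ exceedance x := fun z ⟨v, hv⟩ => ⟨v, (hxy v).trans hv⟩
    have hmy : m (exceedance y) ≠ ∞ := measure_ne_top_of_subset hyx hm
    have hc := NNReal.continuous_coe.comp (continuous_exceedanceRamp x y)
    have hi : Integrable (fun z => (exceedanceRamp x y z : ℝ)) m :=
      integrable_of_bound_of_eq_zero (b := 1) hm hc
        (fun z => by
          rw [NNReal.abs_eq]; exact_mod_cast min_le_left _ _)
        (fun z hz => by rw [exceedanceRamp_of_notMem hz, NNReal.coe_zero])
    have hind : ∀ S : Set (V → ℝ≥0), MeasurableSet S → ∫ z, S.indicator (1 : (V → ℝ≥0) → ℝ) z ∂m = m.real S :=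
      fun S hS => by rw [integral_indicator_one hS]
    rw [← hind _ (measurableSet_exceedance x), ← hind _ (measurableSet_exceedance y)]
    constructor
    · refine integral_mono ((integrable_indicator_iff (measurableSet_exceedance y)).2
        (integrableOn_const hmy (by simp))) hi fun z => ?_
      by_cases hz : z ∈ exceedance y
      · simp [hz, exceedanceRamp_of_mem hxy hz]
      · simp [hz]
    · refine integral_mono hi ((integrable_indicator_iff (measurableSet_exceedance x)).2
        (integrableOn_const hm (by simp))) fun z => ?_
      by_cases hz : z ∈ exceedance x
      · have h1 : exceedanceRamp x y z ≤ 1 := min_le_left _ _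
        rw [Set.indicator_of_mem hz]
        exact_mod_cast h1
      · simp [hz, exceedanceRamp_of_notMem hz]
  have hconv : ∀ x y : V → ℝ≥0, (∀ v, 0 < x v) →
      Tendsto (fun t => ∫ z, (exceedanceRamp x y z : ℝ) ∂(Mt t)) atTop
        (𝓝 (∫ z, (exceedanceRamp x y z : ℝ) ∂μ)) := by
    intro x y hx
    obtain ⟨ε, hε, hεx⟩ := exists_pos_forall_le hx
    refine hvague _ (NNReal.continuous_coe.comp (continuous_exceedanceRamp x y)) (fun z => ?_)
      ⟨ε, hε, fun z hz => ?_⟩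
    · rw [NNReal.abs_eq]; exact_mod_cast min_le_left _ _
    · rw [exceedanceRamp_of_notMem, NNReal.coe_zero]
      rintro ⟨v, hv⟩
      exact absurd ((hz v).trans_le (hεx v)) hv.not_gt
  have hray : Tendsto (fun p : ℝ≥0 => μ.real (exceedance fun v => p * x v)) (𝓝 1)
      (𝓝 (μ.real (exceedance x))) :=
    (continuousAt_measureReal_exceedance hμ hx).tendsto.comp (tendsto_mul_nhds_one x)
  refine tendsto_order.2 ⟨fun c hc => ?_, fun c hc => ?_⟩
  · obtain ⟨q, hq, hq1⟩ := ((((tendsto_order.1 hray).1 c hc).filter_mono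
      (nhdsWithin_le_nhds (s := Set.Ioi 1))).and self_mem_nhdsWithin).exists
    have hq1 : 1 < q := hq1
    have hxq : ∀ v, x v < q * x v := fun v => lt_mul_of_one_lt_left (hx v) hq1
    have h1 := hint μ x (fun v => q * x v) (measure_exceedance_ne_top hμ hx) hxq
    filter_upwards [(tendsto_order.1 (hconv x (fun v => q * x v) hx)).1 c (hq.trans_le h1.1)]
      with t ht
    exact ht.trans_le (hint (Mt t) x _ (measure_ne_top _ _) hxq).2
  · have : (𝓝[Set.Iio 1] (1 : ℝ≥0)).NeBot := nhdsLT_neBot_of_exists_lt ⟨0, zero_lt_one⟩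
    obtain ⟨p, ⟨hp, hp0⟩, hp1⟩ := (((((tendsto_order.1 hray).2 c hc).and
      (Ioi_mem_nhds zero_lt_one)).filter_mono
      (nhdsWithin_le_nhds (s := Set.Iio 1))).and self_mem_nhdsWithin).exists
    have hp1 : p < 1 := hp1
    have hp0 : 0 < p := hp0
    have hpx0 : ∀ v, 0 < p * x v := fun v => mul_pos hp0 (hx v)
    have hpx : ∀ v, p * x v < x v := fun v => mul_lt_of_lt_one_left (hx v) hp1
    have h1 := hint μ _ x (measure_exceedance_ne_top hμ hpx0) hpx
    filter_upwards [(tendsto_order.1 (hconv (fun v => p * x v) x hpx0)).2 c (h1.2.trans_lt hp)]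
      with t ht
    exact (hint (Mt t) _ x (measure_ne_top _ _) hpx).1.trans_lt ht

end Exceedance

/-! ### Scaled maxima: tightness and existence of the limit distribution. -/

section MaxStable

variable {V : Type*}

/-- The law of the componentwise maximum of `n` independent vectors with law `m`, divided by `n`. -/
noncomputable def scaledMaxLaw (m : Measure (V → ℝ≥0)) (n : ℕ) : Measure (V → ℝ≥0) :=
  (Measure.pi fun _ : Fin n => m).map fun z v => (Finset.univ.sup fun i => z i v) / n

lemma measurable_sup_div (n : ℕ) :
    Measurable fun (z : Fin n → V → ℝ≥0) v => (Finset.univ.sup fun i => z i v) / (n : ℝ≥0) := by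
  refine measurable_pi_lambda _ fun v => Measurable.div_const ?_ _
  have h : Measurable (Finset.univ.sup fun (i : Fin n) (z : Fin n → V → ℝ≥0) => z i v) :=
    Finset.univ.sup_induction (p := Measurable) measurable_const (fun _ h _ h' => h.sup h')
      fun i _ => (measurable_pi_apply v).comp (measurable_pi_apply i)
  convert h using 2 with z
  simp [Finset.sup_apply]

lemma isClosed_setOf_forall_apply_le (x : V → ℝ≥0) : IsClosed {y : V → ℝ≥0 | ∀ v, y v ≤ x v} :=
  isClosed_Iic (a := x)

variable {m : Measure (V → ℝ≥0)} [IsProbabilityMeasure m]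

instance (n : ℕ) : IsProbabilityMeasure (scaledMaxLaw m n) :=
  Measure.isProbabilityMeasure_map (measurable_sup_div n).aemeasurable

variable [Fintype V]

lemma scaledMaxLaw_apply {n : ℕ} (hn : n ≠ 0) (x : V → ℝ≥0) :
    scaledMaxLaw m n {y | ∀ v, y v ≤ x v} = m {y | ∀ v, y v ≤ n * x v} ^ n := by
  have hn0 : (0 : ℝ≥0) < n := by exact_mod_cast Nat.pos_of_ne_zero hn
  rw [scaledMaxLaw, Measure.map_apply (measurable_sup_div n)
    (isClosed_setOf_forall_apply_le x).measurableSet]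
  have : (fun (z : Fin n → V → ℝ≥0) v => (Finset.univ.sup fun i => z i v) / (n : ℝ≥0)) ⁻¹'
      {y | ∀ v, y v ≤ x v} = Set.univ.pi fun _ => {y | ∀ v, y v ≤ n * x v} := by
    ext z
    simp only [Set.mem_preimage, Set.mem_ofPred_eq, Set.mem_pi, Set.mem_univ, forall_const,
      div_le_iff₀' hn0, Finset.sup_le_iff, Finset.mem_univ]
    exact forall_comm
  rw [this, Measure.pi_pi, Finset.prod_const, Finset.card_univ, Fintype.card_fin]

/-- A union bound over the `n` vectors is compensated exactly by the scaling, so the estimate is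
uniform in `n`. -/
lemma scaledMaxLaw_lt_le {C : ℝ≥0} {v : V} (hC : ∀ t : ℝ≥0, (t : ℝ≥0∞) * m {y | t < y v} ≤ C)
    (n : ℕ) {r : ℝ≥0} (hr : 0 < r) : scaledMaxLaw m n {y | r < y v} ≤ (C / r : ℝ≥0) := by
  rw [scaledMaxLaw, Measure.map_apply (measurable_sup_div n) (measurableSet_lt_apply v r)]
  have hsub : (fun (z : Fin n → V → ℝ≥0) v => (Finset.univ.sup fun i => z i v) / (n : ℝ≥0)) ⁻¹'
      {y | r < y v} ⊆ ⋃ i : Fin n, Function.eval i ⁻¹' {y | r * n < y v} := by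
    intro z hz
    have hz : r < (Finset.univ.sup fun i => z i v) / (n : ℝ≥0) := hz
    -- For `n = 0`, division by zero gives `0` and the event is empty.
    rcases Nat.eq_zero_or_pos n with h0 | h0
    · simp [h0] at hz
    · rw [lt_div_iff₀ (by exact_mod_cast h0), Finset.lt_sup_iff] at hz
      obtain ⟨i, _, hi⟩ := hz
      exact Set.mem_iUnion.2 ⟨i, hi⟩
  refine (measure_mono hsub).trans ((measure_iUnion_fintype_le _ _).trans ?_)
  have hev : ∀ i : Fin n, (Measure.pi fun _ : Fin n => m) (Function.eval i ⁻¹' {y | r * n < y v}) =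
      m {y | r * n < y v} := fun i =>
    (measurePreserving_eval (fun _ : Fin n => m) i).measure_preimage
      (measurableSet_lt_apply v _).nullMeasurableSet
  simp_rw [hev]
  rw [Finset.sum_const, Finset.card_univ, Fintype.card_fin, nsmul_eq_mul,
    ENNReal.coe_div hr.ne', ENNReal.le_div_iff_mul_le (by simp [hr.ne']) (by simp)]
  refine le_trans (le_of_eq ?_) (hC (r * n))
  push_cast
  ring

lemma exists_forall_mul_measure_le (htail : ∀ v : V,
    Tendsto (fun t : ℝ≥0 => (t : ℝ≥0∞) * m {y | t < y v}) atTop (𝓝 1)) :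
    ∃ C : ℝ≥0, ∀ v, ∀ t : ℝ≥0, (t : ℝ≥0∞) * m {y | t < y v} ≤ C := by
  have h : ∀ᶠ t : ℝ≥0 in atTop, ∀ v, (t : ℝ≥0∞) * m {y | t < y v} < 2 :=
    eventually_all.2 fun v => (tendsto_order.1 (htail v)).2 2 (by norm_num)
  obtain ⟨T, hT⟩ := eventually_atTop.1 h
  -- Beyond `T` the product is below `2`; up to `T` it is at most `t ≤ T`.
  refine ⟨T + 2, fun v t => ?_⟩
  rcases le_total T t with ht | ht
  · refine (hT t ht v).le.trans ?_
    push_cast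
    exact le_add_self
  · refine (mul_le_of_le_one_right zero_le prob_le_one).trans ?_
    exact_mod_cast ht.trans le_self_add

lemma isTightMeasureSet_scaledMaxLaw (htail : ∀ v : V,
    Tendsto (fun t : ℝ≥0 => (t : ℝ≥0∞) * m {y | t < y v}) atTop (𝓝 1)) :
    IsTightMeasureSet (Set.range (scaledMaxLaw m)) := by
  obtain ⟨C, hC⟩ := exists_forall_mul_measure_le htail
  refine isTightMeasureSet_iff_exists_isCompact_measure_compl_le.2 fun ε hε => ?_
  obtain ⟨δ, hδ0, hδ⟩ := ENNReal.lt_iff_exists_nnreal_btwn.1 hε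
  have hδ0 : 0 < δ := by exact_mod_cast hδ0
  set r : ℝ≥0 := Fintype.card V * C / δ + 1 with hr
  have hr0 : 0 < r := by positivity
  refine ⟨Set.Icc 0 fun _ => r, isCompact_Icc, ?_⟩
  rintro _ ⟨n, rfl⟩
  have hsub : (Set.Icc (0 : V → ℝ≥0) fun _ => r)ᶜ ⊆ exceedance fun _ => r := by
    rw [Set.compl_subset_comm, compl_exceedance]
    exact fun y hy => ⟨fun _ => zero_le, hy⟩
  refine (measure_mono hsub).trans ((measure_exceedance_le _ _).trans ?_)
  refine (Finset.sum_le_sum fun v _ => scaledMaxLaw_lt_le (hC v) n hr0).trans (le_trans ?_ hδ.le)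
  rw [Finset.sum_const, Finset.card_univ, nsmul_eq_mul]
  have h1 : (Fintype.card V : ℝ≥0) * (C / r) ≤ δ := by
    rw [← mul_div_assoc, div_le_iff₀ hr0, hr, mul_add, mul_div_cancel₀ _ hδ0.ne']
    exact le_self_add
  exact_mod_cast h1

/-- By tightness the scaled maxima have a weak limit along an ultrafilter. Closed boxes bound its
distribution function from below by `F x`, slightly larger open boxes from above by `F (q x)`, and
continuity of `F` lets `q` decrease to `1`. -/
lemma exists_isProbabilityMeasure_of_tendsto_pow (htail : ∀ v : V,
    Tendsto (fun t : ℝ≥0 => (t : ℝ≥0∞) * m {y | t < y v}) atTop (𝓝 1)) {F : (V → ℝ≥0) → ℝ≥0∞}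
    (hFc : ∀ x : V → ℝ≥0, (∀ v, 0 < x v) → ContinuousAt F x)
    (hF : ∀ x : V → ℝ≥0, (∀ v, 0 < x v) →
      Tendsto (fun n : ℕ => m {y | ∀ v, y v ≤ n * x v} ^ n) atTop (𝓝 (F x))) :
    ∃ γ : Measure (V → ℝ≥0), IsProbabilityMeasure γ ∧
      ∀ x : V → ℝ≥0, (∀ v, 0 < x v) → γ {y | ∀ v, y v ≤ x v} = F x := by
  set g : ℕ → ProbabilityMeasure (V → ℝ≥0) := fun n => ⟨scaledMaxLaw m n, inferInstance⟩ with hg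
  have hcomp : IsCompact (closure (Set.range g)) := by
    refine isCompact_closure_of_isTightMeasureSet ?_
    convert isTightMeasureSet_scaledMaxLaw htail using 1
    exact (Set.range_comp Subtype.val g).symm
  set U : Ultrafilter ℕ := Ultrafilter.of atTop with hU
  have hUle : (U : Filter ℕ) ≤ atTop := Ultrafilter.of_le _
  obtain ⟨γ, -, hγ⟩ := hcomp.ultrafilter_le_nhds (U.map g) (by
    refine le_principal_iff.2 (Filter.mem_map.2 (univ_mem' fun n => ?_))
    exact subset_closure (Set.mem_range_self n))
  have hγ : Tendsto g U (𝓝 γ) := hγ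
  have hlim : ∀ x : V → ℝ≥0, (∀ v, 0 < x v) →
      Tendsto (fun n => (g n : Measure (V → ℝ≥0)) {y | ∀ v, y v ≤ x v}) U (𝓝 (F x)) := by
    intro x hx
    refine Tendsto.congr' ?_ ((hF x hx).mono_left hUle)
    filter_upwards [(eventually_ne_atTop 0).filter_mono hUle] with n hn
    exact (scaledMaxLaw_apply hn x).symm
  refine ⟨γ, γ.2, fun x hx => le_antisymm ?_ ?_⟩
  · have hray : Tendsto (fun p : ℝ≥0 => F fun v => p * x v) (𝓝[>] 1) (𝓝 (F x)) :=
      ((hFc x hx).tendsto.comp (tendsto_mul_nhds_one x)).mono_left nhdsWithin_le_nhds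
    refine ge_of_tendsto hray ?_
    filter_upwards [self_mem_nhdsWithin] with q hq
    have hq : 1 < q := hq
    have hxq : ∀ v, x v < q * x v := fun v => lt_mul_of_one_lt_left (hx v) hq
    have hop : IsOpen {y : V → ℝ≥0 | ∀ v, y v < q * x v} := by
      have : {y : V → ℝ≥0 | ∀ v, y v < q * x v} = ⋂ v, {y | y v < q * x v} := by
        ext y; simp
      rw [this]
      exact isOpen_iInter_of_finite fun v => isOpen_lt (continuous_apply v) continuous_const
    calc (γ : Measure (V → ℝ≥0)) {y | ∀ v, y v ≤ x v}
        ≤ (γ : Measure (V → ℝ≥0)) {y | ∀ v, y v < q * x v} :=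
          measure_mono fun y hy v => (hy v).trans_lt (hxq v)
      _ ≤ liminf (fun n => (g n : Measure (V → ℝ≥0)) {y | ∀ v, y v < q * x v}) U :=
          ProbabilityMeasure.le_liminf_measure_open_of_tendsto hγ hop
      _ ≤ liminf (fun n => (g n : Measure (V → ℝ≥0)) {y | ∀ v, y v ≤ q * x v}) U :=
          liminf_le_liminf (Eventually.of_forall fun n => measure_mono fun y hy v => (hy v).le)
      _ = F fun v => q * x v := (hlim _ fun v => (hx v).trans (hxq v)).liminf_eq
  · rw [← (hlim x hx).limsup_eq]
    exact ProbabilityMeasure.limsup_measure_closed_le_of_tendsto hγ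
      (isClosed_setOf_forall_apply_le x)

lemma tendsto_measure_le_pow {μ : Measure (V → ℝ≥0)} {x : V → ℝ≥0}
    (h : Tendsto (fun n : ℕ => (n : ℝ) * m.real (exceedance fun v => n * x v)) atTop
      (𝓝 (μ.real (exceedance x)))) :
    Tendsto (fun n : ℕ => m {y | ∀ v, y v ≤ n * x v} ^ n) atTop
      (𝓝 (ENNReal.ofReal (Real.exp (-(μ (exceedance x)).toReal)))) := by
  have h1 : Tendsto (fun n : ℕ => (n : ℝ) * -m.real (exceedance fun v => n * x v)) atTop
      (𝓝 (-μ.real (exceedance x))) := by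
    simpa only [mul_neg] using h.neg
  refine (ENNReal.tendsto_ofReal (Real.tendsto_one_add_pow_exp_of_tendsto h1)).congr fun n => ?_
  rw [← sub_eq_add_neg, ← probReal_compl_eq_one_sub (measurableSet_exceedance _), compl_exceedance,
    ENNReal.ofReal_pow measureReal_nonneg, measureReal_def, ENNReal.ofReal_toReal (measure_ne_top _ _)]

end MaxStable

/-! ### Max-stability and the margins of the limit. -/

section MaxStableLaw

variable {V : Type*} [Fintype V] {m : Measure (V → ℝ≥0)}

/-- Along the subsequence `nk`, the power `nk` at `x` is the `n`-th power of the power `k` at `n x`;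
both limits are known. -/
lemma measure_le_pow_eq {γ : Measure (V → ℝ≥0)} [IsProbabilityMeasure γ]
    (hF : ∀ x : V → ℝ≥0, (∀ v, 0 < x v) →
      Tendsto (fun n : ℕ => m {y | ∀ v, y v ≤ n * x v} ^ n) atTop (𝓝 (γ {y | ∀ v, y v ≤ x v})))
    {n : ℕ} (hn : 1 ≤ n) (x : V → ℝ≥0) :
    γ {y | ∀ v, y v ≤ n * x v} ^ n = γ {y | ∀ v, y v ≤ x v} := by
  have hn0 : (0 : ℝ≥0) < n := by exact_mod_cast hn
  have hpos : ∀ x : V → ℝ≥0, (∀ v, 0 < x v) →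
      γ {y | ∀ v, y v ≤ n * x v} ^ n = γ {y | ∀ v, y v ≤ x v} := by
    intro x hx
    have h1 := (hF x hx).comp (tendsto_id.atTop_mul_const' hn)
    have h2 := ((ENNReal.continuous_pow n).tendsto _).comp
      (hF (fun v => n * x v) fun v => mul_pos hn0 (hx v))
    refine tendsto_nhds_unique h2 (h1.congr fun k => ?_)
    simp only [Function.comp_apply, id, pow_mul, Nat.cast_mul, mul_assoc]
  -- Points with zero coordinates are not covered by the limit hypothesis and are approached from
  -- above.
  have happrox : ∀ c : ℝ≥0, Tendsto (fun k : ℕ => γ {y | ∀ v, y v ≤ c * (x v + 1 / (k + 1))}) atTop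
      (𝓝 (γ {y | ∀ v, y v ≤ c * x v})) := by
    intro c
    have hinter : ⋂ k : ℕ, {y : V → ℝ≥0 | ∀ v, y v ≤ c * (x v + 1 / (k + 1))} =
        {y | ∀ v, y v ≤ c * x v} := by
      ext y
      simp only [Set.mem_iInter, Set.mem_ofPred_eq]
      refine ⟨fun h v => ?_, fun h k v => (h v).trans (mul_le_mul_right le_self_add _)⟩
      have hlim : Tendsto (fun k : ℕ => c * (x v + 1 / ((k : ℝ≥0) + 1))) atTop
          (𝓝 (c * (x v + 0))) :=
        (tendsto_const_nhds.add tendsto_one_div_add_atTop_nhds_zero_nat).const_mul c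
      rw [add_zero] at hlim
      exact ge_of_tendsto' hlim fun k => h k v
    rw [← hinter]
    refine tendsto_measure_iInter_atTop (fun k =>
      (isClosed_setOf_forall_apply_le _).measurableSet.nullMeasurableSet) (fun k l hkl y hy v => ?_)
      ⟨0, measure_ne_top _ _⟩
    refine (hy v).trans (mul_le_mul_right (add_le_add le_rfl ?_) _)
    exact one_div_le_one_div_of_le (by positivity) (by gcongr)
  have h1 := ((ENNReal.continuous_pow n).tendsto _).comp (happrox n)
  have h2 := happrox 1
  simp only [one_mul] at h2
  refine tendsto_nhds_unique h1 (h2.congr fun k => ?_)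
  exact (hpos _ fun v => by positivity).symm

lemma measure_setOf_apply_le_eq {μ γ : Measure (V → ℝ≥0)}
    (hμ : ∀ v, ∀ a : ℝ≥0, 0 < a → μ {y | a < y v} = (a : ℝ≥0∞)⁻¹)
    (hγ : ∀ x : V → ℝ≥0, (∀ v, 0 < x v) →
      γ {y | ∀ v, y v ≤ x v} = ENNReal.ofReal (Real.exp (-(μ (exceedance x)).toReal)))
    (v : V) {r : ℝ≥0} (hr : 0 < r) :
    γ {y | y v ≤ r} = ENNReal.ofReal (Real.exp (-(1 / (r : ℝ)))) := by
  classical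
  -- All thresholds except the one at `v` grow to infinity, so the boxes increase to `{y_v ≤ r}` and
  -- the exceedance sets decrease to `{y_v > r}`.
  set x : ℕ → V → ℝ≥0 := fun k => Function.update (fun _ => (k : ℝ≥0) + 1) v r with hx
  have hxv : ∀ k, x k v = r := fun k => Function.update_self _ _ _
  have hxw : ∀ k w, w ≠ v → x k w = k + 1 := fun k w hw => Function.update_of_ne hw _ _
  have hx0 : ∀ k w, 0 < x k w := by
    intro k w
    rcases eq_or_ne w v with rfl | hw
    · rwa [hxv]
    · rw [hxw k w hw]; positivity
  have hmono : ∀ k l, k ≤ l → ∀ w, x k w ≤ x l w := by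
    intro k l hkl w
    rcases eq_or_ne w v with rfl | hw
    · rw [hxv, hxv]
    · rw [hxw k w hw, hxw l w hw]; gcongr
  have hunion : ⋃ k, {y : V → ℝ≥0 | ∀ w, y w ≤ x k w} = {y | y v ≤ r} := by
    ext y
    simp only [Set.mem_iUnion, Set.mem_ofPred_eq]
    refine ⟨fun ⟨k, hk⟩ => (hk v).trans_eq (hxv k), fun h => ?_⟩
    obtain ⟨k, hk⟩ := exists_nat_ge (∑ w, y w)
    refine ⟨k, fun w => ?_⟩
    rcases eq_or_ne w v with rfl | hw
    · rwa [hxv]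
    · rw [hxw k w hw]
      exact (Finset.single_le_sum (f := y) (fun _ _ => zero_le) (Finset.mem_univ w)).trans
        (hk.trans le_self_add)
  have hinter : ⋂ k, exceedance (x k) = {y | r < y v} := by
    have h1 : {y : V → ℝ≥0 | r < y v} = {y | y v ≤ r}ᶜ := by ext y; simp
    rw [h1, ← hunion, Set.compl_iUnion]
    refine Set.iInter_congr fun k => ?_
    rw [← compl_exceedance, compl_compl]
  have hlim1 : Tendsto (fun k => γ {y | ∀ w, y w ≤ x k w}) atTop (𝓝 (γ {y | y v ≤ r})) := by
    rw [← hunion]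
    exact tendsto_measure_iUnion_atTop fun k l hkl y hy w => (hy w).trans (hmono k l hkl w)
  have hlim2 : Tendsto (fun k => μ (exceedance (x k))) atTop (𝓝 (μ {y | r < y v})) := by
    rw [← hinter]
    refine tendsto_measure_iInter_atTop
      (fun k => (measurableSet_exceedance _).nullMeasurableSet) (fun k l hkl y hy => ?_)
      ⟨0, measure_exceedance_ne_top hμ (hx0 0)⟩
    obtain ⟨w, hw⟩ := hy
    exact ⟨w, (hmono k l hkl w).trans_lt hw⟩
  have hlim3 : Tendsto (fun k => ENNReal.ofReal (Real.exp (-(μ (exceedance (x k))).toReal))) atTop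
      (𝓝 (ENNReal.ofReal (Real.exp (-(1 / (r : ℝ)))))) := by
    rw [hμ v r hr] at hlim2
    have h1 := (ENNReal.tendsto_toReal (by simpa using hr.ne')).comp hlim2
    rw [ENNReal.toReal_inv, ENNReal.coe_toReal, ← one_div] at h1
    exact ENNReal.tendsto_ofReal ((Real.continuous_exp.tendsto _).comp h1.neg)
  refine tendsto_nhds_unique hlim1 (hlim3.congr fun k => ?_)
  exact (hγ _ (hx0 k)).symm

end MaxStableLaw

/-! ### Consistency between roots and assembly of the limit results. -/

section Limit

variable {V : Type*} [Finite V] {G : SimpleGraph V}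

lemma IsBlockGraph.tailLaw_lt (hG : IsBlockGraph G)
    (ν : (C : MaxClique G) → (s : V) → ProbabilityMeasure (↥(C.1 \ {s}) → ℝ≥0)) (u : V)
    {a : ℝ≥0} (ha : 0 < a) : tailLaw hG.1 ν u {x | a < x u} = (a : ℝ≥0∞)⁻¹ :=
  (hG.tailLaw_Ioi ν u (measurableSet_Ioi (a := a))).trans (radialMeasure_Ioi ha)

lemma IsBlockGraph.ae_tailLaw_pos (hG : IsBlockGraph G)
    (ν : (C : MaxClique G) → (s : V) → ProbabilityMeasure (↥(C.1 \ {s}) → ℝ≥0)) (u : V) :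
    ∀ᵐ x ∂(tailLaw hG.1 ν u), 0 < x u := by
  have h : tailLaw hG.1 ν u {x | x u ∈ ({0} : Set ℝ≥0)} = 0 :=
    (hG.tailLaw_Ioi ν u (measurableSet_singleton 0)).trans radialMeasure_zero
  filter_upwards [compl_mem_ae_iff.2 h] with x hx
  exact pos_iff_ne_zero.2 hx

variable {Ω : Type*} [MeasurableSpace Ω] {P : Measure Ω} {X : Ω → V → ℝ≥0}

/-- Each of the two laws is the limit where its own root coordinate is positive, and there it
dominates the other; exchanging the roots gives equality. -/
lemma IsBlockGraph.tailLaw_restrict_comm (hG : IsBlockGraph G)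
    {ν : (C : MaxClique G) → (s : V) → ProbabilityMeasure (↥(C.1 \ {s}) → ℝ≥0)}
    (hM : ∀ u, ∀ O, IsOpen O → tailLaw hG.1 ν u O ≤ liminf (fun t => scaledLaw P X t O) atTop)
    (ht : ∀ u, ∀ a : ℝ≥0, 0 < a → Tendsto (fun t => scaledLaw P X t {x | a < x u}) atTop
      (𝓝 (tailLaw hG.1 ν u {x | a < x u}))) (u v : V) :
    (tailLaw hG.1 ν v).restrict {x | 0 < x u} = (tailLaw hG.1 ν u).restrict {x | 0 < x v} := by
  have hle : ∀ u v S, tailLaw hG.1 ν v (S ∩ {x | 0 < x u}) ≤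
      tailLaw hG.1 ν u (S ∩ {x | 0 < x v}) := by
    intro u v S
    have hfin : ∀ a : ℝ≥0, 0 < a → tailLaw hG.1 ν u {x | a < x u} ≠ ∞ := fun a ha =>
      (hG.tailLaw_lt ν u ha).trans_ne (by simpa using ha.ne')
    calc tailLaw hG.1 ν v (S ∩ {x | 0 < x u})
        ≤ tailLaw hG.1 ν v (S ∩ {x | 0 < x u} ∩ {x | 0 < x v}) := by
          refine measure_mono_ae ?_
          filter_upwards [hG.ae_tailLaw_pos ν v] with x hx hxS using ⟨hxS, hx⟩
      _ ≤ tailLaw hG.1 ν u (S ∩ {x | 0 < x u} ∩ {x | 0 < x v}) :=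
          measure_le_of_forall_isOpen (hM u) (hM v) (ht u) hfin fun x hx => hx.1.2
      _ ≤ tailLaw hG.1 ν u (S ∩ {x | 0 < x v}) := measure_mono fun x hx => ⟨hx.1.1, hx.2⟩
  have := Fintype.ofFinite V
  ext S hS
  refine (Measure.restrict_apply hS).trans (Eq.trans ?_ (Measure.restrict_apply hS).symm)
  exact le_antisymm (hle u v S) (hle v u S)

variable [IsProbabilityMeasure P]

/-- The exponent measure: it restricts to the law of `z A_u` on `{x | 0 < x u}`, and it is the vague
limit of the laws of `X / t`, multiplied by `t`. -/
theorem IsBlockGraph.exists_exponentMeasure (hG : IsBlockGraph G)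
    (hX : Measurable X) (hMarkov : IsMarkovRandomField G P X)
    {κ : (C : MaxClique G) → (s : V) → Kernel ℝ≥0 (↥(C.1 \ {s}) → ℝ≥0)}
    [∀ C s, IsMarkovKernel (κ C s)] (hκ : AreCliqueCondLaws G P X κ)
    {ν : (C : MaxClique G) → (s : V) → ProbabilityMeasure (↥(C.1 \ {s}) → ℝ≥0)}
    (hν : CliqueLimits G κ ν) (hzero : NoReturnFromZero hG.1 κ ν)
    (htail : ∀ v, Tendsto (fun t : ℝ≥0 => (t : ℝ≥0∞) * P {ω | t < X ω v}) atTop (𝓝 1)) :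
    ∃ μ : Measure (V → ℝ≥0), (∀ u, μ.restrict {x | 0 < x u} = tailLaw hG.1 ν u) ∧
      (∀ v, ∀ a : ℝ≥0, 0 < a → μ {y | a < y v} = (a : ℝ≥0∞)⁻¹) ∧
      ∀ f : (V → ℝ≥0) → ℝ, Continuous f → ∀ b : ℝ, (∀ x, |f x| ≤ b) →
        (∃ ε : ℝ≥0, 0 < ε ∧ ∀ x : V → ℝ≥0, (∀ v, x v < ε) → f x = 0) →
        Tendsto (fun t => ∫ x, f x ∂(scaledLaw P X t)) atTop (𝓝 (∫ x, f x ∂μ)) := by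
  have := Fintype.ofFinite V
  have hM : ∀ u, ∀ O, IsOpen O →
      tailLaw hG.1 ν u O ≤ liminf (fun t => scaledLaw P X t O) atTop := fun u O hO =>
    hG.tailLaw_le_liminf hX hMarkov hκ hν hzero (htail u) hO
  have hMa : ∀ u, ∀ a : ℝ≥0, 0 < a → tailLaw hG.1 ν u {x | a < x u} = (a : ℝ≥0∞)⁻¹ :=
    fun u a ha => hG.tailLaw_lt ν u ha
  have ht : ∀ u, ∀ a : ℝ≥0, 0 < a → Tendsto (fun t => scaledLaw P X t {x | a < x u}) atTop
      (𝓝 (tailLaw hG.1 ν u {x | a < x u})) := fun u a ha => by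
    have h := tendsto_scaledLaw_lt hX (htail u) ha
    rwa [← hMa u a ha] at h
  have hμ : ∀ u, (exponentMeasure fun u => tailLaw hG.1 ν u).restrict {x | 0 < x u} =
      tailLaw hG.1 ν u :=
    exponentMeasure_restrict (hG.tailLaw_restrict_comm hM ht) (hG.ae_tailLaw_pos ν)
  refine ⟨_, hμ, fun v a ha => (measure_setOf_lt_of_restrict hμ v a).trans (hMa v a ha),
    fun f hf b hb ⟨ε, hε, hfε⟩ => ?_⟩
  exact tendsto_integral_of_eq_zero_near_zero hM ht
    (fun u a ha => (hMa u a ha).trans_ne (by simpa using ha.ne')) hμ hf hb hε hfε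

lemma tendsto_mul_measureReal_exceedance (hX : Measurable X) {μ : Measure (V → ℝ≥0)}
    (hμ : ∀ v, ∀ a : ℝ≥0, 0 < a → μ {y | a < y v} = (a : ℝ≥0∞)⁻¹)
    (hvague : ∀ f : (V → ℝ≥0) → ℝ, Continuous f → ∀ b : ℝ, (∀ x, |f x| ≤ b) →
        (∃ ε : ℝ≥0, 0 < ε ∧ ∀ x : V → ℝ≥0, (∀ v, x v < ε) → f x = 0) →
        Tendsto (fun t => ∫ x, f x ∂(scaledLaw P X t)) atTop (𝓝 (∫ x, f x ∂μ)))
    {x : V → ℝ≥0} (hx : ∀ v, 0 < x v) :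
    Tendsto (fun n : ℕ => (n : ℝ) * (P.map X).real (exceedance fun v => n * x v)) atTop
      (𝓝 (μ.real (exceedance x))) := by
  have := Fintype.ofFinite V
  have h := (tendsto_measureReal_exceedance hμ (fun f hf hb => hvague f hf 1 hb) hx).comp
    (tendsto_natCast_atTop_atTop (R := ℝ≥0))
  refine h.congr' ?_
  filter_upwards [eventually_gt_atTop 0] with n hn
  have hn0 : (0 : ℝ≥0) < n := by exact_mod_cast hn
  have hset : {ω | (fun v => X ω v / (n : ℝ≥0)) ∈ exceedance x} =
      X ⁻¹' exceedance fun v => n * x v := by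
    ext ω
    simp only [exceedance, Set.mem_ofPred_eq, Set.mem_preimage, lt_div_iff₀' hn0]
  rw [Function.comp_apply, measureReal_def, scaledLaw_apply hX _ (measurableSet_exceedance x),
    hset, measureReal_def, Measure.map_apply hX (measurableSet_exceedance _), ENNReal.toReal_mul]
  simp

/-- The law of `X` is in the max-domain of attraction of a max-stable distribution. -/
theorem exists_isSimpleMaxStable (hX : Measurable X)
    (htail : ∀ v, Tendsto (fun t : ℝ≥0 => (t : ℝ≥0∞) * P {ω | t < X ω v}) atTop (𝓝 1))
    {μ : Measure (V → ℝ≥0)}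
    (hμ : ∀ v, ∀ a : ℝ≥0, 0 < a → μ {y | a < y v} = (a : ℝ≥0∞)⁻¹)
    (hvague : ∀ f : (V → ℝ≥0) → ℝ, Continuous f → ∀ b : ℝ, (∀ x, |f x| ≤ b) →
        (∃ ε : ℝ≥0, 0 < ε ∧ ∀ x : V → ℝ≥0, (∀ v, x v < ε) → f x = 0) →
        Tendsto (fun t => ∫ x, f x ∂(scaledLaw P X t)) atTop (𝓝 (∫ x, f x ∂μ))) :
    ∃ γ : Measure (V → ℝ≥0), IsProbabilityMeasure γ ∧ IsSimpleMaxStable γ ∧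
      (∀ x : V → ℝ≥0, (∀ v, 0 < x v) →
        γ {y | ∀ v, y v ≤ x v} = ENNReal.ofReal (Real.exp (-(μ (exceedance x)).toReal))) ∧
      InMaxDomain P X γ := by
  have := Fintype.ofFinite V
  have := Measure.isProbabilityMeasure_map (μ := P) hX.aemeasurable
  have hF := fun (x : V → ℝ≥0) hx =>
    tendsto_measure_le_pow (tendsto_mul_measureReal_exceedance hX hμ hvague (x := x) hx)
  obtain ⟨γ, hγ, hγF⟩ := exists_isProbabilityMeasure_of_tendsto_pow (m := P.map X)
    (fun v => (htail v).congr fun t => by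
      rw [Measure.map_apply hX (measurableSet_lt_apply v t)]; rfl)
    (fun x hx => by
      have h := continuousAt_measureReal_exceedance hμ hx
      exact ENNReal.continuous_ofReal.continuousAt.comp
        (Real.continuous_exp.continuousAt.comp h.neg)) hF
  refine ⟨γ, hγ, ⟨fun v r hr => measure_setOf_apply_le_eq hμ hγF v hr, fun n hn x => ?_⟩, hγF,
    fun x hx => ?_⟩
  · exact measure_le_pow_eq (m := P.map X) (fun x hx => by rw [hγF x hx]; exact hF x hx) hn x
  · rw [hγF x hx]
    refine (hF x hx).congr fun n => ?_
    rw [Measure.map_apply hX (isClosed_setOf_forall_apply_le _).measurableSet]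
    rfl

end Limit

theorem mainTheorem6 {V : Type*} [Finite V] {Ω : Type*} [MeasurableSpace Ω]
    (P : Measure Ω) [IsProbabilityMeasure P]
    (G : SimpleGraph V) (hG : IsBlockGraph G)
    (X : Ω → V → ℝ≥0) (hX : Measurable X) (hMarkov : IsMarkovRandomField G P X)
    (κ : (C : MaxClique G) → (s : V) → Kernel ℝ≥0 (↥(C.1 \ {s}) → ℝ≥0))
    [∀ C s, IsMarkovKernel (κ C s)] (hκ : AreCliqueCondLaws G P X κ)
    (ν : (C : MaxClique G) → (s : V) → ProbabilityMeasure (↥(C.1 \ {s}) → ℝ≥0))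
    (hν : CliqueLimits G κ ν) (hzero : NoReturnFromZero hG.1 κ ν)
    (htail : ∀ v, Tendsto (fun t : ℝ≥0 => (t : ℝ≥0∞) * P {ω | t < X ω v}) atTop (𝓝 1)) :
    ∃ μ : MZero V,
      Tendsto (fun t : ℝ≥0 => scaledTail P X t) atTop (𝓝 μ) ∧
      IsTailFieldMeasure hG.1 ν μ.1 ∧
      (∀ μ' : Measure (PuncturedOrthant V), IsTailFieldMeasure hG.1 ν μ' → μ' = μ.1) ∧
      ∃ γ : Measure (V → ℝ≥0), IsProbabilityMeasure γ ∧ IsSimpleMaxStable γ ∧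
        (∀ x : V → ℝ≥0, (∀ v, 0 < x v) →
          γ {y | ∀ v, y v ≤ x v} = ENNReal.ofReal
            (Real.exp (-(μ.1 {y : PuncturedOrthant V | ∃ v, x v < y.1 v}).toReal))) ∧
        InMaxDomain P X γ := by
  have := Fintype.ofFinite V
  obtain ⟨μ, hμ, hμa, hvague⟩ := hG.exists_exponentMeasure hX hMarkov hκ hν hzero htail
  have hcomap : ∀ x : V → ℝ≥0,
      μ.comap Subtype.val {y : PuncturedOrthant V | ∃ v, x v < y.1 v} = μ (exceedance x) := fun x =>
    comap_val_apply μ (S := exceedance x) fun ⟨_, hv⟩ => not_lt_zero hv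
  have hfield := isTailFieldMeasure_comap hG.1 ν hμ
  refine ⟨⟨μ.comap Subtype.val, fun B _ ⟨ε, hε, hBε⟩ => ?_⟩, ?_, hfield,
    fun μ' hμ' => hfield.unique hμ', ?_⟩
  -- Exceedance is strict, so a set on which the maximum is at least `ε` is placed inside the
  -- exceedance set at level `ε / 2`.
  · have hε2 : 0 < ε / 2 := half_pos hε
    refine (measure_mono fun y hy => ?_).trans_lt
      ((hcomap fun _ => ε / 2).trans_lt (measure_exceedance_ne_top hμa fun _ => hε2).lt_top)
    obtain ⟨v, hv⟩ := hBε hy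
    exact ⟨v, (half_lt_self hε).trans_le hv⟩
  · refine MZero.tendsto_iff.2 fun f ⟨ε, hε, hfε⟩ => ?_
    have h := hvague (extendZero f) (continuous_extendZero f.continuous hε hfε) ‖f‖
      (fun x => by
        rw [extendZero]
        split
        · exact f.norm_coe_le_norm _
        · simp)
      ⟨ε, hε, fun x hx => by
        rw [extendZero]
        split
        · exact hfε _ hx
        · rfl⟩
    rw [← integral_comap_val] at h
    refine h.congr fun t => ?_
    exact (integral_comap_val (scaledLaw P X t) f).symm
  · obtain ⟨γ, hγ, hstable, hγF, hdom⟩ := exists_isSimpleMaxStable hX htail hμa hvague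
    exact ⟨γ, hγ, hstable, fun x hx => by rw [hγF x hx, ← hcomap x], hdom⟩
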